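/- Work over $\mathbf C$. Let $R=\mathbf C[u_0,\dots,u_n]$ act on $S=\mathbf C[x_0,\dots,x_n]$ by $u_k=\partial/\partial x_k$, written $\varphi\circ F$, and let $\mathbf P^n=\mathrm{Proj}\,R=\mathbf P(S_1)$. A closed subscheme $Z\subseteq\mathbf P^n$ with saturated ideal $I_Z\subseteq R$ is *apolar* to a subspace $\Lambda\subseteq S_d$ if $\varphi\circ F=0$ for all $\varphi\in I_Z$, $F\in\Lambda$. A zero-dimensional scheme $Z\subseteq\mathbf P^n$ of length $s$ is *resolution-general* if the graded Betti numbers of $R/I_Z$ equal those of the ideal of $s$ general points of $\mathbf P^n$. A *polar $s$-hedron* of $\Lambda$ is a zero-dimensional scheme of length $s$ which is apolar to $\Lambda$ and resolution-general. A quadruple $(n,d,r,s)$ with $s\ge r\binom{n+d}{d}/(n+r)$ is *nondegenerate* if a general $\Lambda\in G(r,S_d)$ admits a polar $s$-hedron. A *grove* for points $p_1,\dots,p_8\in\mathbf P^1$ and $Q_1,\dots,Q_8\in\mathbf P^3$ is a linear system $\Gamma\subseteq\mathbf P H^0(\mathbf P^3,\mathcal O(3))$ of projective dimension $t\in\{0,1\}$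 whose base locus contains all $Q_i$, and such that either $t=0$ and the generator of $\Gamma$ is singular at all $Q_i$, or $t=1$ and there is an isomorphism $\gamma:\mathbf P^1\to\Gamma$ such that the surface $\gamma(p_i)$ is singular at $Q_i$ for every $i$. **Theorem.** 1. The quadruple $(3,3,2,8)$ is nondegenerate: a general pencil of cubic surfaces in $\mathbf P^3$ admits a polar octahedron. 2. For the points $$\begin{array}{llll}Q_1=[1,0,0,0],&Q_2=[0,1,0,0],&Q_3=[0,0,1,0],&Q_4=[0,0,0,1],\\ Q_5=[-1,1,1,1],&Q_6=[1,-1,1,1],&Q_7=[1,1,-1,1],&Q_8=[1,1,1,-1]\end{array}$$ of $\mathbf P^3$ and general points $p_1,\dots,p_8\in\mathbf P^1$ there is no grove for the data $(p_i)$, $(Q_i)$. 3. Let $E$ be an elliptic curve over $\mathbf C$, $\mathcal M$ a line bundle on $E$ of degree $4$, and $Q_1,\dots,Q_8$ distinct points of $E$. Then there are points $p_1,\dots,p_8\in\mathbf P^1$ such that no morphism $f:E\to\mathbf P^1$ satisfies both of the following conditions: (A) $2\le\deg f\le4$, and if $\deg f=4$ then $f^*\mathcal O_{\mathbf P^1}(1)\simeq\mathcal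 M$; (B) $f(Q_i)=p_i$ for at least $4+\deg f$ values of $i$. -/

import Mathlib

open MvPolynomial

noncomputable section

namespace PolarPolyhedra

/-! ### Apolarity

For `n : ℕ` both polynomial rings `R = ℂ[u₀, …, uₙ]` and `S = ℂ[x₀, …, xₙ]` are
`MvPolynomial (Fin (n + 1)) ℂ`.  A point of `ℙⁿ = ℙ(S₁) = Proj R` is given by a nonzero vector
`L : Fin (n + 1) → ℂ`, its homogeneous coordinates (the coefficients of the linear form
`∑ L k • x k`). -/

/-- The monomial differential operator `∂₀ ^ m₀ ∘ ⋯ ∘ ∂ₙ ^ mₙ`. -/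
def diffMonomial {n : ℕ} (m : Fin (n + 1) →₀ ℕ) :
    Module.End ℂ (MvPolynomial (Fin (n + 1)) ℂ) :=
  (List.ofFn fun k : Fin (n + 1) =>
    ((pderiv k).toLinearMap : Module.End ℂ (MvPolynomial (Fin (n + 1)) ℂ)) ^ m k).prod

/-- The internal product `φ ∘ F = φ(∂/∂x₀, …, ∂/∂xₙ) F`. -/
def internalProduct {n : ℕ} (φ F : MvPolynomial (Fin (n + 1)) ℂ) :
    MvPolynomial (Fin (n + 1)) ℂ :=
  ∑ m ∈ φ.support, φ.coeff m • diffMonomial m F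

/-- `Z` is apolar to `Λ`: the ideal `I` of `Z` is contained in `Λ^⊥`. -/
def IsApolar {n : ℕ} (I : Ideal (MvPolynomial (Fin (n + 1)) ℂ))
    (Λ : Submodule ℂ (MvPolynomial (Fin (n + 1)) ℂ)) : Prop :=
  ∀ φ ∈ I, ∀ F ∈ Λ, internalProduct φ F = 0

/-! ### Zero-dimensional subschemes of `ℙⁿ` and their graded Betti numbers

A closed subscheme of `ℙⁿ = Proj R` is given by its saturated homogeneous ideal. -/

/-- The degree `k` part of `R / I`. -/
def quotientPiece {n : ℕ} (I : Ideal (MvPolynomial (Fin (n + 1)) ℂ)) (k : ℕ) :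
    Submodule ℂ (MvPolynomial (Fin (n + 1)) ℂ ⧸ I) :=
  (homogeneousSubmodule (Fin (n + 1)) ℂ k).map (Ideal.Quotient.mkₐ ℂ I).toLinearMap

/-- `I` is saturated with respect to the irrelevant ideal. -/
def IsSaturated {n : ℕ} (I : Ideal (MvPolynomial (Fin (n + 1)) ℂ)) : Prop :=
  ∀ f : MvPolynomial (Fin (n + 1)) ℂ,
    (∃ k : ℕ, ∀ g : MvPolynomial (Fin (n + 1)) ℂ, g.IsHomogeneous k → g * f ∈ I) → f ∈ I

/-- `I` is the saturated homogeneous ideal of a zero-dimensional subscheme of `ℙⁿ` of length `s`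
(the Hilbert polynomial of `R / I` is the constant `s`). -/
structure IsZeroDimScheme {n : ℕ} (s : ℕ) (I : Ideal (MvPolynomial (Fin (n + 1)) ℂ)) : Prop where
  homogeneous : ∀ f ∈ I, ∀ k, homogeneousComponent k f ∈ I
  saturated : IsSaturated I
  length : ∃ k₀ : ℕ, ∀ k ≥ k₀, Module.finrank ℂ (quotientPiece I k) = s

/-- The Koszul differential on `⋀ ℂ^(n+1) ⊗ R / I`; an element `∑ c_T e_T` is given by its
coefficients `c`, and `d e_T = ∑_{k ∈ T} (-1)^#{t ∈ T | t < k} x_k e_{T \ k}`. -/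
def koszulD {n : ℕ} (I : Ideal (MvPolynomial (Fin (n + 1)) ℂ)) :
    (Finset (Fin (n + 1)) → MvPolynomial (Fin (n + 1)) ℂ ⧸ I) →ₗ[ℂ]
      (Finset (Fin (n + 1)) → MvPolynomial (Fin (n + 1)) ℂ ⧸ I) where
  toFun c := fun T => ∑ k ∈ Tᶜ,
    (-1) ^ (T.filter fun t => t < k).card * (Ideal.Quotient.mk I (X k) * c (insert k T))
  map_add' c c' := by
    funext T
    simp only [Pi.add_apply, mul_add, Finset.sum_add_distrib]
  map_smul' a c := by
    funext T
    simp only [Pi.smul_apply, mul_smul_comm, Finset.smul_sum, RingHom.id_apply]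

/-- The internal degree `j` part `⋀^i ℂ^(n+1) ⊗ (R / I)_(j - i)` of the Koszul complex. -/
def koszulChain {n : ℕ} (I : Ideal (MvPolynomial (Fin (n + 1)) ℂ)) (i j : ℕ) :
    Submodule ℂ (Finset (Fin (n + 1)) → MvPolynomial (Fin (n + 1)) ℂ ⧸ I) :=
  Submodule.pi Set.univ fun T =>
    if T.card = i ∧ i ≤ j then quotientPiece I (j - i) else ⊥

/-- The graded Betti number `β_{i,j} = dim Tor_i(R / I, ℂ)_j` of `R / I`, that is, the number of
generators of degree `j` in the `i`-th step of the minimal free resolution, computed as the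
dimension of the Koszul homology of `R / I`. -/
def bettiNumber {n : ℕ} (I : Ideal (MvPolynomial (Fin (n + 1)) ℂ)) (i j : ℕ) : ℕ :=
  Module.finrank ℂ
    (↥(koszulChain I i j ⊓ LinearMap.ker (koszulD I)) ⧸
      ((koszulChain I (i + 1) j).map (koszulD I)).submoduleOf
        (koszulChain I i j ⊓ LinearMap.ker (koszulD I)))

/-- The homogeneous ideal of a set of points of `ℙⁿ`. -/
def pointsIdeal {n s : ℕ} (L : Fin s → Fin (n + 1) → ℂ) :
    Ideal (MvPolynomial (Fin (n + 1)) ℂ) :=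
  Ideal.span {f | (∃ k, f.IsHomogeneous k) ∧ ∀ i, eval (L i) f = 0}

/-! ### General points -/

/-- `P` holds for `s` general points of `ℙⁿ`: it holds on a nonempty Zariski open subset of
`(ℙⁿ)^s`, expressed in homogeneous coordinates. -/
def ForGeneralPoints (n s : ℕ) (P : (Fin s → Fin (n + 1) → ℂ) → Prop) : Prop :=
  ∃ Φ : MvPolynomial (Fin s × Fin (n + 1)) ℂ, Φ ≠ 0 ∧
    ∀ L : Fin s → Fin (n + 1) → ℂ, (∀ i, L i ≠ 0) →
      eval (fun q => L q.1 q.2) Φ ≠ 0 → P L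

/-- `P` holds for a general point `Λ` of the Grassmannian `G(r, S_d)`: it holds on a nonempty
Zariski open subset.  The open subset is described by its preimage in the space of bases
`F₁, …, F_r`, through a nonzero polynomial in the coefficients of the `F_i`. -/
def ForGeneralSystem (n d r : ℕ)
    (P : Submodule ℂ (MvPolynomial (Fin (n + 1)) ℂ) → Prop) : Prop :=
  ∃ Φ : MvPolynomial (Fin r × {m : Fin (n + 1) →₀ ℕ // m.degree = d}) ℂ, Φ ≠ 0 ∧
    ∀ F : Fin r → MvPolynomial (Fin (n + 1)) ℂ,
      (∀ i, (F i).IsHomogeneous d) → LinearIndependent ℂ F →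
        eval (fun q => (F q.1).coeff q.2.1) Φ ≠ 0 → P (Submodule.span ℂ (Set.range F))

/-! ### Polar polyhedra and nondegeneracy -/

/-- The scheme with ideal `I` has the same graded Betti numbers as `s` general points. -/
def IsResolutionGeneral {n : ℕ} (s : ℕ) (I : Ideal (MvPolynomial (Fin (n + 1)) ℂ)) : Prop :=
  ForGeneralPoints n s fun L => ∀ i j, bettiNumber I i j = bettiNumber (pointsIdeal L) i j

/-- `I` is the ideal of a polar `s`-hedron of `Λ`. -/
structure IsPolarPolyhedron {n : ℕ} (s : ℕ) (Λ : Submodule ℂ (MvPolynomial (Fin (n + 1)) ℂ))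
    (I : Ideal (MvPolynomial (Fin (n + 1)) ℂ)) : Prop where
  scheme : IsZeroDimScheme s I
  apolar : IsApolar I Λ
  resolutionGeneral : IsResolutionGeneral s I

/-- The quadruple `(n, d, r, s)` is nondegenerate: `s ≥ r * binom (n + d) d / (n + r)`, and a
general `Λ` in `G(r, S_d)` admits a polar `s`-hedron. -/
def Nondegenerate (n d r s : ℕ) : Prop :=
  r * (n + d).choose d ≤ s * (n + r) ∧
    ForGeneralSystem n d r fun Λ => ∃ I, IsPolarPolyhedron s Λ I

/-! ### Groves -/

/-- The hypersurface `F = 0` is singular at the point `q`. -/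
def SingularAt (F : MvPolynomial (Fin 4) ℂ) (q : Fin 4 → ℂ) : Prop :=
  eval q F = 0 ∧ ∀ k, eval q (pderiv k F) = 0

/-- A grove for points `p₁, …, p₈` of `ℙ¹` and `Q₁, …, Q₈` of `ℙ³`: a linear system
`ℙ(Γ)` of cubic surfaces, of projective dimension `t = dim Γ - 1`.  An isomorphism `ℙ¹ ≃ ℙ(Γ)` is
induced by a linear isomorphism `ℂ² ≃ Γ`. -/
structure IsGrove (p : Fin 8 → Fin 2 → ℂ) (Q : Fin 8 → Fin 4 → ℂ)
    (Γ : Submodule ℂ (MvPolynomial (Fin 4) ℂ)) : Prop where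
  cubics : Γ ≤ homogeneousSubmodule (Fin 4) ℂ 3
  base : ∀ F ∈ Γ, ∀ i, eval (Q i) F = 0
  singular :
    (Module.finrank ℂ Γ = 1 ∧ ∀ F ∈ Γ, ∀ i, SingularAt F (Q i)) ∨
    (Module.finrank ℂ Γ = 2 ∧ ∃ γ : (Fin 2 → ℂ) ≃ₗ[ℂ] Γ, ∀ i, SingularAt (γ (p i)) (Q i))

/-- The points `Q₁, …, Q₈` of `ℙ³`, in the coordinates `w, x, y, z`. -/
def octad : Fin 8 → Fin 4 → ℂ :=
  ![![1, 0, 0, 0], ![0, 1, 0, 0], ![0, 0, 1, 0], ![0, 0, 0, 1],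
    ![-1, 1, 1, 1], ![1, -1, 1, 1], ![1, 1, -1, 1], ![1, 1, 1, -1]]

/-! ### Maps from an elliptic curve to `ℙ¹`

The points of the smooth projective curve with function field `K` are the places of `K / ℂ`, and
its nonconstant morphisms to `ℙ¹` are the elements of `K` outside `ℂ`. -/

/-- A place of the function field `K / ℂ`, given by its local ring. -/
@[ext]
structure Place (K : Type*) [Field K] [Algebra ℂ K] where
  localRing : ValuationSubring K
  const_mem : ∀ c : ℂ, algebraMap ℂ K c ∈ localRing
  ne_top : localRing ≠ ⊤

section

variable {K : Type*} [Field K] [Algebra ℂ K]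

/-- `g` has order `m` at `P`: `g = u * t ^ m` with `t` a uniformizer and `u` a unit at `P`. -/
def Place.HasOrder (P : Place K) (g : K) (m : ℤ) : Prop :=
  ∃ (t : P.localRing) (u : P.localRingˣ),
    IsLocalRing.maximalIdeal P.localRing = Ideal.span {t} ∧
      g = ((u : P.localRing) : K) * (t : K) ^ m

/-- The morphism `f = [f : 1]` takes the value `[a 0 : a 1]` at the point `P`. -/
def Place.TakesValue (P : Place K) (f : K) (a : Fin 2 → ℂ) : Prop :=
  (a 1 ≠ 0 ∧ P.localRing.valuation (f - algebraMap ℂ K (a 0 / a 1)) < 1) ∨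
    (a 1 = 0 ∧ 1 < P.localRing.valuation f)

/-- The degree `[K : ℂ(f)]` of the morphism `f` (for constant `f` the value is `0`). -/
def morphismDegree (f : K) : ℕ :=
  Module.finrank (IntermediateField.adjoin ℂ {f}) K

/-- `f^* 𝒪(1) ≅ 𝒪(D)`: the divisor `D` is linearly equivalent to the polar divisor of `f`. -/
def PullbackIso (f : K) (D : Place K →₀ ℤ) : Prop :=
  ∃ g : K, g ≠ 0 ∧ ∀ P : Place K, ∃ m : ℤ,
    P.HasOrder f m ∧ P.HasOrder g (D P - max (-m) 0)

end

end PolarPolyhedra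

end

noncomputable section

namespace PolarPolyhedra


/-! ### Generic ranks -/

/-! Parts 1 and 2 come from one fact of linear algebra. Send eight vectors `L a` of ℂ⁴ and weights
`p a` in ℂ² to the pair of cubics `∑ a, p a i • linearForm (L a) ^ 3`. As in Terracini's lemma, the
annihilator of the image of the differential at `(Q, p)` consists, up to multinomial factors, of the
pairs `(G 0, G 1)` of cubics that vanish at every `Q a` and satisfy `∑ r, p a r • dG r (Q a) = 0`.
Every grove yields a nonzero pair of this kind, and `octad_cubics_eq_zero` shows that the octad with
one special marking `p` admits none.

Full rank is an open condition on `p`, so general points of ℙ¹ carry no grove. The same fact makes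
the power sum map submersive at one point, hence dominant (`aeval_injective_of_jacobian`). By
Chevalley's theorem the image of any nonempty open set then contains a nonempty open set of pairs
(`exists_eval_eq_of_aeval_injective`). A pencil spanned by two such power sums is annihilated by the
ideal of the eight points. The open set is chosen so that these points have generic Betti numbers,
which is possible because Betti numbers of points are expressed by ranks of matrices polynomial in
the points (`exists_isResolutionGeneral`).

Part 3 is a parameter count. Quotients of two elements of an `n`-dimensional space of functions
depend on `2n - 1` parameters, so they cannot take `2n` general values; if the space moves in a
`d`-dimensional family, `2n + d` general values are out of reach. A morphism of degree 2 is a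
quotient of elements of L(3∞), of dimension 3: six values. In degree 3 it is either such a quotient
or a quotient of elements of L(4∞) with a common affine zero, that is, of elements of a
3-dimensional space moving with a point of the curve: seven values. In degree 4 with fixed line
bundle the space has dimension at most 4: eight values. These representations need no Riemann-Roch
theorem. The `deg f + 1` basis elements of L((deg f + 1)∞) are dependent over ℂ(f), and the leading
coefficient of a relation in powers of `f` is a denominator of `f` in that space
(`exists_sections_eq_div`). Smoothness enters as normality of the affine coordinate ring, which lets
valuations decide membership in L(m∞). -/

theorem exists_mul_mul_eq_one_of_rank {ι κ : Type*} [Fintype ι] [Fintype κ] [DecidableEq ι]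
    (M : Matrix ι κ ℂ) :
    ∃ (B : Matrix (Fin M.rank) ι ℂ) (C : Matrix κ (Fin M.rank) ℂ), B * M * C = 1 := by
  let b : Module.Basis (Fin M.rank) ℂ (LinearMap.range M.mulVecLin) :=
    Module.finBasisOfFinrankEq ℂ _ rfl
  have hb : ∀ j, ∃ c, M.mulVecLin c = b j := fun j => (b j).2
  choose c hc using hb
  obtain ⟨g, hg⟩ := LinearMap.exists_extend b.equivFun.toLinearMap
  refine ⟨LinearMap.toMatrix' g, Matrix.of fun k j => c j k, ?_⟩
  ext i j
  have h1 : (M * Matrix.of fun k j => c j k).col j = (b j : ι → ℂ) := by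
    rw [← hc]; rfl
  have h2 : g (b j : ι → ℂ) = Pi.single j 1 := by
    have := LinearMap.congr_fun hg (b j)
    simpa [Finsupp.single_eq_pi_single] using this
  have h3 : (LinearMap.toMatrix' g * M * Matrix.of fun k j => c j k) i j
      = (LinearMap.toMatrix' g).mulVec ((M * Matrix.of fun k j => c j k).col j) i := by
    rw [Matrix.mul_assoc]; rfl
  rw [h3, h1, LinearMap.toMatrix'_mulVec, h2, Matrix.one_apply, Pi.single_apply]

/-- Lower semicontinuity of rank in the form of a single inequation: constant matrices that turn the
value at `x₀` into an identity matrix are multiplied onto `A`, and `Φ` is the determinant of the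
product. -/
theorem exists_rank_le {σ ι κ : Type*} [Fintype ι] [Fintype κ]
    (A : Matrix ι κ (MvPolynomial σ ℂ)) (x₀ : σ → ℂ) :
    ∃ Φ : MvPolynomial σ ℂ, eval x₀ Φ ≠ 0 ∧
      ∀ x, eval x Φ ≠ 0 → (A.map (eval x₀)).rank ≤ (A.map (eval x)).rank := by
  classical
  obtain ⟨B, D, h⟩ := exists_mul_mul_eq_one_of_rank (A.map (eval x₀))
  let B' : Matrix _ ι (MvPolynomial σ ℂ) := Matrix.map B C
  let D' : Matrix κ _ (MvPolynomial σ ℂ) := Matrix.map D C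
  let N : Matrix _ _ (MvPolynomial σ ℂ) := B' * A * D'
  have key : ∀ x, N.map (eval x) = B * A.map (eval x) * D := by
    intro x
    have hB : B'.map (eval x) = B := by ext; simp [B']
    have hD : D'.map (eval x) = D := by ext; simp [D']
    rw [← hB, ← hD, ← Matrix.map_mul, ← Matrix.map_mul]
  have hdet : ∀ x, eval x N.det = (B * A.map (eval x) * D).det := by
    intro x
    rw [RingHom.map_det, RingHom.mapMatrix_apply, key]
  refine ⟨N.det, by rw [hdet, h]; simp, fun x hx => ?_⟩
  rw [hdet] at hx
  have h1 := Matrix.rank_of_isUnit _ ((Matrix.isUnit_iff_isUnit_det _).2 hx.isUnit)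
  rw [Fintype.card_fin] at h1
  calc _ = _ := h1.symm
    _ ≤ _ := (Matrix.rank_mul_le_left _ _).trans (Matrix.rank_mul_le_right _ _)

/-- The maximal rank is attained at some `x₀`, and by semicontinuity on an open set around it. -/
theorem exists_rank_eq {σ ι κ : Type*} [Fintype ι] [Fintype κ]
    (A : Matrix ι κ (MvPolynomial σ ℂ)) :
    ∃ Φ : MvPolynomial σ ℂ, Φ ≠ 0 ∧ ∀ x y, eval x Φ ≠ 0 → eval y Φ ≠ 0 →
      (A.map (eval x)).rank = (A.map (eval y)).rank := by
  let S : Set ℕ := Set.range fun x => (A.map (eval x)).rank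
  have hbdd : BddAbove S := ⟨Fintype.card κ, by
    rintro _ ⟨x, rfl⟩; exact Matrix.rank_le_card_width _⟩
  obtain ⟨x₀, hx₀⟩ : sSup S ∈ S := Nat.sSup_mem (Set.range_nonempty _) hbdd
  obtain ⟨Φ, h0, h⟩ := exists_rank_le A x₀
  have hS : ∀ x, eval x Φ ≠ 0 → (A.map (eval x)).rank = sSup S := fun x hx =>
    le_antisymm (le_csSup hbdd ⟨x, rfl⟩) (hx₀ ▸ h x hx)
  refine ⟨Φ, ?_, fun x y hx hy => (hS x hx).trans (hS y hy).symm⟩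
  rintro rfl
  simp at h0

/-! ### Dominant polynomial maps -/

theorem pderiv_aeval {σ τ : Type*} [Fintype τ] (ψ : τ → MvPolynomial σ ℂ) (j : σ)
    (P : MvPolynomial τ ℂ) :
    pderiv j (aeval ψ P) = ∑ t, aeval ψ (pderiv t P) * pderiv j (ψ t) := by
  classical
  induction P using MvPolynomial.induction_on with
  | C a => simp
  | add p q hp hq => simp only [map_add, hp, hq, add_mul, Finset.sum_add_distrib]
  | mul_X p t hp =>
    have h1 : ∀ i, aeval ψ (pderiv i (p * X t)) * pderiv j (ψ i) =
        aeval ψ (pderiv i p) * pderiv j (ψ i) * ψ t +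
          if i = t then aeval ψ p * pderiv j (ψ t) else 0 := by
      intro i
      rw [pderiv_mul, map_add, map_mul, map_mul, aeval_X]
      split_ifs with hi
      · subst hi
        rw [pderiv_X_self, map_one]; ring
      · rw [pderiv_X_of_ne (Ne.symm hi), map_zero]; ring
    rw [Finset.sum_congr rfl fun i _ => h1 i, Finset.sum_add_distrib, ← Finset.sum_mul, ← hp,
      Finset.sum_ite_eq' Finset.univ t, if_pos (Finset.mem_univ t), map_mul, aeval_X, pderiv_mul]

theorem totalDegree_pderiv_le {σ : Type*} (P : MvPolynomial σ ℂ) (j : σ) :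
    (pderiv j P).totalDegree ≤ P.totalDegree - 1 := by
  classical
  refine Finset.sup_le fun m hm => ?_
  rw [mem_support_iff, coeff_pderiv] at hm
  have h1 := le_totalDegree (mem_support_iff.2 (left_ne_zero_of_mul hm))
  rw [Finsupp.sum_add_index' (fun _ => rfl) fun _ _ _ => rfl, Finsupp.sum_single_index rfl] at h1
  omega

theorem eq_C_of_pderiv_eq_zero {σ : Type*} (P : MvPolynomial σ ℂ) (h : ∀ j, pderiv j P = 0) :
    P = C (coeff 0 P) := by
  classical
  ext m
  rw [coeff_C]
  split_ifs with hm
  · rw [hm]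
  · obtain ⟨j, hj⟩ : ∃ j, m j ≠ 0 := by
      by_contra! hcon
      exact hm (Finsupp.ext fun j => (hcon j).symm)
    have h1 := coeff_pderiv (i := j) P (m - Finsupp.single j 1)
    rw [h j, coeff_zero, tsub_add_cancel_of_le (by simpa using Nat.one_le_iff_ne_zero.2 hj)] at h1
    have h2 : ((((m - Finsupp.single j 1 : σ →₀ ℕ) j : ℕ) : ℂ) + 1) ≠ 0 :=
      Nat.cast_add_one_ne_zero _
    exact (mul_eq_zero.1 h1.symm).resolve_right h2

/-- Jacobian criterion in characteristic zero. If `P(ψ) = 0`, the chain rule says that the vector of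
the `(∂P)(ψ)` is killed by the Jacobian matrix, which has a right inverse at `x₀` and therefore
becomes a square matrix of nonzero determinant after multiplication by a constant matrix. So all
partials of `P` are again relations, of smaller degree; by induction they vanish, and a constant
relation is zero. -/
theorem aeval_injective_of_jacobian {σ τ : Type*} [Fintype σ] [Fintype τ]
    (ψ : τ → MvPolynomial σ ℂ) (x₀ : σ → ℂ)
    (h : ∀ c : τ → ℂ, (∀ j, ∑ t, c t * eval x₀ (pderiv j (ψ t)) = 0) → c = 0) :
    Function.Injective (aeval ψ : MvPolynomial τ ℂ →ₐ[ℂ] MvPolynomial σ ℂ) := by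
  classical
  let J : Matrix τ σ (MvPolynomial σ ℂ) := Matrix.of fun t j => pderiv j (ψ t)
  have hli : LinearIndependent ℂ (J.map (eval x₀)).row := by
    rw [← Matrix.vecMul_injective_iff]
    refine (injective_iff_map_eq_zero (Matrix.vecMulLinear (J.map (eval x₀)))).2 fun c hc => ?_
    exact h c fun j => congrFun hc j
  have hrk : (J.map (eval x₀)).rank = Fintype.card τ := hli.rank_matrix
  have hsurj : Function.Surjective (J.map (eval x₀)).mulVec := by
    have : LinearMap.range (J.map (eval x₀)).mulVecLin = ⊤ := by
      apply Submodule.eq_top_of_finrank_eq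
      rw [Module.finrank_fintype_fun_eq_card]; exact hrk
    exact LinearMap.range_eq_top.1 this
  obtain ⟨D, hD⟩ := Matrix.mulVec_surjective_iff_exists_right_inverse.1 hsurj
  let D' : Matrix σ τ (MvPolynomial σ ℂ) := Matrix.map D C
  have hD' : D'.map (eval x₀) = D := by ext; simp [D']
  have hdet : (J * D').det ≠ 0 := by
    intro h0
    have h1 : (J * D').map (eval x₀) = 1 := by
      rw [Matrix.map_mul, hD', hD]
    have h2 := congrArg (eval x₀) h0
    rw [RingHom.map_det, RingHom.mapMatrix_apply, h1] at h2
    simp at h2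
  rw [injective_iff_map_eq_zero]
  suffices H : ∀ d : ℕ, ∀ P : MvPolynomial τ ℂ, P.totalDegree < d → aeval ψ P = 0 → P = 0 from
    fun P hP => H _ P (Nat.lt_succ_self _) hP
  intro d
  induction d with
  | zero => intro P hP; omega
  | succ d ih =>
    intro P hP hP0
    have hv : (fun t => aeval ψ (pderiv t P)) = (0 : τ → MvPolynomial σ ℂ) := by
      refine Matrix.eq_zero_of_vecMul_eq_zero hdet ?_
      rw [← Matrix.vecMul_vecMul]
      have : Matrix.vecMul (fun t => aeval ψ (pderiv t P)) J = 0 := by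
        funext j
        have := pderiv_aeval ψ j P
        rw [hP0, map_zero] at this
        exact this.symm
      rw [this, Matrix.zero_vecMul]
    have hconst : P.totalDegree = 0 → P = 0 := by
      intro h0
      rw [totalDegree_eq_zero_iff_eq_C] at h0
      rw [h0] at hP0 ⊢
      simpa using hP0
    by_cases h0 : P.totalDegree = 0
    · exact hconst h0
    · apply hconst
      have hz : ∀ t, pderiv t P = 0 := fun t => ih _
        (by have := totalDegree_pderiv_le P t; omega) (congrFun hv t)
      rw [eq_C_of_pderiv_eq_zero P hz, totalDegree_C]

/-- Chevalley's theorem: the image of the basic open set of `v` is constructible, and by injectivity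
it contains the generic point. The locally closed piece containing that point has only trivial
equations, so it is a basic open set. -/
theorem exists_eval_eq_of_aeval_injective {σ τ : Type*} [Finite σ] [Finite τ]
    (ψ : τ → MvPolynomial σ ℂ)
    (hψ : Function.Injective (aeval ψ : MvPolynomial τ ℂ →ₐ[ℂ] MvPolynomial σ ℂ))
    (v : MvPolynomial σ ℂ) (hv : v ≠ 0) :
    ∃ u : MvPolynomial τ ℂ, u ≠ 0 ∧ ∀ y : τ → ℂ, eval y u ≠ 0 →
      ∃ x : σ → ℂ, (∀ t, eval x (ψ t) = y t) ∧ eval x v ≠ 0 := by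
  classical
  let f : MvPolynomial τ ℂ →+* MvPolynomial σ ℂ := (aeval ψ).toRingHom
  have hft : f.FiniteType := by
    apply RingHom.FiniteType.of_comp_finiteType (f := (C : ℂ →+* MvPolynomial τ ℂ))
    have : f.comp C = algebraMap ℂ (MvPolynomial σ ℂ) := by
      ext; simp [f]
    rw [this]
    exact RingHom.finiteType_algebraMap.2 inferInstance
  have hfp : f.FinitePresentation := RingHom.FinitePresentation.of_finiteType.1 hft
  have hcon := PrimeSpectrum.isConstructible_comap_image hfp
    (PrimeSpectrum.isConstructible_basicOpen (f := v))
  obtain ⟨S, hS⟩ := PrimeSpectrum.exists_constructibleSetData_iff.2 hcon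
  have hbot : (⊥ : PrimeSpectrum (MvPolynomial τ ℂ)) ∈ S.toSet := by
    rw [hS]
    refine ⟨⊥, ?_, ?_⟩
    · simpa [PrimeSpectrum.mem_basicOpen] using hv
    · ext x
      exact map_eq_zero_iff _ hψ
  simp only [PrimeSpectrum.ConstructibleSetData.toSet, Set.mem_iUnion] at hbot
  obtain ⟨D, hD, hDm⟩ := hbot
  have hg : ∀ i, D.g i = 0 := fun i => by
    have := hDm.1 (Set.mem_range_self i)
    simpa using this
  have hu : D.f ≠ 0 := by
    intro h0
    exact hDm.2 (by simp [h0])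
  refine ⟨D.f, hu, fun y hy => ?_⟩
  let m : PrimeSpectrum (MvPolynomial τ ℂ) :=
    ⟨RingHom.ker (eval y), RingHom.ker_isPrime _⟩
  have hm : m ∈ S.toSet := by
    simp only [PrimeSpectrum.ConstructibleSetData.toSet, Set.mem_iUnion]
    refine ⟨D, hD, ?_, ?_⟩
    · rintro _ ⟨i, rfl⟩
      simp [hg]
    · intro hcon
      exact hy (by simpa [m] using hcon)
  rw [hS] at hm
  obtain ⟨q, hq, hqm⟩ := hm
  -- The prime `q` need not be maximal. By the Nullstellensatz some point `x` of its zero locus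
  -- avoids the zeros of `v`, and since `q` contracts to the maximal ideal of `y`, this point maps
  -- to `y`.
  have hv' : v ∉ q.asIdeal := hq
  have hvan := IsPrime.vanishingIdeal_zeroLocus (K := ℂ) q.asIdeal
  rw [← hvan, mem_vanishingIdeal_iff] at hv'
  push Not at hv'
  obtain ⟨x, hx, hxv⟩ := hv'
  refine ⟨x, fun t => ?_, by simpa [aeval_eq_eval] using hxv⟩
  have h1 : (X t - C (y t)) ∈ m.asIdeal := by simp [m]
  rw [← hqm] at h1
  have h2 : f (X t - C (y t)) ∈ q.asIdeal := h1
  have h3 := hx _ h2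
  simp [f, aeval_eq_eval, sub_eq_zero] at h3
  exact h3


/-! ### Cubics through the octad -/

/-- A choice of points `p₁, …, p₈` of `ℙ¹` for which the octad carries no grove. -/
def octadMarking : Fin 8 → Fin 2 → ℂ :=
  ![![1, 0], ![1, 0], ![0, 1], ![0, 1], ![0, 1], ![1, 1], ![1, 1], ![1, 1]]

/-- A nonsingular square system: 20 unknowns, 20 equations. The letters `a` and `b` denote the third
partials of the two cubics that survive the conditions at the coordinate points; `g4` to `g7` are
gradient conditions at the last four points of the octad, and `f0` is the vanishing of the first
cubic there. -/
theorem octad_linear_system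
    (a012 a013 a022 a023 a033 a122 a123 a133 a223 a233 b001 b002 b003 b011 b012 b013 b023 b112
        b113 b123 : ℂ)
    (g4_0 : -2 * b001 - 2 * b002 - 2 * b003 + b011 + 2 * b012 + 2 * b013 + 2 * b023 = 0)
    (g4_1 : b001 - 2 * b011 - 2 * b012 - 2 * b013 + 2 * b112 + 2 * b113 + 2 * b123 = 0)
    (g4_2 : b002 - 2 * b012 - 2 * b023 + b112 + 2 * b123 = 0)
    (g4_3 : b003 - 2 * b013 - 2 * b023 + b113 + 2 * b123 = 0)
    (f0_4 : -6 * a012 - 6 * a013 - 3 * a022 - 6 * a023 - 3 * a033 + 3 * a122 + 6 * a123 + 3 *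
        a133 + 3 * a223 + 3 * a233 = 0)
    (g5_0 : -2 * a012 - 2 * a013 + a022 + 2 * a023 + a033 - 2 * b001 + 2 * b002 + 2 * b003 +
        b011 - 2 * b012 - 2 * b013 + 2 * b023 = 0)
    (g5_1 : 2 * a012 + 2 * a013 + a122 + 2 * a123 + a133 + b001 - 2 * b011 + 2 * b012 + 2 *
        b013 - 2 * b112 - 2 * b113 + 2 * b123 = 0)
    (g5_2 : -2 * a012 + 2 * a022 + 2 * a023 - 2 * a122 - 2 * a123 + 2 * a223 + a233 + b002 - 2
        * b012 + 2 * b023 + b112 - 2 * b123 = 0)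
    (g5_3 : -2 * a013 + 2 * a023 + 2 * a033 - 2 * a123 - 2 * a133 + a223 + 2 * a233 + b003 - 2
        * b013 + 2 * b023 + b113 - 2 * b123 = 0)
    (f0_5 : -6 * a012 - 6 * a013 + 3 * a022 + 6 * a023 + 3 * a033 - 3 * a122 - 6 * a123 - 3 *
        a133 + 3 * a223 + 3 * a233 = 0)
    (g6_0 : -2 * a012 + 2 * a013 + a022 - 2 * a023 + a033 + 2 * b001 - 2 * b002 + 2 * b003 +
        b011 - 2 * b012 + 2 * b013 - 2 * b023 = 0)
    (g6_1 : -2 * a012 + 2 * a013 + a122 - 2 * a123 + a133 + b001 + 2 * b011 - 2 * b012 + 2 *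
        b013 - 2 * b112 + 2 * b113 - 2 * b123 = 0)
    (g6_2 : 2 * a012 - 2 * a022 + 2 * a023 - 2 * a122 + 2 * a123 - 2 * a223 + a233 + b002 + 2
        * b012 + 2 * b023 + b112 + 2 * b123 = 0)
    (g6_3 : 2 * a013 - 2 * a023 + 2 * a033 - 2 * a123 + 2 * a133 + a223 - 2 * a233 + b003 + 2
        * b013 - 2 * b023 + b113 - 2 * b123 = 0)
    (f0_6 : -6 * a012 + 6 * a013 + 3 * a022 - 6 * a023 + 3 * a033 + 3 * a122 - 6 * a123 + 3 *
        a133 + 3 * a223 - 3 * a233 = 0)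
    (g7_0 : 2 * a012 - 2 * a013 + a022 - 2 * a023 + a033 + 2 * b001 + 2 * b002 - 2 * b003 +
        b011 + 2 * b012 - 2 * b013 - 2 * b023 = 0)
    (g7_1 : 2 * a012 - 2 * a013 + a122 - 2 * a123 + a133 + b001 + 2 * b011 + 2 * b012 - 2 *
        b013 + 2 * b112 - 2 * b113 - 2 * b123 = 0)
    (g7_2 : 2 * a012 + 2 * a022 - 2 * a023 + 2 * a122 - 2 * a123 - 2 * a223 + a233 + b002 + 2
        * b012 - 2 * b023 + b112 - 2 * b123 = 0)
    (g7_3 : 2 * a013 + 2 * a023 - 2 * a033 + 2 * a123 - 2 * a133 + a223 - 2 * a233 + b003 + 2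
        * b013 + 2 * b023 + b113 + 2 * b123 = 0)
    (f0_7 : 6 * a012 - 6 * a013 + 3 * a022 - 6 * a023 + 3 * a033 + 3 * a122 - 6 * a123 + 3 *
        a133 - 3 * a223 + 3 * a233 = 0)
    : a012 = 0 ∧ a013 = 0 ∧ a022 = 0 ∧ a023 = 0 ∧ a033 = 0 ∧ a122 = 0 ∧ a123 = 0 ∧ a133 = 0 ∧
        a223 = 0 ∧ a233 = 0 ∧ b001 = 0 ∧ b002 = 0 ∧ b003 = 0 ∧ b011 = 0 ∧ b012 = 0 ∧ b013 = 0 ∧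
        b023 = 0 ∧ b112 = 0 ∧ b113 = 0 ∧ b123 = 0 := by
  refine ⟨?_, ?_, ?_, ?_, ?_, ?_, ?_, ?_, ?_, ?_, ?_, ?_, ?_, ?_, ?_, ?_, ?_, ?_, ?_, ?_⟩ <;> grind

/-- The marking uses only [1,0], [0,1] and [1,1], so each gradient condition concerns the first
form, the second form or their sum. The conditions at the coordinate points kill ten of the twenty
coefficients of each form. -/
theorem octad_trilinear_eq_zero (t : Fin 2 → Fin 4 → Fin 4 → Fin 4 → ℂ)
    (hs₁ : ∀ r i j k, t r i j k = t r j i k) (hs₂ : ∀ r i j k, t r i j k = t r i k j)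
    (h₁ : ∀ r a, ∑ k, (∑ i, ∑ j, t r i j k * octad a i * octad a j) * octad a k = 0)
    (h₂ : ∀ a k, ∑ r, octadMarking a r * ∑ i, ∑ j, t r i j k * octad a i * octad a j = 0) :
    t = 0 := by
  have s₁ := fun r k => hs₁ r 1 0 k
  have s₂ := fun r k => hs₁ r 2 0 k
  have s₃ := fun r k => hs₁ r 3 0 k
  have s₄ := fun r k => hs₁ r 2 1 k
  have s₅ := fun r k => hs₁ r 3 1 k
  have s₆ := fun r k => hs₁ r 3 2 k
  have s₇ := fun r i => hs₂ r i 1 0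
  have s₈ := fun r i => hs₂ r i 2 0
  have s₉ := fun r i => hs₂ r i 3 0
  have s₁₀ := fun r i => hs₂ r i 2 1
  have s₁₁ := fun r i => hs₂ r i 3 1
  have s₁₂ := fun r i => hs₂ r i 3 2
  clear hs₁ hs₂
  simp [Fin.forall_fin_succ, Fin.sum_univ_four, octad, octadMarking, s₁, s₂, s₃, s₄, s₅, s₆,
      s₇, s₈, s₉, s₁₀, s₁₁, s₁₂] at h₁ h₂
  -- The vanishing of the second form at the last four points is discarded: by Euler's formula it
  -- follows from the gradient conditions and the vanishing of the first form.
  obtain ⟨⟨wa0, wa1, wa2, wa3, f0_4, f0_5, f0_6, f0_7⟩, ⟨wb0, wb1, wb2, wb3, -, -, -, -⟩⟩ := h₁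
  obtain ⟨⟨za000, za001, za002, za003⟩, ⟨za011, za111, za112, za113⟩, ⟨zb022, zb122, zb222,
      zb223⟩, ⟨zb033, zb133, zb233, zb333⟩, ⟨g4_0, g4_1, g4_2, g4_3⟩, ⟨g5_0, g5_1, g5_2, g5_3⟩,
      ⟨g6_0, g6_1, g6_2, g6_3⟩, ⟨g7_0, g7_1, g7_2, g7_3⟩⟩ := h₂
  simp only [
    za000, za001, za002, za003, za011, za111, za112, za113, zb022, zb033, zb122, zb133, zb222,
    zb223, zb233, zb333, wa2, wa3, wb0, wb1, neg_zero, add_zero, zero_add]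
    at g4_0 g4_1 g4_2 g4_3 f0_4 g5_0 g5_1 g5_2 g5_3 f0_5 g6_0 g6_1
       g6_2 g6_3 f0_6 g7_0 g7_1 g7_2 g7_3 f0_7
  have key := octad_linear_system
    (t 0 0 1 2)
    (t 0 0 1 3)
    (t 0 0 2 2)
    (t 0 0 2 3)
    (t 0 0 3 3)
    (t 0 1 2 2)
    (t 0 1 2 3)
    (t 0 1 3 3)
    (t 0 2 2 3)
    (t 0 2 3 3)
    (t 1 0 0 1)
    (t 1 0 0 2)
    (t 1 0 0 3)
    (t 1 0 1 1)
    (t 1 0 1 2)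
    (t 1 0 1 3)
    (t 1 0 2 3)
    (t 1 1 1 2)
    (t 1 1 1 3)
    (t 1 1 2 3)
    (by linear_combination g4_0)
    (by linear_combination g4_1)
    (by linear_combination g4_2)
    (by linear_combination g4_3)
    (by linear_combination f0_4)
    (by linear_combination g5_0)
    (by linear_combination g5_1)
    (by linear_combination g5_2)
    (by linear_combination g5_3)
    (by linear_combination f0_5)
    (by linear_combination g6_0)
    (by linear_combination g6_1)
    (by linear_combination g6_2)
    (by linear_combination g6_3)
    (by linear_combination f0_6)
    (by linear_combination g7_0)
    (by linear_combination g7_1)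
    (by linear_combination g7_2)
    (by linear_combination g7_3)
    (by linear_combination f0_7)
  obtain ⟨ka012, ka013, ka022, ka023, ka033, ka122, ka123, ka133, ka223, ka233, kb001, kb002,
      kb003, kb011, kb012, kb013, kb023, kb112, kb113, kb123⟩ := key
  have hz : ∀ r i j k, t r i j k = 0 := by
    simp [Fin.forall_fin_succ, s₁, s₂, s₃, s₄, s₅, s₆, s₇, s₈, s₉, s₁₀, s₁₁, s₁₂, za000,
        za001, za002, za003, za011, za111, za112, za113, zb022, zb033, zb122, zb133, zb222, zb223,
        zb233, zb333, wa2, wa3, wb0, wb1, ka012, ka013, ka022, ka023, ka033, ka122, ka123, ka133,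
        ka223, ka233, kb001, kb002, kb003, kb011, kb012, kb013, kb023, kb112, kb113, kb123]
  funext r i j k
  exact hz r i j k


/-! ### Forms as coefficient vectors -/

instance fintypeDegreeEq (n d : ℕ) : Fintype {m : Fin n →₀ ℕ // m.degree = d} :=
  @Fintype.ofFinite _ (Finsupp.finite_of_degree_eq d).to_subtype

/-- The form of degree `d` with coefficients `c`. -/
def formOf {n d : ℕ} : ({m : Fin n →₀ ℕ // m.degree = d} → ℂ) →ₗ[ℂ] MvPolynomial (Fin n) ℂ where
  toFun c := ∑ m, c m • monomial m.1 1
  map_add' c c' := by simp only [Pi.add_apply, add_smul, Finset.sum_add_distrib]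
  map_smul' a c := by
    simp only [Pi.smul_apply, smul_assoc, Finset.smul_sum, RingHom.id_apply]

theorem formOf_apply {n d : ℕ} (c : {m : Fin n →₀ ℕ // m.degree = d} → ℂ) :
    formOf c = ∑ m, c m • monomial m.1 1 := rfl

theorem coeff_formOf {n d : ℕ} (c : {m : Fin n →₀ ℕ // m.degree = d} → ℂ)
    (m : {m : Fin n →₀ ℕ // m.degree = d}) : (formOf c).coeff m.1 = c m := by
  classical
  simp only [formOf_apply, coeff_sum, coeff_smul, coeff_monomial]
  rw [Finset.sum_eq_single m]
  · simp
  · intro b _ hb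
    rw [if_neg fun h => hb (Subtype.ext h), smul_zero]
  · simp

theorem isHomogeneous_formOf {n d : ℕ} (c : {m : Fin n →₀ ℕ // m.degree = d} → ℂ) :
    (formOf c).IsHomogeneous d := by
  refine IsHomogeneous.sum _ _ _ fun m _ => ?_
  rw [smul_monomial]
  exact isHomogeneous_monomial _ m.2

theorem formOf_coeff {n d : ℕ} {F : MvPolynomial (Fin n) ℂ} (hF : F.IsHomogeneous d) :
    formOf (fun m : {m : Fin n →₀ ℕ // m.degree = d} => F.coeff m.1) = F := by
  ext m
  by_cases hm : m.degree = d
  · exact coeff_formOf _ ⟨m, hm⟩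
  · rw [(isHomogeneous_formOf _).coeff_eq_zero hm, hF.coeff_eq_zero hm]

theorem eval_formOf {n d : ℕ} (c : {m : Fin n →₀ ℕ // m.degree = d} → ℂ) (x : Fin n → ℂ) :
    eval x (formOf c) = ∑ m, c m * eval x (monomial m.1 1) := by
  simp only [formOf_apply, map_sum, smul_eval]

theorem eval_pderiv_formOf {n d : ℕ} (c : {m : Fin n →₀ ℕ // m.degree = d} → ℂ) (x : Fin n → ℂ)
    (k : Fin n) :
    eval x (pderiv k (formOf c)) = ∑ m, c m * eval x (pderiv k (monomial m.1 1)) := by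
  simp only [formOf_apply, map_sum, Derivation.map_smul, smul_eval]

theorem formOf_eq_zero {n d : ℕ} {c : {m : Fin n →₀ ℕ // m.degree = d} → ℂ}
    (h : formOf c = 0) : c = 0 := by
  funext m
  rw [← coeff_formOf c m, h, coeff_zero, Pi.zero_apply]

/-! ### Cubic forms as symmetric trilinear forms -/

theorem pderiv_comm {σ : Type*} (i j : σ) (F : MvPolynomial σ ℂ) :
    pderiv i (pderiv j F) = pderiv j (pderiv i F) := by
  classical
  ext m
  simp only [coeff_pderiv, Finsupp.add_apply, add_right_comm m (Finsupp.single j 1)]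
  by_cases h : i = j
  · subst h; rfl
  · simp [h, Ne.symm h]
    ring

/-- The third partial derivatives of a cubic form. -/
def thirdPartials (F : MvPolynomial (Fin 4) ℂ) (i j k : Fin 4) : ℂ :=
  coeff 0 (pderiv i (pderiv j (pderiv k F)))

/-- Euler's formula in degrees 2 and 1; the factor is `2 * 1`. One more application, in degree 3,
gives the factor 6 of `eval_of_cubic`. -/
theorem eval_pderiv_of_cubic {F : MvPolynomial (Fin 4) ℂ} (hF : F.IsHomogeneous 3) (k : Fin 4)
    (q : Fin 4 → ℂ) :
    2 * eval q (pderiv k F) = ∑ i, ∑ j, thirdPartials F i j k * q i * q j := by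
  have h2 : (pderiv k F).IsHomogeneous 2 := hF.pderiv
  have h1 : ∀ j, (pderiv j (pderiv k F)).IsHomogeneous 1 := fun j => h2.pderiv
  have h0 : ∀ i j, pderiv i (pderiv j (pderiv k F)) = C (thirdPartials F i j k) := fun i j => by
    have : (pderiv i (pderiv j (pderiv k F))).IsHomogeneous 0 := (h1 j).pderiv
    rw [← totalDegree_zero_iff_isHomogeneous, totalDegree_eq_zero_iff_eq_C] at this
    exact this
  have e2 := congrArg (eval q) h2.sum_X_mul_pderiv
  have e1 := fun j => congrArg (eval q) (h1 j).sum_X_mul_pderiv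
  simp only [map_sum, map_mul, eval_X, map_nsmul, h0, eval_C, one_smul] at e1 e2
  rw [nsmul_eq_mul] at e2
  rw [← Nat.cast_ofNat, ← e2, Finset.sum_comm]
  refine Finset.sum_congr rfl fun j _ => ?_
  rw [← e1 j, Finset.mul_sum]
  exact Finset.sum_congr rfl fun i _ => by ring

theorem eval_of_cubic {F : MvPolynomial (Fin 4) ℂ} (hF : F.IsHomogeneous 3) (q : Fin 4 → ℂ) :
    6 * eval q F = ∑ k, (∑ i, ∑ j, thirdPartials F i j k * q i * q j) * q k := by
  have e := congrArg (eval q) hF.sum_X_mul_pderiv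
  simp only [map_sum, map_mul, eval_X, nsmul_eq_mul, Nat.cast_ofNat, map_ofNat] at e
  simp only [← eval_pderiv_of_cubic hF]
  calc 6 * eval q F = 2 * (3 * eval q F) := by ring
    _ = _ := by
      rw [← e, Finset.mul_sum]
      exact Finset.sum_congr rfl fun i _ => by ring

/-- The fact on which both the absence of groves and the dominance of the power sum map rest. Third
partials turn it into a statement about two symmetric tensors. -/
theorem octad_cubics_eq_zero (G : Fin 2 → MvPolynomial (Fin 4) ℂ)
    (hG : ∀ r, (G r).IsHomogeneous 3) (h₁ : ∀ r a, eval (octad a) (G r) = 0)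
    (h₂ : ∀ a k, ∑ r, octadMarking a r * eval (octad a) (pderiv k (G r)) = 0) : G = 0 := by
  have ht : (fun r => thirdPartials (G r)) = 0 := by
    apply octad_trilinear_eq_zero
    · intro r i j k; simp only [thirdPartials]; rw [pderiv_comm]
    · intro r i j k; simp only [thirdPartials]; rw [pderiv_comm j k]
    · intro r a; rw [← eval_of_cubic (hG r), h₁, mul_zero]
    · intro a k
      rw [← mul_zero 2, ← h₂ a k, Finset.mul_sum]
      refine Finset.sum_congr rfl fun r _ => ?_
      rw [← eval_pderiv_of_cubic (hG r)]; ring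
  funext r
  refine MvPolynomial.funext fun q => ?_
  have h := eval_of_cubic (hG r) q
  simp only [congrFun ht r, Pi.zero_apply, zero_mul, Finset.sum_const_zero] at h
  simpa using h

/-! ### The octad carries no grove for general points of `ℙ¹` -/

/-- The linear conditions, with coefficients polynomial in the `p i`, on the coefficients of a pair
of cubics that span a grove for the points `p i` and the octad. -/
def groveMatrix : Matrix ((Fin 2 × Fin 8) ⊕ (Fin 8 × Fin 4))
    (Fin 2 × {m : Fin 4 →₀ ℕ // m.degree = 3}) (MvPolynomial (Fin 8 × Fin 2) ℂ) :=
  Matrix.of fun e c => match e with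
    | .inl (r, a) => if r = c.1 then C (eval (octad a) (monomial c.2.1 1)) else 0
    | .inr (a, k) => X (a, c.1) * C (eval (octad a) (pderiv k (monomial c.2.1 1)))

theorem groveMatrix_mulVec_eq_zero_iff (p : Fin 8 → Fin 2 → ℂ)
    (c : Fin 2 × {m : Fin 4 →₀ ℕ // m.degree = 3} → ℂ) :
    (groveMatrix.map (eval fun q => p q.1 q.2)).mulVec c = 0 ↔
      (∀ r a, eval (octad a) (formOf fun m => c (r, m)) = 0) ∧
      ∀ a k, ∑ r, p a r * eval (octad a) (pderiv k (formOf fun m => c (r, m))) = 0 := by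
  have h1 : ∀ r a, (groveMatrix.map (eval fun q => p q.1 q.2)).mulVec c (.inl (r, a)) =
      eval (octad a) (formOf fun m => c (r, m)) := by
    intro r a
    simp only [Matrix.mulVec, dotProduct, Fintype.sum_prod_type, groveMatrix, Matrix.map_apply,
      Matrix.of_apply, eval_formOf]
    rw [Finset.sum_eq_single r]
    · exact Finset.sum_congr rfl fun m _ => by rw [if_pos rfl, eval_C, mul_comm]
    · intro b _ hb
      exact Finset.sum_eq_zero fun m _ => by rw [if_neg hb.symm, map_zero, zero_mul]
    · simp
  have h2 : ∀ a k, (groveMatrix.map (eval fun q => p q.1 q.2)).mulVec c (.inr (a, k)) =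
      ∑ r, p a r * eval (octad a) (pderiv k (formOf fun m => c (r, m))) := by
    intro a k
    simp only [Matrix.mulVec, dotProduct, Fintype.sum_prod_type, groveMatrix, Matrix.map_apply,
      Matrix.of_apply, eval_pderiv_formOf, map_mul, eval_X, eval_C, Finset.mul_sum]
    exact Finset.sum_congr rfl fun r _ => Finset.sum_congr rfl fun m _ => by ring
  constructor
  · intro h
    exact ⟨fun r a => (h1 r a).symm.trans (congrFun h _),
      fun a k => (h2 a k).symm.trans (congrFun h _)⟩
  · rintro ⟨ha, hb⟩
    funext e
    rcases e with ⟨r, a⟩ | ⟨a, k⟩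
    · exact (h1 r a).trans (ha r a)
    · exact (h2 a k).trans (hb a k)

theorem rank_eq_card_iff_mulVec_injective {ι κ : Type*} [Fintype ι] [Fintype κ]
    (M : Matrix ι κ ℂ) : M.rank = Fintype.card κ ↔ ∀ c, M.mulVec c = 0 → c = 0 := by
  classical
  have h := LinearMap.finrank_range_add_finrank_ker M.mulVecLin
  rw [Module.finrank_fintype_fun_eq_card] at h
  have h' : M.rank + Module.finrank ℂ (LinearMap.ker M.mulVecLin) = Fintype.card κ := h
  have h'' : (∀ c, M.mulVec c = 0 → c = 0) ↔ Module.finrank ℂ (LinearMap.ker M.mulVecLin) = 0 := by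
    rw [Submodule.finrank_eq_zero, LinearMap.ker_eq_bot']
    rfl
  rw [h'']
  omega

/-- The matrix `groveMatrix` has trivial kernel at `octadMarking`, hence on an open set. A grove
with `t = 0` gives the kernel element `(F, 0)`; one with `t = 1` gives the images under `γ` of the
two basis vectors, because `γ (p a)` is their combination with weights `p a`. -/
theorem forGeneralPoints_not_exists_grove :
    ForGeneralPoints 1 8 fun p => ¬ ∃ Γ, IsGrove p octad Γ := by
  obtain ⟨Φ, h0, h⟩ := exists_rank_le groveMatrix fun q => octadMarking q.1 q.2
  have hrk : (groveMatrix.map (eval fun q => octadMarking q.1 q.2)).rank =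
      Fintype.card (Fin 2 × {m : Fin 4 →₀ ℕ // m.degree = 3}) := by
    rw [rank_eq_card_iff_mulVec_injective]
    intro c hc
    rw [groveMatrix_mulVec_eq_zero_iff] at hc
    have := octad_cubics_eq_zero _ (fun r => isHomogeneous_formOf _) hc.1 hc.2
    funext ⟨r, m⟩
    exact congrFun (formOf_eq_zero (congrFun this r)) m
  refine ⟨Φ, by rintro rfl; simp at h0, fun p _ hp => ?_⟩
  have hinj := (rank_eq_card_iff_mulVec_injective _).1
    (le_antisymm (Matrix.rank_le_card_width _) (hrk ▸ h _ hp))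
  have key : ∀ G : Fin 2 → MvPolynomial (Fin 4) ℂ, (∀ r, (G r).IsHomogeneous 3) →
      (∀ r a, eval (octad a) (G r) = 0) →
      (∀ a k, ∑ r, p a r * eval (octad a) (pderiv k (G r)) = 0) → G = 0 := by
    intro G hG h1 h2
    have hc := hinj (fun q => (G q.1).coeff q.2.1)
      ((groveMatrix_mulVec_eq_zero_iff p _).2 (by simpa only [formOf_coeff (hG _)] using ⟨h1, h2⟩))
    funext r
    rw [← formOf_coeff (hG r)]
    have : (fun m : {m : Fin 4 →₀ ℕ // m.degree = 3} => (G r).coeff m.1) = 0 :=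
      funext fun m => congrFun hc (r, m)
    rw [this, map_zero, Pi.zero_apply]
  rintro ⟨Γ, hΓ⟩
  rcases hΓ.singular with ⟨hd, hs⟩ | ⟨hd, γ, hs⟩
  · have : Γ ≠ ⊥ := by rintro rfl; simp at hd
    obtain ⟨F, hF, hF0⟩ := Γ.exists_mem_ne_zero_of_ne_bot this
    have h3 := key ![F, 0] (by
        intro r; fin_cases r
        · exact hΓ.cubics hF
        · exact isHomogeneous_zero _ _ _)
      (by
        intro r a; fin_cases r
        · exact hΓ.base F hF a
        · simp)
      (by intro a k; simp [(hs F hF a).2 k])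
    exact hF0 (congrFun h3 0)
  · have h3 := key (fun r => (γ (Pi.single r 1) : MvPolynomial (Fin 4) ℂ))
      (fun r => hΓ.cubics (γ _).2) (fun r a => hΓ.base _ (γ _).2 a)
      (by
        intro a k
        rw [← (hs a).2 k]
        have : p a = ∑ r, p a r • (Pi.single r 1 : Fin 2 → ℂ) := (pi_eq_sum_univ' (p a)).trans
          (Finset.sum_congr rfl fun i _ => by congr 1)
        conv_rhs => rw [this]
        simp only [map_sum, map_smul, Submodule.coe_sum, Submodule.coe_smul, Derivation.map_smul,
          smul_eval])
    have h4 : γ (Pi.single 0 1) = 0 := Subtype.ext (congrFun h3 0)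
    rw [map_eq_zero_iff _ γ.injective] at h4
    simpa using congrFun h4 0


/-! ### The ideal of a set of points -/

theorem eval_smul_of_isHomogeneous {σ : Type*} {f : MvPolynomial σ ℂ} {k : ℕ}
    (hf : f.IsHomogeneous k) (t : ℂ) (x : σ → ℂ) : eval (t • x) f = t ^ k * eval x f := by
  rw [eval_eq, eval_eq, Finset.mul_sum]
  refine Finset.sum_congr rfl fun m hm => ?_
  have h : ∑ i ∈ m.support, m i = k := by
    rw [hf.degree_eq_sum_deg_support hm]
  simp only [Pi.smul_apply, smul_eq_mul, mul_pow, Finset.prod_mul_distrib]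
  rw [Finset.prod_pow_eq_pow_sum, h]
  ring

/-- Along the line through `x`, `f` is a polynomial in `t` whose coefficients are the values of its
components at `x`; it has infinitely many roots. -/
theorem eval_homogeneousComponent_eq_zero {σ : Type*} {f : MvPolynomial σ ℂ} {x : σ → ℂ}
    (h : ∀ t : ℂ, t ≠ 0 → eval (t • x) f = 0) (k : ℕ) :
    eval x (homogeneousComponent k f) = 0 := by
  let p : Polynomial ℂ := ∑ i ∈ Finset.range (f.totalDegree + 1),
    Polynomial.C (eval x (homogeneousComponent i f)) * Polynomial.X ^ i
  have hp : ∀ t, p.eval t = eval (t • x) f := by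
    intro t
    conv_rhs => rw [← sum_homogeneousComponent f]
    simp only [p, Polynomial.eval_finsetSum, map_sum, Polynomial.eval_mul, Polynomial.eval_C,
      Polynomial.eval_pow, Polynomial.eval_X]
    refine Finset.sum_congr rfl fun i _ => ?_
    rw [eval_smul_of_isHomogeneous (homogeneousComponent_isHomogeneous i f), mul_comm]
  have hp0 : p = 0 := by
    refine Polynomial.eq_zero_of_infinite_isRoot p
      ((Set.finite_singleton (0 : ℂ)).infinite_compl.mono fun t ht => ?_)
    exact (hp t).trans (h t ht)
  by_cases hk : k < f.totalDegree + 1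
  · have h1 : p.coeff k = eval x (homogeneousComponent k f) := by
      simp only [p, Polynomial.finsetSum_coeff, Polynomial.coeff_C_mul_X_pow]
      rw [Finset.sum_ite_eq, if_pos (Finset.mem_range.2 hk)]
    rw [← h1, hp0, Polynomial.coeff_zero]
  · rw [homogeneousComponent_eq_zero _ _ (by omega), map_zero]

variable {n s : ℕ}

theorem mem_pointsIdeal_of_isHomogeneous {L : Fin s → Fin (n + 1) → ℂ}
    {f : MvPolynomial (Fin (n + 1)) ℂ} {k : ℕ} (hf : f.IsHomogeneous k)
    (h : ∀ a, eval (L a) f = 0) : f ∈ pointsIdeal L :=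
  Ideal.subset_span ⟨⟨k, hf⟩, h⟩

theorem mem_pointsIdeal_iff {L : Fin s → Fin (n + 1) → ℂ} {f : MvPolynomial (Fin (n + 1)) ℂ} :
    f ∈ pointsIdeal L ↔ ∀ a, ∀ t : ℂ, t ≠ 0 → eval (t • L a) f = 0 := by
  constructor
  · intro hf a t _
    have : pointsIdeal L ≤ RingHom.ker (eval (t • L a)) := by
      refine Ideal.span_le.2 ?_
      rintro g ⟨⟨k, hg⟩, h⟩
      exact (eval_smul_of_isHomogeneous hg t _).trans (by rw [h a, mul_zero])
    exact this hf
  · intro h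
    rw [← sum_homogeneousComponent f]
    exact Ideal.sum_mem _ fun k _ => mem_pointsIdeal_of_isHomogeneous
      (homogeneousComponent_isHomogeneous k f) fun a => eval_homogeneousComponent_eq_zero (h a) k

theorem eval_eq_zero_of_mem_pointsIdeal {L : Fin s → Fin (n + 1) → ℂ}
    {f : MvPolynomial (Fin (n + 1)) ℂ} (hf : f ∈ pointsIdeal L) (a : Fin s) :
    eval (L a) f = 0 := by
  simpa using mem_pointsIdeal_iff.1 hf a 1 one_ne_zero

theorem exists_linear_form {x : Fin (n + 1) → ℂ} (hx : x ≠ 0) :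
    ∃ l : MvPolynomial (Fin (n + 1)) ℂ, l.IsHomogeneous 1 ∧ eval x l = 1 := by
  obtain ⟨k, hk⟩ := Function.ne_iff.1 hx
  exact ⟨C (x k)⁻¹ * X k, isHomogeneous_C_mul_X _ _, by simp [inv_mul_cancel₀ hk]⟩

theorem isSaturated_pointsIdeal {L : Fin s → Fin (n + 1) → ℂ} (hL : ∀ a, L a ≠ 0) :
    IsSaturated (pointsIdeal L) := by
  rintro f ⟨k, hk⟩
  rw [mem_pointsIdeal_iff]
  intro a t ht
  obtain ⟨l, hl, hla⟩ := exists_linear_form (hL a)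
  have h1 := mem_pointsIdeal_iff.1 (hk (l ^ k) (by simpa using hl.pow k)) a t ht
  rw [map_mul, map_pow, eval_smul_of_isHomogeneous hl, hla, mul_one, pow_one] at h1
  exact (mul_eq_zero.1 h1).resolve_left (pow_ne_zero _ ht)

/-- The points `L a` impose independent conditions on forms of degree `k`. -/
def ImposeIndependentConditions (L : Fin s → Fin (n + 1) → ℂ) (k : ℕ) : Prop :=
  ∀ w : Fin s → ℂ, ∃ f : MvPolynomial (Fin (n + 1)) ℂ, f.IsHomogeneous k ∧ ∀ a, eval (L a) f = w a

theorem ImposeIndependentConditions.ne_zero {L : Fin s → Fin (n + 1) → ℂ} {k : ℕ}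
    (h : ImposeIndependentConditions L k) (hk : k ≠ 0) (a : Fin s) : L a ≠ 0 := by
  intro h0
  obtain ⟨f, hf, hfa⟩ := h 1
  have h1 := eval_smul_of_isHomogeneous hf 0 (L a)
  rw [zero_smul, zero_pow hk, zero_mul, ← h0, hfa] at h1
  exact one_ne_zero h1

/-- Interpolating forms are multiplied by powers of a linear form with value 1 at the point in
question. -/
theorem ImposeIndependentConditions.mono {L : Fin s → Fin (n + 1) → ℂ} {k l : ℕ}
    (h : ImposeIndependentConditions L k) (hL : ∀ a, L a ≠ 0) (hkl : k ≤ l) :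
    ImposeIndependentConditions L l := by
  intro w
  choose q hq hqa using fun a : Fin s => h (Pi.single a (w a))
  choose m hm hma using fun a : Fin s => exists_linear_form (hL a)
  refine ⟨∑ a, q a * m a ^ (l - k), IsHomogeneous.sum _ _ _ fun a _ => ?_, fun b => ?_⟩
  · have := (hq a).mul ((hm a).pow (l - k))
    rwa [one_mul, Nat.add_sub_cancel' hkl] at this
  · rw [map_sum, Finset.sum_eq_single b]
    · rw [map_mul, map_pow, hqa, hma, Pi.single_eq_same, one_pow, mul_one]
    · intro a _ hab
      rw [map_mul, hqa, Pi.single_eq_of_ne hab.symm, zero_mul]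
    · simp

/-- Evaluation of the homogeneous coordinate ring at the (representatives of the) points. -/
def evalQuotient (L : Fin s → Fin (n + 1) → ℂ) :
    (MvPolynomial (Fin (n + 1)) ℂ ⧸ pointsIdeal L) →ₐ[ℂ] (Fin s → ℂ) :=
  Ideal.Quotient.liftₐ _ (AlgHom.pi fun a => aeval (L a)) fun f hf => by
    funext a
    exact eval_eq_zero_of_mem_pointsIdeal hf a

theorem evalQuotient_mk (L : Fin s → Fin (n + 1) → ℂ) (f : MvPolynomial (Fin (n + 1)) ℂ)
    (a : Fin s) : evalQuotient L (Ideal.Quotient.mk _ f) a = eval (L a) f := rfl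

theorem mem_quotientPiece {I : Ideal (MvPolynomial (Fin (n + 1)) ℂ)} {k : ℕ}
    {x : MvPolynomial (Fin (n + 1)) ℂ ⧸ I} :
    x ∈ quotientPiece I k ↔ ∃ f : MvPolynomial (Fin (n + 1)) ℂ, f.IsHomogeneous k ∧
      Ideal.Quotient.mk I f = x := Iff.rfl

/-- Evaluation at chosen representatives is faithful one degree at a time, though it need not be
injective on the whole coordinate ring. -/
theorem evalQuotient_eq_zero {L : Fin s → Fin (n + 1) → ℂ} {k : ℕ}
    {x : MvPolynomial (Fin (n + 1)) ℂ ⧸ pointsIdeal L} (hx : x ∈ quotientPiece (pointsIdeal L) k)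
    (h : evalQuotient L x = 0) : x = 0 := by
  obtain ⟨f, hf, rfl⟩ := mem_quotientPiece.1 hx
  exact Ideal.Quotient.eq_zero_iff_mem.2 (mem_pointsIdeal_of_isHomogeneous hf (congrFun h))

theorem finrank_map_of_injOn {V W : Type*} [AddCommGroup V] [Module ℂ V] [AddCommGroup W]
    [Module ℂ W] (f : V →ₗ[ℂ] W) (N : Submodule ℂ V) (h : ∀ x ∈ N, f x = 0 → x = 0) :
    Module.finrank ℂ (N.map f) = Module.finrank ℂ N := by
  rw [← LinearMap.range_domRestrict]
  refine LinearMap.finrank_range_of_inj ((injective_iff_map_eq_zero _).2 fun x hx => ?_)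
  exact Subtype.ext (h x x.2 hx)

theorem isZeroDimScheme_pointsIdeal {L : Fin s → Fin (n + 1) → ℂ} {k : ℕ}
    (h : ImposeIndependentConditions L k) (hL : ∀ a, L a ≠ 0) :
    IsZeroDimScheme s (pointsIdeal L) where
  homogeneous f hf k := mem_pointsIdeal_of_isHomogeneous (homogeneousComponent_isHomogeneous k f)
    fun a => eval_homogeneousComponent_eq_zero (mem_pointsIdeal_iff.1 hf a) k
  saturated := isSaturated_pointsIdeal hL
  length := by
    refine ⟨k, fun l hl => ?_⟩
    rw [← finrank_map_of_injOn (evalQuotient L).toLinearMap _ fun x hx => evalQuotient_eq_zero hx]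
    have : (quotientPiece (pointsIdeal L) l).map (evalQuotient L).toLinearMap = ⊤ := by
      rw [eq_top_iff]
      intro w _
      obtain ⟨f, hf, hfw⟩ := h.mono hL hl w
      exact ⟨_, mem_quotientPiece.2 ⟨f, hf, rfl⟩, funext hfw⟩
    rw [this, finrank_top, Module.finrank_fin_fun]

/-! ### The Koszul complex -/

theorem neg_one_pow_insert_mul {R : Type*} [CommRing R] {T : Finset (Fin (n + 1))}
    {k l : Fin (n + 1)} (hk : k ∉ T) (hkl : k < l) :
    (-1 : R) ^ (T.filter fun t => t < k).card * (-1) ^ ((insert k T).filter fun t => t < l).card =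
      -((-1) ^ (T.filter fun t => t < l).card *
        (-1) ^ ((insert l T).filter fun t => t < k).card) := by
  rw [Finset.filter_insert, Finset.filter_insert, if_pos hkl, if_neg hkl.not_gt,
    Finset.card_insert_of_notMem (by simp [hk])]
  ring

/-- The double sum has a summand antisymmetric in the two removed indices, so it equals its own
negative, and 2 is invertible. -/
theorem koszulD_koszulD (I : Ideal (MvPolynomial (Fin (n + 1)) ℂ))
    (c : Finset (Fin (n + 1)) → MvPolynomial (Fin (n + 1)) ℂ ⧸ I) :
    koszulD I (koszulD I c) = 0 := by
  funext T
  let g : Fin (n + 1) → Fin (n + 1) → MvPolynomial (Fin (n + 1)) ℂ ⧸ I := fun k l =>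
    if k ∉ T ∧ l ∉ T ∧ k ≠ l then
      (-1) ^ (T.filter fun t => t < k).card * (-1) ^ ((insert k T).filter fun t => t < l).card *
        (Ideal.Quotient.mk I (X k) * Ideal.Quotient.mk I (X l) * c (insert k (insert l T))) else 0
  have h1 : koszulD I (koszulD I c) T = ∑ k, ∑ l, g k l := by
    have h2 : koszulD I (koszulD I c) T = ∑ k ∈ Tᶜ, ∑ l ∈ (insert k T)ᶜ, g k l := by
      refine Finset.sum_congr rfl fun k hk => ?_
      simp only [koszulD, LinearMap.coe_mk, AddHom.coe_mk, Finset.mul_sum]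
      refine Finset.sum_congr rfl fun l hl => ?_
      simp only [Finset.mem_compl, Finset.mem_insert, not_or] at hk hl
      simp only [g]
      rw [if_pos ⟨hk, hl.2, Ne.symm hl.1⟩, Finset.insert_comm]
      ring
    rw [h2]
    refine (Finset.sum_congr rfl fun k _ => ?_).trans (Finset.sum_subset (Finset.subset_univ _) ?_)
    · refine Finset.sum_subset (Finset.subset_univ _) fun l _ hl => ?_
      simp only [Finset.mem_compl, Finset.mem_insert, not_not] at hl
      exact if_neg fun h => hl.elim (fun e => h.2.2 e.symm) h.2.1
    · intro k _ hk
      exact Finset.sum_eq_zero fun l _ => if_neg fun h => hk (Finset.mem_compl.2 h.1)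
  have h2 : ∀ k l, g k l = -g l k := by
    intro k l
    by_cases h : k ∉ T ∧ l ∉ T ∧ k ≠ l
    · simp only [g, if_pos h, if_pos (show l ∉ T ∧ k ∉ T ∧ l ≠ k from ⟨h.2.1, h.1, h.2.2.symm⟩),
        Finset.insert_comm l k]
      rcases lt_or_gt_of_ne h.2.2 with hlt | hlt
      · rw [neg_one_pow_insert_mul h.1 hlt]; ring
      · rw [neg_one_pow_insert_mul h.2.1 hlt]; ring
    · simp only [g, if_neg h, if_neg (show ¬(l ∉ T ∧ k ∉ T ∧ l ≠ k) from
        fun h' => h ⟨h'.2.1, h'.1, h'.2.2.symm⟩), neg_zero]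
  have h3 : ∑ k, ∑ l, g k l = -∑ k, ∑ l, g k l := by
    conv_lhs => rw [Finset.sum_comm]
    simp only [← Finset.sum_neg_distrib]
    exact Finset.sum_congr rfl fun k _ => Finset.sum_congr rfl fun l _ => h2 l k
  have h4 : (2 : ℂ) • ∑ k, ∑ l, g k l = 0 := by
    rw [two_smul]; nth_rewrite 1 [h3]; exact neg_add_cancel _
  rw [h1, Pi.zero_apply]
  exact (smul_eq_zero.1 h4).resolve_left two_ne_zero

theorem mem_koszulChain {I : Ideal (MvPolynomial (Fin (n + 1)) ℂ)} {i j : ℕ}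
    {c : Finset (Fin (n + 1)) → MvPolynomial (Fin (n + 1)) ℂ ⧸ I} :
    c ∈ koszulChain I i j ↔
      ∀ T, (T.card = i ∧ i ≤ j → c T ∈ quotientPiece I (j - i)) ∧
        (¬(T.card = i ∧ i ≤ j) → c T = 0) := by
  simp only [koszulChain, Submodule.mem_pi, Set.mem_univ, true_imp_iff]
  refine forall_congr' fun T => ?_
  split_ifs with h
  · simp [h]
  · simp [h]

theorem mem_quotientPiece_of_mem_koszulChain {I : Ideal (MvPolynomial (Fin (n + 1)) ℂ)} {i j : ℕ}
    {c : Finset (Fin (n + 1)) → MvPolynomial (Fin (n + 1)) ℂ ⧸ I} (hc : c ∈ koszulChain I i j)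
    (T : Finset (Fin (n + 1))) : c T ∈ quotientPiece I (j - i) := by
  by_cases h : T.card = i ∧ i ≤ j
  · exact (mem_koszulChain.1 hc T).1 h
  · rw [(mem_koszulChain.1 hc T).2 h]; exact zero_mem _

theorem X_mul_mem_quotientPiece {I : Ideal (MvPolynomial (Fin (n + 1)) ℂ)} {d : ℕ}
    {x : MvPolynomial (Fin (n + 1)) ℂ ⧸ I} (hx : x ∈ quotientPiece I d) (k : Fin (n + 1)) :
    Ideal.Quotient.mk I (X k) * x ∈ quotientPiece I (d + 1) := by
  obtain ⟨f, hf, rfl⟩ := mem_quotientPiece.1 hx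
  exact mem_quotientPiece.2 ⟨X k * f, by simpa [add_comm] using (isHomogeneous_X ℂ k).mul hf,
    map_mul _ _ _⟩

theorem neg_one_pow_mul_mem {A : Type*} [CommRing A] [Algebra ℂ A] (N : Submodule ℂ A) (e : ℕ)
    {x : A} (hx : x ∈ N) : (-1) ^ e * x ∈ N := by
  rcases neg_one_pow_eq_or A e with h | h
  · rwa [h, one_mul]
  · rw [h, neg_one_mul]; exact N.neg_mem hx

theorem koszulD_mem_quotientPiece {I : Ideal (MvPolynomial (Fin (n + 1)) ℂ)} {i j : ℕ}
    {c : Finset (Fin (n + 1)) → MvPolynomial (Fin (n + 1)) ℂ ⧸ I} (hc : c ∈ koszulChain I i j)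
    (T : Finset (Fin (n + 1))) : koszulD I c T ∈ quotientPiece I (j - i + 1) :=
  Submodule.sum_mem _ fun k _ => neg_one_pow_mul_mem _ _
    (X_mul_mem_quotientPiece (mem_quotientPiece_of_mem_koszulChain hc _) k)

theorem koszulD_mem_koszulChain {I : Ideal (MvPolynomial (Fin (n + 1)) ℂ)} {i j : ℕ}
    {c : Finset (Fin (n + 1)) → MvPolynomial (Fin (n + 1)) ℂ ⧸ I}
    (hc : c ∈ koszulChain I (i + 1) j) : koszulD I c ∈ koszulChain I i j := by
  have hz : ∀ T, ¬(T.card = i ∧ i + 1 ≤ j) → koszulD I c T = 0 := by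
    intro T hT
    refine Finset.sum_eq_zero fun k hk => ?_
    rw [(mem_koszulChain.1 hc _).2, mul_zero, mul_zero]
    rw [Finset.card_insert_of_notMem (Finset.mem_compl.1 hk)]
    omega
  refine mem_koszulChain.2 fun T => ⟨fun hT => ?_, fun hT => hz T (by omega)⟩
  -- For `j ≤ i` the truncated subtractions do not match, but then there are no nonzero chains in
  -- step `i + 1`.
  by_cases h : i + 1 ≤ j
  · have := koszulD_mem_quotientPiece hc T
    rwa [show j - (i + 1) + 1 = j - i by omega] at this
  · rw [hz T (by omega)]; exact zero_mem _


/-! ### Betti numbers of points in terms of matrices polynomial in the points -/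

variable {n s : ℕ}

theorem finrank_quotient_submoduleOf {V : Type*} [AddCommGroup V] [Module ℂ V]
    {B Z : Submodule ℂ V} [FiniteDimensional ℂ Z] (h : B ≤ Z) :
    Module.finrank ℂ (Z ⧸ B.submoduleOf Z) = Module.finrank ℂ Z - Module.finrank ℂ B := by
  have h1 := Submodule.finrank_quotient_add_finrank (B.submoduleOf Z)
  rw [(Submodule.submoduleOfEquivOfLe h).finrank_eq] at h1
  omega

theorem finrank_inf_ker {V W : Type*} [AddCommGroup V] [Module ℂ V] [AddCommGroup W]
    [Module ℂ W] (f : V →ₗ[ℂ] W) (N : Submodule ℂ V) [FiniteDimensional ℂ N] :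
    Module.finrank ℂ (N ⊓ LinearMap.ker f : Submodule ℂ V) =
      Module.finrank ℂ N - Module.finrank ℂ (N.map f) := by
  have h1 := LinearMap.finrank_range_add_finrank_ker (f.domRestrict N)
  rw [LinearMap.range_domRestrict, LinearMap.ker_domRestrict, ← Submodule.finrank_map_subtype_eq,
    Submodule.map_comap_subtype] at h1
  omega

/-- Evaluation of the Koszul complex of the homogeneous coordinate ring at the points. -/
def evalKoszul (L : Fin s → Fin (n + 1) → ℂ) :
    (Finset (Fin (n + 1)) → MvPolynomial (Fin (n + 1)) ℂ ⧸ pointsIdeal L) →ₗ[ℂ]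
      (Finset (Fin (n + 1)) × Fin s → ℂ) where
  toFun c q := evalQuotient L (c q.1) q.2
  map_add' c c' := by funext q; simp
  map_smul' a c := by funext q; simp

theorem evalKoszul_apply (L : Fin s → Fin (n + 1) → ℂ)
    (c : Finset (Fin (n + 1)) → MvPolynomial (Fin (n + 1)) ℂ ⧸ pointsIdeal L)
    (T : Finset (Fin (n + 1))) (a : Fin s) : evalKoszul L c (T, a) = evalQuotient L (c T) a := rfl

theorem evalKoszul_eq_zero {L : Fin s → Fin (n + 1) → ℂ} {d : ℕ}
    {c : Finset (Fin (n + 1)) → MvPolynomial (Fin (n + 1)) ℂ ⧸ pointsIdeal L}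
    (hc : ∀ T, c T ∈ quotientPiece (pointsIdeal L) d) (h : evalKoszul L c = 0) : c = 0 :=
  funext fun T => evalQuotient_eq_zero (hc T) (funext fun a => congrFun h (T, a))

/-- The matrix, polynomial in the points, that evaluates a Koszul chain with polynomial entries. -/
def chainMatrix (n s i j : ℕ) : Matrix (Finset (Fin (n + 1)) × Fin s)
    (Finset (Fin (n + 1)) × {m : Fin (n + 1) →₀ ℕ // m.degree = j - i})
    (MvPolynomial (Fin s × Fin (n + 1)) ℂ) :=
  Matrix.of fun p q => if p.1 = q.1 ∧ p.1.card = i ∧ i ≤ j then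
    rename (Prod.mk p.2) (monomial q.2.1 1) else 0

/-- The matrix, polynomial in the points, of the evaluated Koszul differential. -/
def differentialMatrix (n s : ℕ) : Matrix (Finset (Fin (n + 1)) × Fin s)
    (Finset (Fin (n + 1)) × Fin s) (MvPolynomial (Fin s × Fin (n + 1)) ℂ) :=
  Matrix.of fun p q => if p.2 = q.2 then
    ∑ k ∈ p.1ᶜ, if q.1 = insert k p.1 then
      (-1) ^ (p.1.filter fun t => t < k).card * X (p.2, k) else 0 else 0

/-- Evaluation of the entries of a matrix at a tuple of points. -/
abbrev atPoints {ι κ : Type*} (A : Matrix ι κ (MvPolynomial (Fin s × Fin (n + 1)) ℂ))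
    (L : Fin s → Fin (n + 1) → ℂ) : Matrix ι κ ℂ :=
  A.map (eval fun q => L q.1 q.2)

theorem chainMatrix_mulVec (L : Fin s → Fin (n + 1) → ℂ) (i j : ℕ)
    (v : Finset (Fin (n + 1)) × {m : Fin (n + 1) →₀ ℕ // m.degree = j - i} → ℂ)
    (T : Finset (Fin (n + 1))) (a : Fin s) :
    (atPoints (chainMatrix n s i j) L).mulVec v (T, a) =
      if T.card = i ∧ i ≤ j then eval (L a) (formOf fun m => v (T, m)) else 0 := by
  simp only [Matrix.mulVec, dotProduct, Fintype.sum_prod_type, chainMatrix, Matrix.map_apply,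
    Matrix.of_apply, eval_formOf]
  rw [Finset.sum_eq_single T]
  · by_cases h : T.card = i ∧ i ≤ j
    · rw [if_pos h]
      refine Finset.sum_congr rfl fun m _ => ?_
      rw [if_pos ⟨rfl, h⟩, eval_rename, mul_comm]
      rfl
    · rw [if_neg h]
      exact Finset.sum_eq_zero fun m _ => by rw [if_neg fun h' => h h'.2, map_zero, zero_mul]
  · intro T' _ hT'
    exact Finset.sum_eq_zero fun m _ => by rw [if_neg fun h' => hT' h'.1.symm, map_zero, zero_mul]
  · simp

theorem differentialMatrix_mulVec (L : Fin s → Fin (n + 1) → ℂ)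
    (v : Finset (Fin (n + 1)) × Fin s → ℂ) (T : Finset (Fin (n + 1))) (a : Fin s) :
    (atPoints (differentialMatrix n s) L).mulVec v (T, a) =
      ∑ k ∈ Tᶜ, (-1) ^ (T.filter fun t => t < k).card * (L a k * v (insert k T, a)) := by
  simp only [Matrix.mulVec, dotProduct, Fintype.sum_prod_type, differentialMatrix,
    Matrix.map_apply, Matrix.of_apply]
  have h1 : ∀ T' : Finset (Fin (n + 1)),
      ∑ b : Fin s, eval (fun q : Fin s × Fin (n + 1) => L q.1 q.2)
      (if a = b then ∑ k ∈ Tᶜ, if T' = insert k T then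
        (-1) ^ (T.filter fun t => t < k).card * X (a, k) else 0 else 0) * v (T', b) =
      ∑ k ∈ Tᶜ, if T' = insert k T then
        (-1) ^ (T.filter fun t => t < k).card * (L a k * v (insert k T, a)) else 0 := by
    intro T'
    rw [Finset.sum_eq_single a]
    · rw [if_pos rfl, map_sum, Finset.sum_mul]
      refine Finset.sum_congr rfl fun k _ => ?_
      split_ifs with h
      · subst h
        simp only [map_mul, map_pow, map_neg, map_one, eval_X, mul_assoc]
      · rw [map_zero, zero_mul]
    · intro b _ hb
      rw [if_neg hb.symm, map_zero, zero_mul]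
    · simp
  simp only [h1]
  rw [Finset.sum_comm]
  refine Finset.sum_congr rfl fun k _ => ?_
  rw [Finset.sum_ite_eq', if_pos (Finset.mem_univ _)]

theorem evalKoszul_koszulD (L : Fin s → Fin (n + 1) → ℂ)
    (c : Finset (Fin (n + 1)) → MvPolynomial (Fin (n + 1)) ℂ ⧸ pointsIdeal L) :
    evalKoszul L (koszulD (pointsIdeal L) c) =
      (atPoints (differentialMatrix n s) L).mulVec (evalKoszul L c) := by
  funext ⟨T, a⟩
  rw [differentialMatrix_mulVec, evalKoszul_apply]
  simp only [koszulD, LinearMap.coe_mk, AddHom.coe_mk, map_sum, map_mul, map_pow, map_neg,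
    map_one, Finset.sum_apply, Pi.mul_apply, Pi.pow_apply, Pi.neg_apply, Pi.one_apply,
    evalQuotient_mk, eval_X, evalKoszul_apply]

theorem map_evalKoszul_koszulChain (L : Fin s → Fin (n + 1) → ℂ) (i j : ℕ) :
    (koszulChain (pointsIdeal L) i j).map (evalKoszul L) =
      LinearMap.range (atPoints (chainMatrix n s i j) L).mulVecLin := by
  apply le_antisymm
  · rintro _ ⟨c, hc, rfl⟩
    choose f hf hfc using fun T => mem_quotientPiece.1 (mem_quotientPiece_of_mem_koszulChain hc T)
    refine ⟨fun q => (f q.1).coeff q.2.1, ?_⟩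
    funext ⟨T, a⟩
    rw [Matrix.mulVecLin_apply, chainMatrix_mulVec, evalKoszul_apply, ← hfc]
    split_ifs with h
    · rw [formOf_coeff (hf T), evalQuotient_mk]
    · rw [hfc, (mem_koszulChain.1 hc T).2 h, map_zero, Pi.zero_apply]
  · rintro _ ⟨v, rfl⟩
    refine ⟨fun T => if T.card = i ∧ i ≤ j then
      Ideal.Quotient.mk _ (formOf fun m => v (T, m)) else 0, ?_, ?_⟩
    · refine mem_koszulChain.2 fun T => ⟨fun h => ?_, fun h => if_neg h⟩
      rw [if_pos h]
      exact mem_quotientPiece.2 ⟨_, isHomogeneous_formOf _, rfl⟩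
    · funext ⟨T, a⟩
      rw [Matrix.mulVecLin_apply, chainMatrix_mulVec, evalKoszul_apply]
      split_ifs with h
      · rfl
      · rw [map_zero, Pi.zero_apply]

theorem finrank_koszulChain (L : Fin s → Fin (n + 1) → ℂ) (i j : ℕ) :
    Module.finrank ℂ (koszulChain (pointsIdeal L) i j) =
      (atPoints (chainMatrix n s i j) L).rank := by
  rw [← finrank_map_of_injOn (evalKoszul L) _ fun c hc =>
    evalKoszul_eq_zero (mem_quotientPiece_of_mem_koszulChain hc), map_evalKoszul_koszulChain]
  rfl

/-- Evaluation intertwines the Koszul differential with `differentialMatrix`, and it is injective on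
boundaries because all their entries have the same degree. -/
theorem finrank_map_koszulD (L : Fin s → Fin (n + 1) → ℂ) (i j : ℕ) :
    Module.finrank ℂ ((koszulChain (pointsIdeal L) i j).map (koszulD (pointsIdeal L))) =
      Module.finrank ℂ ((LinearMap.range (atPoints (chainMatrix n s i j) L).mulVecLin).map
        (atPoints (differentialMatrix n s) L).mulVecLin) := by
  rw [← finrank_map_of_injOn (evalKoszul L)]
  · have h : (evalKoszul L).comp (koszulD (pointsIdeal L)) =
        (atPoints (differentialMatrix n s) L).mulVecLin.comp (evalKoszul L) :=
      LinearMap.ext fun c => evalKoszul_koszulD L c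
    rw [← map_evalKoszul_koszulChain, ← Submodule.map_comp, ← Submodule.map_comp, h]
  · rintro _ ⟨c, hc, rfl⟩
    exact evalKoszul_eq_zero (koszulD_mem_quotientPiece hc)

instance finiteDimensional_koszulChain (L : Fin s → Fin (n + 1) → ℂ) (i j : ℕ) :
    FiniteDimensional ℂ (koszulChain (pointsIdeal L) i j) :=
  Module.Finite.of_injective ((evalKoszul L).domRestrict (koszulChain (pointsIdeal L) i j))
    ((injective_iff_map_eq_zero _).2 fun x hx => Subtype.ext
      (evalKoszul_eq_zero (mem_quotientPiece_of_mem_koszulChain x.2) hx))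

/-- Cycles minus boundaries, with cycles counted by rank-nullity. The boundaries lie among the
cycles because the differential squares to zero, so the truncated subtractions lose nothing. -/
theorem bettiNumber_pointsIdeal (L : Fin s → Fin (n + 1) → ℂ) (i j : ℕ) :
    bettiNumber (pointsIdeal L) i j =
      Module.finrank ℂ (LinearMap.range (atPoints (chainMatrix n s i j) L).mulVecLin) -
      Module.finrank ℂ ((LinearMap.range (atPoints (chainMatrix n s i j) L).mulVecLin).map
        (atPoints (differentialMatrix n s) L).mulVecLin) -
      Module.finrank ℂ ((LinearMap.range (atPoints (chainMatrix n s (i + 1) j) L).mulVecLin).map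
        (atPoints (differentialMatrix n s) L).mulVecLin) := by
  have hle : (koszulChain (pointsIdeal L) (i + 1) j).map (koszulD (pointsIdeal L)) ≤
      koszulChain (pointsIdeal L) i j ⊓ LinearMap.ker (koszulD (pointsIdeal L)) := by
    rintro _ ⟨c, hc, rfl⟩
    exact ⟨koszulD_mem_koszulChain hc, koszulD_koszulD _ c⟩
  have := Submodule.finiteDimensional_inf_left (koszulChain (pointsIdeal L) i j)
    (LinearMap.ker (koszulD (pointsIdeal L)))
  rw [bettiNumber, finrank_quotient_submoduleOf hle, finrank_inf_ker, finrank_map_koszulD,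
    finrank_map_koszulD, finrank_koszulChain]
  rfl

/-! ### Betti numbers of general points -/

/-- Once the points impose independent conditions, the evaluated chains fill all coordinates with
`T.card = i`, a space that no longer depends on `j`. This is what reduces the Betti table to
finitely many entries. -/
theorem range_chainMatrix_of_le {L : Fin s → Fin (n + 1) → ℂ} {i j : ℕ} (hij : i ≤ j)
    (h : ImposeIndependentConditions L (j - i)) (w : Finset (Fin (n + 1)) × Fin s → ℂ) :
    w ∈ LinearMap.range (atPoints (chainMatrix n s i j) L).mulVecLin ↔
      ∀ T a, T.card ≠ i → w (T, a) = 0 := by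
  constructor
  · rintro ⟨v, rfl⟩ T a hT
    rw [Matrix.mulVecLin_apply, chainMatrix_mulVec, if_neg fun h => hT h.1]
  · intro hw
    choose f hf hfw using fun T => h fun a => w (T, a)
    refine ⟨fun q => (f q.1).coeff q.2.1, ?_⟩
    funext ⟨T, a⟩
    rw [Matrix.mulVecLin_apply, chainMatrix_mulVec]
    split_ifs with hT
    · rw [formOf_coeff (hf T), hfw]
    · exact (hw T a fun hc => hT ⟨hc, hij⟩).symm

theorem range_chainMatrix_eq {L : Fin s → Fin (n + 1) → ℂ} {i j j' k : ℕ}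
    (h : ImposeIndependentConditions L k) (hL : ∀ a, L a ≠ 0) (hj : i + k ≤ j)
    (hj' : i + k ≤ j') :
    LinearMap.range (atPoints (chainMatrix n s i j) L).mulVecLin =
      LinearMap.range (atPoints (chainMatrix n s i j') L).mulVecLin := by
  ext w
  rw [range_chainMatrix_of_le (by omega) (h.mono hL (by omega)),
    range_chainMatrix_of_le (by omega) (h.mono hL (by omega))]

theorem range_chainMatrix_eq_bot (L : Fin s → Fin (n + 1) → ℂ) {i : ℕ} (hi : n + 1 < i) (j : ℕ) :
    LinearMap.range (atPoints (chainMatrix n s i j) L).mulVecLin = ⊥ := by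
  rw [eq_bot_iff]
  rintro _ ⟨v, rfl⟩
  refine (Submodule.mem_bot ℂ).2 (funext fun ⟨T, a⟩ => ?_)
  have := Finset.card_le_univ T
  rw [Fintype.card_fin] at this
  rw [Matrix.mulVecLin_apply, chainMatrix_mulVec, if_neg (by omega), Pi.zero_apply]

theorem bettiNumber_eq_of_le {L : Fin s → Fin (n + 1) → ℂ} {i j j' k : ℕ}
    (h : ImposeIndependentConditions L k) (hL : ∀ a, L a ≠ 0) (hj : i + 1 + k ≤ j)
    (hj' : i + 1 + k ≤ j') :
    bettiNumber (pointsIdeal L) i j = bettiNumber (pointsIdeal L) i j' := by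
  rw [bettiNumber_pointsIdeal, bettiNumber_pointsIdeal,
    range_chainMatrix_eq h hL (show i + k ≤ j by omega) (show i + k ≤ j' by omega),
    range_chainMatrix_eq h hL hj hj']

theorem bettiNumber_eq_zero (L : Fin s → Fin (n + 1) → ℂ) {i : ℕ} (hi : n + 1 < i) (j : ℕ) :
    bettiNumber (pointsIdeal L) i j = 0 := by
  rw [bettiNumber_pointsIdeal, range_chainMatrix_eq_bot L hi]
  simp

/-- Three ranks of polynomial matrices determine the Betti number, and each is constant on a
nonempty open set. -/
theorem exists_bettiNumber_eq (n s i j : ℕ) :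
    ∃ Φ : MvPolynomial (Fin s × Fin (n + 1)) ℂ, Φ ≠ 0 ∧
      ∀ L L' : Fin s → Fin (n + 1) → ℂ, eval (fun q => L q.1 q.2) Φ ≠ 0 →
        eval (fun q => L' q.1 q.2) Φ ≠ 0 →
          bettiNumber (pointsIdeal L) i j = bettiNumber (pointsIdeal L') i j := by
  obtain ⟨Φ₁, h₁, H₁⟩ := exists_rank_eq (chainMatrix n s i j)
  obtain ⟨Φ₂, h₂, H₂⟩ := exists_rank_eq (differentialMatrix n s * chainMatrix n s i j)
  obtain ⟨Φ₃, h₃, H₃⟩ := exists_rank_eq (differentialMatrix n s * chainMatrix n s (i + 1) j)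
  refine ⟨Φ₁ * Φ₂ * Φ₃, mul_ne_zero (mul_ne_zero h₁ h₂) h₃, fun L L' hL hL' => ?_⟩
  rw [map_mul, map_mul] at hL hL'
  have key : ∀ (M : Fin s → Fin (n + 1) → ℂ) (l : ℕ),
      Module.finrank ℂ ((LinearMap.range (atPoints (chainMatrix n s l j) M).mulVecLin).map
        (atPoints (differentialMatrix n s) M).mulVecLin) =
      (atPoints (differentialMatrix n s * chainMatrix n s l j) M).rank := by
    intro M l
    have h : atPoints (differentialMatrix n s * chainMatrix n s l j) M =
        atPoints (differentialMatrix n s) M * atPoints (chainMatrix n s l j) M := Matrix.map_mul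
    rw [h, Matrix.rank, Matrix.mulVecLin_mul, LinearMap.range_comp]
  rw [bettiNumber_pointsIdeal, bettiNumber_pointsIdeal, key, key, key, key,
    H₂ _ _ (right_ne_zero_of_mul (left_ne_zero_of_mul hL))
      (right_ne_zero_of_mul (left_ne_zero_of_mul hL')),
    H₃ _ _ (right_ne_zero_of_mul hL) (right_ne_zero_of_mul hL')]
  have := H₁ _ _ (left_ne_zero_of_mul (left_ne_zero_of_mul hL))
      (left_ne_zero_of_mul (left_ne_zero_of_mul hL'))
  rw [Matrix.rank, Matrix.rank] at this
  rw [this]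

theorem exists_imposeIndependentConditions {L₀ : Fin s → Fin (n + 1) → ℂ} {k : ℕ}
    (h₀ : ImposeIndependentConditions L₀ k) :
    ∃ Φ : MvPolynomial (Fin s × Fin (n + 1)) ℂ, Φ ≠ 0 ∧
      ∀ L : Fin s → Fin (n + 1) → ℂ, eval (fun q => L q.1 q.2) Φ ≠ 0 →
        ImposeIndependentConditions L k := by
  let A : Matrix (Fin s) {m : Fin (n + 1) →₀ ℕ // m.degree = k}
      (MvPolynomial (Fin s × Fin (n + 1)) ℂ) :=
    Matrix.of fun a m => rename (Prod.mk a) (monomial m.1 1)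
  have hA : ∀ L : Fin s → Fin (n + 1) → ℂ, ∀ v a,
      (atPoints A L).mulVec v a = eval (L a) (formOf v) := by
    intro L v a
    rw [eval_formOf]
    refine Finset.sum_congr rfl fun m _ => ?_
    simp only [A, Matrix.map_apply, Matrix.of_apply, eval_rename]
    rw [mul_comm]; rfl
  have hrk : ∀ L : Fin s → Fin (n + 1) → ℂ,
      ImposeIndependentConditions L k ↔ s ≤ (atPoints A L).rank := by
    intro L
    have h1 : s ≤ (atPoints A L).rank ↔ LinearMap.range (atPoints A L).mulVecLin = ⊤ := by
      constructor
      · intro h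
        refine Submodule.eq_top_of_finrank_eq (le_antisymm (Submodule.finrank_le _) ?_)
        rwa [Module.finrank_fin_fun]
      · intro h
        rw [Matrix.rank, h, finrank_top, Module.finrank_fin_fun]
    rw [h1, LinearMap.range_eq_top]
    constructor
    · intro h w
      obtain ⟨f, hf, hfw⟩ := h w
      refine ⟨fun m => f.coeff m.1, funext fun a => ?_⟩
      rw [Matrix.mulVecLin_apply, hA, formOf_coeff hf, hfw]
    · intro h w
      obtain ⟨v, hv⟩ := h w
      refine ⟨formOf v, isHomogeneous_formOf v, fun a => ?_⟩
      rw [← hA, ← hv, Matrix.mulVecLin_apply]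
  obtain ⟨Φ, h0, h⟩ := exists_rank_le A fun q => L₀ q.1 q.2
  refine ⟨Φ, by rintro rfl; simp at h0, fun L hL => (hrk L).2 (((hrk L₀).1 h₀).trans (h _ hL))⟩

/-- Any two tuples in one open set must have the same Betti numbers in all bidegrees, while only
finitely many open conditions may be imposed; vanishing for large `i` and stabilization for large
`j` supply the rest. -/
theorem exists_isResolutionGeneral {L₀ : Fin s → Fin (n + 1) → ℂ} {k : ℕ} (hk : k ≠ 0)
    (h₀ : ImposeIndependentConditions L₀ k) :
    ∃ Φ : MvPolynomial (Fin s × Fin (n + 1)) ℂ, Φ ≠ 0 ∧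
      ∀ L : Fin s → Fin (n + 1) → ℂ, eval (fun q => L q.1 q.2) Φ ≠ 0 →
        IsZeroDimScheme s (pointsIdeal L) ∧ IsResolutionGeneral s (pointsIdeal L) := by
  obtain ⟨Ψ, hΨ, hΨL⟩ := exists_imposeIndependentConditions h₀
  choose Φ hΦ hΦL using exists_bettiNumber_eq n s
  -- Betti numbers vanish for `i > n + 1`, and for `i ≤ n + 1` they are constant in `j` from `n + k
  -- + 2` on. The value `j = n + k + 3`, still inside the product, represents all larger `j`.
  obtain ⟨Θ, hΘe⟩ : ∃ Θ, Θ = Ψ * ∏ i ∈ Finset.range (n + 2),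
    ∏ j ∈ Finset.range (n + k + 4), Φ i j := ⟨_, rfl⟩
  have hΘ : Θ ≠ 0 := hΘe ▸ mul_ne_zero hΨ
    (Finset.prod_ne_zero_iff.2 fun i _ => Finset.prod_ne_zero_iff.2 fun j _ => hΦ i j)
  have hΘΨ : ∀ L : Fin s → Fin (n + 1) → ℂ, eval (fun q => L q.1 q.2) Θ ≠ 0 →
      ImposeIndependentConditions L k := fun L hL => hΨL L (by
    rw [hΘe, map_mul] at hL; exact left_ne_zero_of_mul hL)
  have hΘΦ : ∀ L : Fin s → Fin (n + 1) → ℂ, eval (fun q => L q.1 q.2) Θ ≠ 0 →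
      ∀ i < n + 2, ∀ j < n + k + 4, eval (fun q => L q.1 q.2) (Φ i j) ≠ 0 := by
    intro L hL i hi j hj
    rw [hΘe, map_mul, map_prod] at hL
    have h1 := Finset.prod_ne_zero_iff.1 (right_ne_zero_of_mul hL) i (Finset.mem_range.2 hi)
    rw [map_prod] at h1
    exact Finset.prod_ne_zero_iff.1 h1 j (Finset.mem_range.2 hj)
  refine ⟨Θ, hΘ, fun L hL => ⟨isZeroDimScheme_pointsIdeal (hΘΨ L hL) ((hΘΨ L hL).ne_zero hk),
    Θ, hΘ, fun L' _ hL' i j => ?_⟩⟩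
  by_cases hi : i < n + 2
  · by_cases hj : j < n + k + 4
    · exact hΦL i j L L' (hΘΦ L hL i hi j hj) (hΘΦ L' hL' i hi j hj)
    · have e : ∀ M : Fin s → Fin (n + 1) → ℂ, eval (fun q => M q.1 q.2) Θ ≠ 0 →
          bettiNumber (pointsIdeal M) i j = bettiNumber (pointsIdeal M) i (n + k + 3) :=
        fun M hM => bettiNumber_eq_of_le (hΘΨ M hM) ((hΘΨ M hM).ne_zero hk) (by omega) (by omega)
      rw [e L hL, e L' hL']
      exact hΦL i _ L L' (hΘΦ L hL i hi _ (by omega)) (hΘΦ L' hL' i hi _ (by omega))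
  · rw [bettiNumber_eq_zero L (by omega), bettiNumber_eq_zero L' (by omega)]


/-! ### Apolarity of points and powers of linear forms -/

/-- The linear form with coefficients `L`. -/
def linearForm {n : ℕ} (L : Fin (n + 1) → ℂ) : MvPolynomial (Fin (n + 1)) ℂ := ∑ k, L k • X k

theorem pderiv_linearForm {n : ℕ} (L : Fin (n + 1) → ℂ) (k : Fin (n + 1)) :
    pderiv k (linearForm L) = C (L k) := by
  classical
  simp only [linearForm, map_sum, Derivation.map_smul]
  rw [Finset.sum_eq_single k]
  · rw [pderiv_X_self, smul_eq_C_mul, mul_one]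
  · intro b _ hb
    rw [pderiv_X_of_ne hb, smul_zero]
  · simp

theorem descFactorial_mul_descFactorial_sub (d a b : ℕ) :
    d.descFactorial a * (d - a).descFactorial b = d.descFactorial (a + b) := by
  induction b with
  | zero => simp
  | succ b ih =>
    rw [← Nat.add_assoc, Nat.descFactorial_succ, Nat.descFactorial_succ, ← ih, Nat.sub_sub]
    ring

/-- The operator `A` acts on powers of `linearForm L` as a monomial differential operator of order
`e` whose symbol has the value `c` at `L`. -/
def ActsOnPowers {n : ℕ} (L : Fin (n + 1) → ℂ) (A : Module.End ℂ (MvPolynomial (Fin (n + 1)) ℂ))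
    (e : ℕ) (c : ℂ) : Prop :=
  ∀ d, A (linearForm L ^ d) = ((d.descFactorial e : ℂ) * c) • linearForm L ^ (d - e)

theorem ActsOnPowers.one {n : ℕ} (L : Fin (n + 1) → ℂ) : ActsOnPowers L 1 0 1 := by
  intro d
  simp

theorem ActsOnPowers.mul {n : ℕ} {L : Fin (n + 1) → ℂ}
    {A B : Module.End ℂ (MvPolynomial (Fin (n + 1)) ℂ)} {e f : ℕ} {c c' : ℂ}
    (hA : ActsOnPowers L A e c) (hB : ActsOnPowers L B f c') :
    ActsOnPowers L (A * B) (e + f) (c * c') := by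
  intro d
  rw [Module.End.mul_apply, hB, map_smul, hA, smul_smul, Nat.sub_sub, add_comm e f,
    ← descFactorial_mul_descFactorial_sub, Nat.cast_mul]
  congr 1
  ring

theorem ActsOnPowers.pow {n : ℕ} {L : Fin (n + 1) → ℂ}
    {A : Module.End ℂ (MvPolynomial (Fin (n + 1)) ℂ)} {c : ℂ}
    (hA : ActsOnPowers L A 1 c) (e : ℕ) : ActsOnPowers L (A ^ e) e (c ^ e) := by
  induction e with
  | zero => simpa using ActsOnPowers.one L
  | succ e ih => rw [pow_succ, pow_succ]; exact ih.mul hA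

theorem ActsOnPowers.pderiv {n : ℕ} (L : Fin (n + 1) → ℂ) (k : Fin (n + 1)) :
    ActsOnPowers L (MvPolynomial.pderiv k).toLinearMap 1 (L k) := by
  intro d
  rw [Derivation.coeFn_coe, pderiv_pow, pderiv_linearForm, Nat.descFactorial_one, smul_eq_C_mul,
    map_mul, map_natCast]
  ring

theorem ActsOnPowers.prod_ofFn {n : ℕ} {L : Fin (n + 1) → ℂ} {N : ℕ}
    {A : Fin N → Module.End ℂ (MvPolynomial (Fin (n + 1)) ℂ)} {e : Fin N → ℕ} {c : Fin N → ℂ}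
    (h : ∀ i, ActsOnPowers L (A i) (e i) (c i)) :
    ActsOnPowers L (List.ofFn A).prod (∑ i, e i) (∏ i, c i) := by
  induction N with
  | zero => simpa using ActsOnPowers.one L
  | succ N ih =>
    rw [List.ofFn_succ, List.prod_cons, Fin.sum_univ_succ, Fin.prod_univ_succ]
    exact (h 0).mul (ih fun i => h i.succ)

theorem diffMonomial_linearForm_pow {n : ℕ} (L : Fin (n + 1) → ℂ) (m : Fin (n + 1) →₀ ℕ) (d : ℕ) :
    diffMonomial m (linearForm L ^ d) =
      ((d.descFactorial m.degree : ℂ) * ∏ k, L k ^ m k) • linearForm L ^ (d - m.degree) := by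
  rw [Finsupp.degree_eq_sum]
  exact ActsOnPowers.prod_ofFn (fun k => (ActsOnPowers.pderiv L k).pow (m k)) d

/-- A form of degree `k` acts on the `d`-th power of a linear form as multiplication by its value at
`L`, a descending factorial, and a drop of the exponent to `d - k`. The monomials of `φ` are grouped
by degree to use this. -/
theorem internalProduct_linearForm_pow {n : ℕ} (φ : MvPolynomial (Fin (n + 1)) ℂ)
    (L : Fin (n + 1) → ℂ) (h : ∀ k, eval L (homogeneousComponent k φ) = 0) (d : ℕ) :
    internalProduct φ (linearForm L ^ d) = 0 := by
  classical
  rw [internalProduct, ← Finset.sum_fiberwise_of_maps_to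
    (fun m hm => Finset.mem_image_of_mem Finsupp.degree hm)]
  refine Finset.sum_eq_zero fun k _ => ?_
  have h1 := h k
  rw [homogeneousComponent_apply, map_sum] at h1
  calc _ = ∑ m ∈ φ.support with m.degree = k, (eval L (monomial m (coeff m φ))) •
        ((d.descFactorial k : ℂ) • linearForm L ^ (d - k)) := by
        refine Finset.sum_congr rfl fun m hm => ?_
        rw [diffMonomial_linearForm_pow, (Finset.mem_filter.1 hm).2, smul_smul, smul_smul,
          eval_monomial, Finsupp.prod_fintype _ _ fun _ => pow_zero _]
        congr 1
        ring
    _ = 0 := by rw [← Finset.sum_smul, h1, zero_smul]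

theorem internalProduct_sum {n : ℕ} (φ : MvPolynomial (Fin (n + 1)) ℂ) {ι : Type*} (s : Finset ι)
    (c : ι → ℂ) (F : ι → MvPolynomial (Fin (n + 1)) ℂ) :
    internalProduct φ (∑ i ∈ s, c i • F i) = ∑ i ∈ s, c i • internalProduct φ (F i) := by
  simp only [internalProduct, map_sum, map_smul, Finset.smul_sum]
  rw [Finset.sum_comm]
  exact Finset.sum_congr rfl fun i _ => Finset.sum_congr rfl fun m _ => smul_comm _ _ _

/-- The easy direction of the apolarity lemma: each power of a linear form is annihilated by
everything vanishing at the corresponding point. -/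
theorem isApolar_pointsIdeal {n s r d : ℕ} (L : Fin s → Fin (n + 1) → ℂ) (p : Fin s → Fin r → ℂ) :
    IsApolar (pointsIdeal L)
      (Submodule.span ℂ (Set.range fun i => ∑ a, p a i • linearForm (L a) ^ d)) := by
  intro φ hφ F hF
  obtain ⟨c, rfl⟩ := (Submodule.mem_span_range_iff_exists_fun ℂ).1 hF
  rw [internalProduct_sum]
  refine Finset.sum_eq_zero fun i _ => ?_
  rw [internalProduct_sum, Finset.sum_eq_zero, smul_zero]
  intro a _
  rw [internalProduct_linearForm_pow φ (L a) (fun k => eval_homogeneousComponent_eq_zero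
    (mem_pointsIdeal_iff.1 hφ a) k), smul_zero]

/-! ### Sums of powers -/

/-- The coefficients of `r` linear combinations of the `d`-th powers of `s` linear forms, as
polynomials in the coefficients of the linear forms and of the combinations. -/
def powerSumCoeff (n d r s : ℕ) (t : Fin r × {m : Fin (n + 1) →₀ ℕ // m.degree = d}) :
    MvPolynomial ((Fin s × Fin (n + 1)) ⊕ (Fin s × Fin r)) ℂ :=
  ∑ a, X (.inr (a, t.1)) *
    rename (fun k => .inl (a, k)) (monomial t.2.1 (t.2.1.multinomial : ℂ))

theorem eval_powerSumCoeff {n d r s : ℕ} (x : (Fin s × Fin (n + 1)) ⊕ (Fin s × Fin r) → ℂ)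
    (t : Fin r × {m : Fin (n + 1) →₀ ℕ // m.degree = d}) :
    eval x (powerSumCoeff n d r s t) =
      coeff t.2.1 (∑ a, x (.inr (a, t.1)) • linearForm (fun k => x (.inl (a, k))) ^ d) := by
  have hd : t.2.1.sum (fun _ m => m) = d := t.2.2
  rw [powerSumCoeff, map_sum, coeff_sum]
  refine Finset.sum_congr rfl fun a _ => ?_
  rw [map_mul, eval_X, eval_rename, eval_monomial, coeff_smul, linearForm,
    coeff_linearCombination_X_pow_of_fintype, if_pos hd, smul_eq_mul]
  rfl

theorem eval_pderiv_inr_powerSumCoeff {n d r s : ℕ}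
    (x : (Fin s × Fin (n + 1)) ⊕ (Fin s × Fin r) → ℂ)
    (t : Fin r × {m : Fin (n + 1) →₀ ℕ // m.degree = d}) (a : Fin s) (i : Fin r) :
    eval x (pderiv (.inr (a, i)) (powerSumCoeff n d r s t)) = if i = t.1 then
      eval (fun k => x (.inl (a, k))) (monomial t.2.1 (t.2.1.multinomial : ℂ)) else 0 := by
  classical
  have h0 : ∀ b : Fin s, pderiv (.inr (a, i) : (Fin s × Fin (n + 1)) ⊕ (Fin s × Fin r))
      (rename (fun k => .inl (b, k)) (monomial t.2.1 (t.2.1.multinomial : ℂ))) = 0 := by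
    intro b
    refine pderiv_eq_zero_of_notMem_vars fun h => ?_
    obtain ⟨k, _, hk⟩ := mem_vars_rename _ _ h
    cases hk
  rw [powerSumCoeff, map_sum, map_sum, Finset.sum_eq_single a]
  · rw [pderiv_mul, h0, mul_zero, add_zero, map_mul, eval_rename]
    split_ifs with hi
    · subst hi
      rw [pderiv_X_self, map_one, one_mul]; rfl
    · rw [pderiv_X_of_ne (by simpa using Ne.symm hi), map_zero, zero_mul]
  · intro b _ hb
    rw [pderiv_mul, h0, mul_zero, add_zero, pderiv_X_of_ne (by simp [hb]), zero_mul, map_zero]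
  · simp

theorem eval_pderiv_inl_powerSumCoeff {n d r s : ℕ}
    (x : (Fin s × Fin (n + 1)) ⊕ (Fin s × Fin r) → ℂ)
    (t : Fin r × {m : Fin (n + 1) →₀ ℕ // m.degree = d}) (a : Fin s) (k : Fin (n + 1)) :
    eval x (pderiv (.inl (a, k)) (powerSumCoeff n d r s t)) = x (.inr (a, t.1)) *
      eval (fun k => x (.inl (a, k))) (pderiv k (monomial t.2.1 (t.2.1.multinomial : ℂ))) := by
  classical
  rw [powerSumCoeff, map_sum, map_sum, Finset.sum_eq_single a]
  · have h1 := pderiv_rename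
      (f := fun k => (.inl (a, k) : (Fin s × Fin (n + 1)) ⊕ (Fin s × Fin r)))
      (fun k l h => by simpa using h) k (monomial t.2.1 (t.2.1.multinomial : ℂ))
    rw [pderiv_mul, pderiv_X_of_ne (by simp), zero_mul, zero_add, h1, map_mul, eval_X, eval_rename]
    rfl
  · intro b _ hb
    rw [pderiv_mul, pderiv_X_of_ne (by simp), zero_mul, zero_add, pderiv_eq_zero_of_notMem_vars,
      mul_zero, map_zero]
    intro h
    obtain ⟨l, _, hl⟩ := mem_vars_rename _ _ h
    simp only [Sum.inl.injEq, Prod.mk.injEq] at hl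
    exact hb hl.1
  · simp

/-! ### Polar octahedra of pencils of cubic surfaces -/

theorem imposeIndependentConditions_octad : ImposeIndependentConditions octad 3 := by
  intro w
  -- The cubes of the variables fix the values at the coordinate points and contribute `S - 2 * w i`
  -- at the opposite-sign point `i + 4`. The product of the variables other than `X i` vanishes at
  -- the coordinate points, is 1 at point `i + 4` and -1 at the other three. Hence its coefficient
  -- `c i` solves `2 * c i - ∑ c = v i`, where `∑ c = -T`.
  let S := w 0 + w 1 + w 2 + w 3
  let v : Fin 4 → ℂ := ![w 4 - (S - 2 * w 0), w 5 - (S - 2 * w 1), w 6 - (S - 2 * w 2),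
    w 7 - (S - 2 * w 3)]
  let T := (v 0 + v 1 + v 2 + v 3) / 2
  refine ⟨C (w 0) * X 0 ^ 3 + C (w 1) * X 1 ^ 3 + C (w 2) * X 2 ^ 3 + C (w 3) * X 3 ^ 3 +
    C ((v 0 - T) / 2) * (X 1 * X 2 * X 3) + C ((v 1 - T) / 2) * (X 0 * X 2 * X 3) +
    C ((v 2 - T) / 2) * (X 0 * X 1 * X 3) + C ((v 3 - T) / 2) * (X 0 * X 1 * X 2), ?_, ?_⟩
  · have h1 : ∀ (c : ℂ) (i : Fin 4), (C c * X i ^ 3 : MvPolynomial (Fin 4) ℂ).IsHomogeneous 3 :=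
      fun c i => isHomogeneous_C_mul_X_pow c i 3
    have h2 : ∀ (c : ℂ) (i j k : Fin 4),
        (C c * (X i * X j * X k) : MvPolynomial (Fin 4) ℂ).IsHomogeneous 3 := fun c i j k =>
      (((isHomogeneous_X ℂ i).mul (isHomogeneous_X ℂ j)).mul (isHomogeneous_X ℂ k)).C_mul c
    exact (((((((h1 _ _).add (h1 _ _)).add (h1 _ _)).add (h1 _ _)).add (h2 _ _ _ _)).add
      (h2 _ _ _ _)).add (h2 _ _ _ _)).add (h2 _ _ _ _)
  · intro a
    fin_cases a <;> simp [octad, T, v, S] <;> ring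

/-- Terracini's lemma at the octad: after absorbing the multinomial coefficients into `c`, pairing
with the derivatives in the weights evaluates the two cubics, and pairing with the derivatives in
the points gives the weighted gradient condition. -/
theorem powerSumCoeff_jacobian (c : Fin 2 × {m : Fin (3 + 1) →₀ ℕ // m.degree = 3} → ℂ)
    (h : ∀ j, ∑ t, c t * eval (Sum.elim (fun q => octad q.1 q.2) fun q => octadMarking q.1 q.2)
      (pderiv j (powerSumCoeff 3 3 2 8 t)) = 0) : c = 0 := by
  have hm : ∀ m : {m : Fin (3 + 1) →₀ ℕ // m.degree = 3},
      (monomial m.1 (m.1.multinomial : ℂ) : MvPolynomial (Fin 4) ℂ) =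
        C (m.1.multinomial : ℂ) * monomial m.1 1 := fun m => by rw [C_mul_monomial, mul_one]
  have hG := octad_cubics_eq_zero (fun r => formOf fun m => c (r, m) * (m.1.multinomial : ℂ))
    (fun r => isHomogeneous_formOf _)
    (by
      intro r a
      rw [eval_formOf, ← h (.inr (a, r)), Fintype.sum_prod_type, Finset.sum_eq_single r]
      · refine Finset.sum_congr rfl fun m _ => ?_
        rw [eval_pderiv_inr_powerSumCoeff, if_pos rfl, hm, map_mul, eval_C, mul_assoc]
        rfl
      · intro b _ hb
        refine Finset.sum_eq_zero fun m _ => ?_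
        rw [eval_pderiv_inr_powerSumCoeff, if_neg hb.symm, mul_zero]
      · simp)
    (by
      intro a k
      rw [← h (.inl (a, k)), Fintype.sum_prod_type]
      refine Finset.sum_congr rfl fun r _ => ?_
      rw [eval_pderiv_formOf, Finset.mul_sum]
      refine Finset.sum_congr rfl fun m _ => ?_
      rw [eval_pderiv_inl_powerSumCoeff, hm, pderiv_C_mul, map_mul, eval_C]
      simp only [Sum.elim_inr, Sum.elim_inl]
      ring)
  funext ⟨r, m⟩
  have h1 := congrFun (formOf_eq_zero (congrFun hG r)) m
  refine (mul_eq_zero.1 h1).resolve_right ?_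
  exact Nat.cast_ne_zero.2 (Nat.multinomial_pos _ _).ne'

/-- The numerical condition is the equality 40 = 40. Chevalley's theorem is applied on the open set
where the eight points have generic Betti numbers, so a general pair of cubics is a pair of power
sums over such points. -/
theorem nondegenerate_three_three_two_eight : Nondegenerate 3 3 2 8 := by
  refine ⟨by decide, ?_⟩
  obtain ⟨Φ, hΦ, hΦL⟩ := exists_isResolutionGeneral three_ne_zero imposeIndependentConditions_octad
  obtain ⟨u, hu, huy⟩ := exists_eval_eq_of_aeval_injective (powerSumCoeff 3 3 2 8)
    (aeval_injective_of_jacobian _ _ powerSumCoeff_jacobian) (rename Sum.inl Φ)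
    ((map_ne_zero_iff _ (rename_injective _ Sum.inl_injective)).2 hΦ)
  refine ⟨u, hu, fun F hF _ hFu => ?_⟩
  obtain ⟨x, hx, hxΦ⟩ := huy _ hFu
  rw [eval_rename] at hxΦ
  let L : Fin 8 → Fin 4 → ℂ := fun a k => x (.inl (a, k))
  obtain ⟨hL, hL'⟩ := hΦL L hxΦ
  refine ⟨pointsIdeal L, hL, ?_, hL'⟩
  have hFe : F = fun i => ∑ a, x (.inr (a, i)) • linearForm (L a) ^ 3 := by
    funext i
    have hh : (∑ a, x (.inr (a, i)) • linearForm (L a) ^ 3).IsHomogeneous 3 := by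
      refine IsHomogeneous.sum _ _ _ fun a _ => ?_
      rw [smul_eq_C_mul]
      have : (linearForm (L a)).IsHomogeneous 1 := IsHomogeneous.sum _ _ _ fun k _ => by
        rw [smul_eq_C_mul]; exact isHomogeneous_C_mul_X _ _
      exact (this.pow 3).C_mul _
    rw [← formOf_coeff (hF i), ← formOf_coeff hh]
    congr 1
    funext m
    rw [← hx (i, m), eval_powerSumCoeff]
  rw [hFe]
  exact isApolar_pointsIdeal L fun a i => x (.inr (a, i))


/-! ### Parameter counts -/

/-- There are more ratios `α i / β i` than the transcendence degree, so they satisfy a polynomial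
relation, which specializes under `ψ`. The ratios are formed in the localization at the product of
the `β i`, to which `ψ` extends. -/
theorem exists_ne_zero_eval_div_eq_zero {ι B : Type} [Fintype ι] [CommRing B] [IsDomain B]
    [Algebra ℂ B] (hB : Algebra.trdeg ℂ B < Fintype.card ι) (α β : ι → B) :
    ∃ Φ : MvPolynomial ι ℂ, Φ ≠ 0 ∧ ∀ ψ : B →ₐ[ℂ] ℂ, (∀ i, ψ (β i) ≠ 0) →
      eval (fun i => ψ (α i) / ψ (β i)) Φ = 0 := by
  classical
  by_cases h0 : ∃ i, β i = 0
  · obtain ⟨i, hi⟩ := h0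
    exact ⟨1, one_ne_zero, fun ψ hψ => (hψ i (by rw [hi, map_zero])).elim⟩
  push Not at h0
  let Δ := ∏ i, β i
  have hΔ : Δ ≠ 0 := Finset.prod_ne_zero_iff.mpr fun i _ => h0 i
  have hle : Submonoid.powers Δ ≤ nonZeroDivisors B :=
    powers_le_nonZeroDivisors_of_noZeroDivisors hΔ
  let S := Localization.Away Δ
  have : IsDomain S := IsLocalization.isDomain_localization hle
  have : FaithfulSMul B S := by
    rw [faithfulSMul_iff_algebraMap_injective]
    exact IsLocalization.injective S hle
  have hx : ∀ i, ∃ s : S, s * algebraMap B S (β i) = algebraMap B S (α i) := fun i => by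
    have hu : IsUnit (algebraMap B S (β i)) :=
      isUnit_of_dvd_unit ((algebraMap B S).map_dvd (Finset.dvd_prod_of_mem β (Finset.mem_univ i)))
        (IsLocalization.Away.algebraMap_isUnit Δ)
    obtain ⟨u, hu⟩ := hu
    exact ⟨algebraMap B S (α i) * ↑u⁻¹, by rw [← hu, mul_assoc, Units.inv_mul, mul_one]⟩
  choose x hx using hx
  have htr : Algebra.trdeg ℂ S = Algebra.trdeg ℂ B := by
    have : Algebra.IsAlgebraic B S := IsLocalization.isAlgebraic S (Submonoid.powers Δ)
    rw [← trdeg_add_eq ℂ B (A := S), trdeg_eq_zero (R := B), add_zero]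
  have hdep : ¬ AlgebraicIndependent ℂ x := fun h => by
    have := h.cardinalMk_le_trdeg
    rw [htr, Cardinal.mk_fintype] at this
    exact absurd this (not_le.mpr hB)
  rw [algebraicIndependent_iff] at hdep
  push Not at hdep
  obtain ⟨Φ, hΦ, hΦ0⟩ := hdep
  refine ⟨Φ, hΦ0, fun ψ hψ => ?_⟩
  have hψΔ : ∀ y : Submonoid.powers Δ, IsUnit (ψ y) := by
    rintro ⟨_, k, rfl⟩
    rw [isUnit_iff_ne_zero, map_pow, map_prod]
    exact pow_ne_zero _ (Finset.prod_ne_zero_iff.mpr fun i _ => hψ i)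
  let ψ' : S →ₐ[ℂ] ℂ := IsLocalization.liftAlgHom (M := Submonoid.powers Δ) hψΔ
  have hψ' : ∀ b, ψ' (algebraMap B S b) = ψ b := fun b => by
    simp [ψ', IsLocalization.lift_eq]
  have hval : (fun i => ψ (α i) / ψ (β i)) = fun i => ψ' (x i) := by
    funext i
    rw [div_eq_iff (hψ i), ← hψ', ← hψ', ← map_mul, hx]
  rw [hval]
  have h1 := congrArg ψ' hΦ
  rw [map_zero, ← AlgHom.comp_apply, MvPolynomial.comp_aeval, aeval_eq_eval] at h1
  exact h1

theorem exists_algHom_extending {τ A : Type} [CommRing A] [Algebra ℂ A] (φ : A →ₐ[ℂ] ℂ)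
    (v : τ → ℂ) : ∃ ψ : MvPolynomial τ A →ₐ[ℂ] ℂ, (∀ j, ψ (X j) = v j) ∧ ∀ c, ψ (C c) = φ c := by
  let _ : Algebra A ℂ := φ.toRingHom.toAlgebra
  have : IsScalarTower ℂ A ℂ := IsScalarTower.of_algebraMap_eq fun c => (φ.commutes c).symm
  exact ⟨(aeval v : MvPolynomial τ A →ₐ[A] ℂ).restrictScalars ℂ, fun j => aeval_X v j,
    fun c => aeval_C v c⟩

/-- If `g` and `h` are linear combinations of `n` sections and the sections vary in a family of
dimension `d`, then `g / h` does not take general values at `2 * n + d` places. -/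
theorem exists_ne_zero_of_two_mul_add_le_card {N n d : ℕ} {A : Type} [CommRing A] [IsDomain A]
    [Algebra ℂ A] (hA : Algebra.trdeg ℂ A ≤ d) (I : Finset (Fin N)) (hI : I.Nonempty)
    (hcard : 2 * n + d ≤ I.card) (e : Fin N → Fin n → A) :
    ∃ Φ : MvPolynomial (Fin N) ℂ, Φ ≠ 0 ∧ ∀ π : Fin N → ℂ, eval π Φ ≠ 0 →
      ∀ (φ : A →ₐ[ℂ] ℂ) (a b : Fin n → ℂ),
        (∀ i ∈ I, ∑ j, b j * φ (e i j) ≠ 0) →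
        ¬ ∀ i ∈ I, ∑ j, a j * φ (e i j) = π i * ∑ j, b j * φ (e i j) := by
  classical
  -- Common scaling of `a` and `b` normalizes one nonzero coordinate `b k` to 1. This leaves `n + (n
  -- - 1) + d` parameters, one less than the required number of places.
  have key : ∀ k : Fin n, ∃ Φ : MvPolynomial (Fin N) ℂ, Φ ≠ 0 ∧
      ∀ π : Fin N → ℂ, eval π Φ ≠ 0 → ∀ (φ : A →ₐ[ℂ] ℂ) (a b : Fin n → ℂ), b k ≠ 0 →
        (∀ i ∈ I, ∑ j, b j * φ (e i j) ≠ 0) →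
        ¬ ∀ i ∈ I, ∑ j, a j * φ (e i j) = π i * ∑ j, b j * φ (e i j) := by
    intro k
    let B := MvPolynomial (Fin n ⊕ {j : Fin n // j ≠ k}) A
    let cb : Fin n → B := fun j => if h : j = k then 1 else X (.inr ⟨j, h⟩)
    let α : I → B := fun i => ∑ j, X (.inl j) * C (e i j)
    let β : I → B := fun i => ∑ j, cb j * C (e i j)
    have htr : Algebra.trdeg ℂ B < Fintype.card I := by
      rw [← trdeg_add_eq ℂ A (A := B), MvPolynomial.trdeg_of_isDomain, Cardinal.lift_id,
        Cardinal.mk_fintype]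
      refine (add_le_add_left hA _).trans_lt ?_
      have hn : 0 < n := k.pos
      have hc : Fintype.card (Fin n ⊕ {j : Fin n // j ≠ k}) = n + (n - 1) := by
        rw [Fintype.card_sum, Fintype.card_fin, Fintype.card_subtype_compl, Fintype.card_fin,
          Fintype.card_subtype_eq]
      rw [hc, Fintype.card_coe]
      exact_mod_cast (by omega : d + (n + (n - 1)) < I.card)
    obtain ⟨Φ, hΦ, h⟩ := exists_ne_zero_eval_div_eq_zero htr α β
    have hinj : Function.Injective (rename (Subtype.val : I → Fin N) (R := ℂ)) :=
      rename_injective _ Subtype.val_injective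
    refine ⟨rename Subtype.val Φ, (map_ne_zero_iff _ hinj).mpr hΦ,
      fun π hπ φ a b hb hden heq => hπ ?_⟩
    obtain ⟨ψ, hψX, hψC⟩ := exists_algHom_extending φ
      (Sum.elim (fun j => a j / b k) fun j : {j : Fin n // j ≠ k} => b j / b k)
    have hψb : ∀ j, ψ (cb j) = b j / b k := fun j => by
      by_cases hj : j = k
      · rw [show cb j = 1 from dif_pos hj, map_one, hj, div_self hb]
      · simp only [cb, dif_neg hj, hψX, Sum.elim_inr]
    have hα : ∀ i : I, ψ (α i) = (∑ j, a j * φ (e i j)) / b k := fun i => by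
      simp only [α, map_sum, map_mul, hψX, hψC, Sum.elim_inl, Finset.sum_div]
      exact Finset.sum_congr rfl fun j _ => by ring
    have hβ : ∀ i : I, ψ (β i) = (∑ j, b j * φ (e i j)) / b k := fun i => by
      simp only [β, map_sum, map_mul, hψb, hψC, Finset.sum_div]
      exact Finset.sum_congr rfl fun j _ => by ring
    have := h ψ fun i => by rw [hβ]; exact div_ne_zero (hden i i.2) hb
    rw [eval_rename]
    convert this using 2
    congr 1
    funext i
    rw [hα, hβ, Function.comp_apply, heq i i.2, div_div_div_cancel_right₀ hb,
      mul_div_cancel_right₀ _ (hden i i.2)]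
  choose Φ hΦ h using key
  refine ⟨∏ k, Φ k, Finset.prod_ne_zero_iff.mpr fun k _ => hΦ k, fun π hπ φ a b hden => ?_⟩
  rw [map_prod, Finset.prod_ne_zero_iff] at hπ
  by_cases hb : ∃ k, b k ≠ 0
  · obtain ⟨k, hk⟩ := hb
    exact h k π (hπ k (Finset.mem_univ k)) φ a b hk hden
  · push Not at hb
    obtain ⟨i, hi⟩ := hI
    exact (hden i hi (by simp [hb])).elim


/-! ### Places and residues -/

section

variable {K : Type*} [Field K] [Algebra ℂ K]

theorem Place.valuation_algebraMap (P : Place K) {c : ℂ} (hc : c ≠ 0) :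
    P.localRing.valuation (algebraMap ℂ K c) = 1 := by
  have h1 := (P.localRing.valuation_le_one_iff _).mpr (P.const_mem c)
  have h2 := (P.localRing.valuation_le_one_iff _).mpr (P.const_mem c⁻¹)
  rw [map_inv₀, map_inv₀] at h2
  have h0 : P.localRing.valuation (algebraMap ℂ K c) ≠ 0 := by simpa using hc
  exact le_antisymm h1 ((inv_le_one₀ (zero_lt_iff.mpr h0)).mp h2)

/-- The residue field of a place of a function field in one variable is `ℂ`. -/
theorem Place.exists_valuation_sub_lt_one (hK : Algebra.trdeg ℂ K ≤ 1) (P : Place K) {a : K}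
    (ha : P.localRing.valuation a ≤ 1) :
    ∃ c : ℂ, P.localRing.valuation (a - algebraMap ℂ K c) < 1 := by
  by_contra! h
  -- If no constant works, every nonzero polynomial in `a` is a unit at `P`. Then `a` is
  -- transcendental, ℂ(a) lies in the local ring and `K` is algebraic over it; as valuation rings
  -- are integrally closed, the local ring is all of `K`, which is excluded.
  have h1 : ∀ c : ℂ, P.localRing.valuation (a - algebraMap ℂ K c) = 1 := fun c =>
    le_antisymm ((P.localRing.valuation_le_one_iff _).mpr (sub_mem
      ((P.localRing.valuation_le_one_iff _).mp ha) (P.const_mem c))) (h c)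
  have hp : ∀ p : Polynomial ℂ, p ≠ 0 → P.localRing.valuation (Polynomial.aeval a p) = 1 := by
    intro p hp0
    rw [(IsAlgClosed.splits p).eq_prod_roots]
    rw [map_mul, Polynomial.aeval_C, map_mul, P.valuation_algebraMap (by simpa using hp0), one_mul,
      map_multiset_prod, map_multiset_prod]
    refine Multiset.prod_eq_one fun x hx => ?_
    simp only [Multiset.map_map, Multiset.mem_map, Function.comp_apply, map_sub,
      Polynomial.aeval_X, Polynomial.aeval_C] at hx
    obtain ⟨c, -, rfl⟩ := hx
    exact h1 c
  have htr : AlgebraicIndependent ℂ fun _ : Unit => a := by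
    rw [algebraicIndependent_unique_type_iff, transcendental_iff]
    intro p hp0
    by_contra hne
    have := hp p hne
    rw [hp0, map_zero] at this
    exact zero_ne_one this
  have hbasis : IsTranscendenceBasis ℂ fun _ : Unit => a := by
    refine htr.isTranscendenceBasis_of_lift_trdeg_le_of_finite ?_
    simpa using hK
  have hal : Algebra.IsAlgebraic (IntermediateField.adjoin ℂ (Set.range fun _ : Unit => a)) K :=
    hbasis.isAlgebraic_field
  rw [Set.range_const] at hal
  have hF : ∀ w : IntermediateField.adjoin ℂ {a}, (w : K) ∈ P.localRing := by
    rintro ⟨w, hw⟩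
    obtain ⟨r, s, rfl⟩ := IntermediateField.mem_adjoin_simple_iff ℂ w |>.mp hw
    rw [← P.localRing.valuation_le_one_iff, map_div₀]
    have hle : ∀ p : Polynomial ℂ, P.localRing.valuation (Polynomial.aeval a p) ≤ 1 := fun p => by
      by_cases hp0 : p = 0
      · simp [hp0]
      · exact (hp p hp0).le
    by_cases hs : s = 0
    · simp [hs]
    · rw [hp s hs, div_one]
      exact hle r
  refine P.ne_top (eq_top_iff.mpr fun z _ => ?_)
  obtain ⟨p, hpm, hpz⟩ := (Algebra.IsAlgebraic.isAlgebraic (R :=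
    IntermediateField.adjoin ℂ {a}) z).isIntegral
  let j : IntermediateField.adjoin ℂ {a} →+* P.localRing :=
    (algebraMap (IntermediateField.adjoin ℂ {a}) K).codRestrict P.localRing.toSubring hF
  have hz : IsIntegral P.localRing z := by
    refine ⟨p.map j, hpm.map j, ?_⟩
    rw [Polynomial.eval₂_map]
    exact hpz
  obtain ⟨y, rfl⟩ := IsIntegrallyClosed.isIntegral_iff.mp hz
  exact y.2

/-- The leading coefficient at `P` of the elements of a finite dimensional space. -/
theorem Place.exists_functional (hK : Algebra.trdeg ℂ K ≤ 1) (P : Place K) (V : Submodule ℂ K)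
    [FiniteDimensional ℂ V] (hV : V ≠ ⊥) :
    ∃ l : V →ₗ[ℂ] ℂ, l ≠ 0 ∧ ∀ (g h : V) (c : ℂ), (h : K) ≠ 0 →
      P.localRing.valuation ((g : K) / h - algebraMap ℂ K c) < 1 → l g = c * l h := by
  classical
  set v := P.localRing.valuation with hv
  let b := Module.finBasis ℂ V
  have : Nonempty (Fin (Module.finrank ℂ V)) := by
    rw [← Fin.pos_iff_nonempty, Module.finrank_pos_iff]
    exact (Submodule.nontrivial_iff_ne_bot).mpr hV
  -- The functional sends `g` to the residue of `g / b j₀`, where `b j₀` has the largest valuation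
  -- in the space; it is therefore 1 on `b j₀`.
  obtain ⟨j₀, hj₀⟩ := Finite.exists_max fun j => v (b j : K)
  have hs0 : (b j₀ : K) ≠ 0 := fun h => b.ne_zero j₀ (Subtype.ext h)
  have hvs : 0 < v (b j₀ : K) := zero_lt_iff.mpr ((map_ne_zero v).mpr hs0)
  have hle : ∀ g : V, v (g : K) ≤ v (b j₀ : K) := fun g => by
    conv_lhs => rw [← b.sum_repr g]
    rw [AddSubmonoidClass.coe_finsetSum]
    refine v.map_sum_le fun j _ => ?_
    rw [Submodule.coe_smul, Algebra.smul_def, map_mul]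
    refine le_trans ?_ (hj₀ j)
    by_cases h0 : b.repr g j = 0
    · simp [h0]
    · rw [P.valuation_algebraMap h0, one_mul]
  have hex : ∀ g : V, ∃ c : ℂ, v ((g : K) / b j₀ - algebraMap ℂ K c) < 1 := fun g =>
    P.exists_valuation_sub_lt_one hK (by rw [map_div₀]; exact div_le_one_of_le₀ (hle g) hvs.le)
  have huniq : ∀ {x : K} {c c' : ℂ}, v (x - algebraMap ℂ K c) < 1 →
      v (x - algebraMap ℂ K c') < 1 → c = c' := by
    intro x c c' h1 h2
    by_contra hne
    have := v.map_sub_lt h2 h1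
    rw [sub_sub_sub_cancel_left, ← map_sub, P.valuation_algebraMap (sub_ne_zero.mpr hne)] at this
    exact lt_irrefl _ this
  choose l hl using hex
  let L : V →ₗ[ℂ] ℂ :=
    { toFun := l
      map_add' := fun g h => huniq (hl (g + h)) (by
        have := v.map_add_lt (hl g) (hl h)
        rwa [show (g : K) / b j₀ - algebraMap ℂ K (l g) + ((h : K) / b j₀ - algebraMap ℂ K (l h))
          = ((g + h : V) : K) / b j₀ - algebraMap ℂ K (l g + l h) by
            rw [map_add, Submodule.coe_add]; ring] at this)
      map_smul' := fun c g => huniq (hl (c • g)) (by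
        have : v (algebraMap ℂ K c * ((g : K) / b j₀ - algebraMap ℂ K (l g))) < 1 := by
          rw [map_mul]
          by_cases h0 : c = 0
          · simp [h0]
          · rw [P.valuation_algebraMap h0, one_mul]; exact hl g
        rwa [show algebraMap ℂ K c * ((g : K) / b j₀ - algebraMap ℂ K (l g))
          = ((c • g : V) : K) / b j₀ - algebraMap ℂ K (c • l g) by
            rw [smul_eq_mul, map_mul, Submodule.coe_smul, Algebra.smul_def]; ring] at this) }
  refine ⟨L, fun h0 => ?_, fun g h c hh hlt => ?_⟩
  · have h1 : l (b j₀) = 1 := huniq (hl (b j₀)) (by rw [div_self hs0]; simp)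
    exact one_ne_zero (h1.symm.trans (LinearMap.congr_fun h0 (b j₀)))
  · have h1 : L (g - c • h) = 0 := huniq (hl _) (by
      rw [map_zero, sub_zero, map_div₀, div_lt_one₀ hvs]
      refine lt_of_lt_of_le ?_ (hle h)
      have : ((g - c • h : V) : K) = ((g : K) / h - algebraMap ℂ K c) * h := by
        rw [Submodule.coe_sub, Submodule.coe_smul, Algebra.smul_def]; field_simp
      rw [this, map_mul]
      exact mul_lt_of_lt_one_left (zero_lt_iff.mpr ((map_ne_zero v).mpr hh)) hlt)
    rw [map_sub, map_smul, sub_eq_zero] at h1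
    exact h1

/-- The quotient of two elements of an `n`-dimensional space does not take general values at
`2 * n` places. -/
theorem exists_ne_zero_of_two_mul_finrank_le_card (hK : Algebra.trdeg ℂ K ≤ 1) {N : ℕ}
    (Q : Fin N → Place K) (I : Finset (Fin N)) (V : Submodule ℂ K) [FiniteDimensional ℂ V]
    (hV : 2 * Module.finrank ℂ V ≤ I.card) :
    ∃ Φ : MvPolynomial (Fin N) ℂ, Φ ≠ 0 ∧ ∀ π : Fin N → ℂ, eval π Φ ≠ 0 →
      ∀ g ∈ V, ∀ h ∈ V, h ≠ 0 → (∀ c : ℂ, g ≠ c • h) →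
        ¬ ∀ i ∈ I, (Q i).localRing.valuation (g / h - algebraMap ℂ K (π i)) < 1 := by
  classical
  induction hn : Module.finrank ℂ V using Nat.strong_induction_on generalizing V with
  | _ n ih =>
  by_cases hn0 : V = ⊥
  · subst hn0
    exact ⟨1, one_ne_zero, fun π _ g _ h hh h0 => absurd ((Submodule.mem_bot ℂ).mp hh) h0⟩
  choose l hl0 hl using fun i => (Q i).exists_functional hK V hn0
  -- If the leading coefficient of `h` vanishes at some place of `I`, so does that of `g`, and the
  -- quotient already comes from the smaller space `U i`: induction on the dimension. Otherwise the
  -- values are quotients of leading coefficients and the parameter count applies with `d = 0`.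
  let U : Fin N → Submodule ℂ K := fun i => (LinearMap.ker (l i)).map V.subtype
  have hU : ∀ i, Module.finrank ℂ (U i) < n := fun i => by
    rw [← hn, Submodule.finrank_map_subtype_eq]
    exact Submodule.finrank_lt fun h => hl0 i (LinearMap.ker_eq_top.mp h)
  choose Ψ hΨ0 hΨ using fun i => ih _ (hU i) (U i) (by have := hU i; omega) rfl
  have hnpos : 0 < n := by
    rw [← hn, Module.finrank_pos_iff]
    exact (Submodule.nontrivial_iff_ne_bot).mpr hn0
  let b := Module.finBasisOfFinrankEq ℂ V hn
  obtain ⟨Φ, hΦ0, hΦ⟩ := exists_ne_zero_of_two_mul_add_le_card (A := ℂ) (d := 0) (n := n)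
    (by rw [trdeg_eq_zero]; simp) I (Finset.card_pos.mp (by omega)) (by omega)
    fun i j => l i (b j)
  refine ⟨Φ * ∏ i, Ψ i, mul_ne_zero hΦ0 (Finset.prod_ne_zero_iff.mpr fun i _ => hΨ0 i),
    fun π hπ g hg h hh h0 hgh hval => ?_⟩
  rw [map_mul, map_prod] at hπ
  have hπ1 := left_ne_zero_of_mul hπ
  have hπ2 := fun i => Finset.prod_ne_zero_iff.mp (right_ne_zero_of_mul hπ) i (Finset.mem_univ i)
  have hv : ∀ i ∈ I, l i ⟨g, hg⟩ = π i * l i ⟨h, hh⟩ := fun i hi =>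
    hl i ⟨g, hg⟩ ⟨h, hh⟩ (π i) h0 (hval i hi)
  have hsum : ∀ i (x : V), l i x = ∑ j, b.repr x j * l i (b j) := fun i x => by
    conv_lhs => rw [← b.sum_repr x]
    rw [map_sum]
    exact Finset.sum_congr rfl fun j _ => by rw [map_smul, smul_eq_mul]
  by_cases hz : ∃ i ∈ I, l i ⟨h, hh⟩ = 0
  · obtain ⟨i, hi, hi0⟩ := hz
    refine hΨ i π (hπ2 i) g ?_ h ?_ h0 hgh hval
    · exact ⟨⟨g, hg⟩, by rw [SetLike.mem_coe, LinearMap.mem_ker, hv i hi, hi0, mul_zero], rfl⟩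
    · exact ⟨⟨h, hh⟩, hi0, rfl⟩
  · push Not at hz
    refine hΦ π hπ1 (AlgHom.id ℂ ℂ) (b.repr ⟨g, hg⟩) (b.repr ⟨h, hh⟩) (fun i hi => ?_)
      fun i hi => ?_
    · have := hz i hi
      rwa [hsum] at this
    · have := hv i hi
      rwa [hsum, hsum i ⟨h, hh⟩] at this

end


/-! ### The function field of an elliptic curve -/

section

open WeierstrassCurve.Affine
open scoped Polynomial

variable (W : WeierstrassCurve.Affine ℂ)

theorem trdeg_coordinateRing : Algebra.trdeg ℂ W.CoordinateRing = 1 := by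
  have : Module.Finite ℂ[X] W.CoordinateRing :=
    Module.Finite.of_basis (CoordinateRing.basis W)
  rw [← trdeg_add_eq ℂ ℂ[X] (A := W.CoordinateRing), trdeg_eq_zero (R := ℂ[X]), add_zero,
    Polynomial.trdeg_of_isDomain]

theorem trdeg_functionField : Algebra.trdeg ℂ W.FunctionField ≤ 1 := by
  have : Algebra.IsAlgebraic W.CoordinateRing W.FunctionField :=
    IsLocalization.isAlgebraic _ (nonZeroDivisors W.CoordinateRing)
  rw [← trdeg_add_eq ℂ W.CoordinateRing (A := W.FunctionField), trdeg_coordinateRing,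
    trdeg_eq_zero (R := W.CoordinateRing), add_zero]

/-- The coordinate `x`. -/
def coordX : W.CoordinateRing := algebraMap ℂ[X] W.CoordinateRing Polynomial.X

/-- The coordinate `y`. -/
def coordY : W.CoordinateRing := CoordinateRing.mk W Polynomial.X

theorem coord_equation :
    coordY W ^ 2 + algebraMap ℂ _ W.a₁ * coordX W * coordY W + algebraMap ℂ _ W.a₃ * coordY W =
      coordX W ^ 3 + algebraMap ℂ _ W.a₂ * coordX W ^ 2 + algebraMap ℂ _ W.a₄ * coordX W +
        algebraMap ℂ _ W.a₆ := by
  let f : ℂ[X][X] →+* W.CoordinateRing := CoordinateRing.mk W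
  have hC : ∀ a : ℂ, f (Polynomial.C (Polynomial.C a)) = algebraMap ℂ _ a := fun a => rfl
  have hX : f (Polynomial.C Polynomial.X) = coordX W := rfl
  have hY : f Polynomial.X = coordY W := rfl
  have h : f (Polynomial.X ^ 2 + Polynomial.C (Polynomial.C W.a₁ * Polynomial.X +
      Polynomial.C W.a₃) * Polynomial.X - Polynomial.C (Polynomial.X ^ 3 +
      Polynomial.C W.a₂ * Polynomial.X ^ 2 + Polynomial.C W.a₄ * Polynomial.X +
      Polynomial.C W.a₆)) = 0 := AdjoinRoot.mk_self
  clear_value f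
  simp only [map_add, map_sub, map_mul, map_pow, hC, hX, hY] at h
  linear_combination h

variable {W}

theorem exists_coord_eq (r : W.CoordinateRing) : ∃ p q : ℂ[X],
    r = algebraMap _ _ p + algebraMap _ _ q * coordY W := by
  obtain ⟨p, q, rfl⟩ := CoordinateRing.exists_smul_basis_eq r
  exact ⟨p, q, by rw [Algebra.smul_def, Algebra.smul_def, mul_one]; rfl⟩

/-- Multiplying a monic equation of `z` by a power of `s` gives a monic equation of `w` whose lower
coefficients are divisible by `s`; under `φ` it reads `φ(w)^n = 0`. -/
theorem eval_eq_zero_of_isIntegral {z : W.FunctionField} (hz : IsIntegral W.CoordinateRing z)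
    {s w : W.CoordinateRing} (hw : algebraMap _ W.FunctionField s * z = algebraMap _ _ w)
    (φ : W.CoordinateRing →+* ℂ) (hs : φ s = 0) : φ w = 0 := by
  obtain ⟨p, hp, hpz⟩ := hz
  have h1 : Polynomial.aeval (algebraMap _ W.FunctionField s * z) (p.scaleRoots s) = 0 :=
    Polynomial.scaleRoots_aeval_eq_zero hpz
  rw [hw, Polynomial.aeval_algebraMap_apply,
    map_eq_zero_iff _ (IsFractionRing.injective _ _)] at h1
  have h2 := congrArg φ h1
  rw [map_zero, Polynomial.coe_aeval_eq_eval, ← Polynomial.eval_map_apply,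
    Polynomial.map_scaleRoots _ _ _ (by simp [hp.leadingCoeff]), hs, Polynomial.scaleRoots_zero,
    Polynomial.eval_smul] at h2
  rw [(hp.map φ).leadingCoeff, one_smul, Polynomial.eval_pow, Polynomial.eval_X] at h2
  exact eq_zero_of_pow_eq_zero h2

/-- Evaluation at a point of the curve. -/
theorem exists_evaluation {c y : ℂ} (h : W.Equation c y) :
    ∃ φ : W.CoordinateRing →+* ℂ, (∀ p : ℂ[X], φ (algebraMap _ _ p) = p.eval c) ∧
      φ (coordY W) = y := by
  refine ⟨AdjoinRoot.lift (Polynomial.evalRingHom c) y ?_, fun p => ?_, ?_⟩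
  · rw [Polynomial.eval₂_evalRingHom]
    exact h
  · exact AdjoinRoot.lift_of _
  · exact AdjoinRoot.lift_root _

/-- Normality along the fibre `x = c`. Modulo the coordinate ring, `z` becomes `(α + β y) / (x -
c)`, whose numerator must vanish at every point of the fibre. If `β ≠ 0`, the fibre is one
ramification point, and nonsingularity there makes `1 / (x - c)` integral, which evaluation at the
point refutes. -/
theorem exists_eq_algebraMap_of_isIntegral_of_sub_mul [W.IsElliptic] {z : W.FunctionField}
    (hz : IsIntegral W.CoordinateRing z) (c : ℂ) {w : W.CoordinateRing}
    (hw : algebraMap _ W.FunctionField (algebraMap ℂ[X] W.CoordinateRing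
      (Polynomial.X - Polynomial.C c)) * z = algebraMap _ _ w) :
    ∃ r : W.CoordinateRing, z = algebraMap _ _ r := by
  set ι := algebraMap W.CoordinateRing W.FunctionField with hι
  have hιinj : Function.Injective ι := IsFractionRing.injective _ _
  set t : W.CoordinateRing := algebraMap ℂ[X] W.CoordinateRing
    (Polynomial.X - Polynomial.C c) with ht
  have htc : t = coordX W - algebraMap ℂ _ c := by rw [ht, map_sub]; rfl
  have ht0 : ι t ≠ 0 := by
    rw [map_ne_zero_iff _ hιinj, ht, map_ne_zero_iff _ (FaithfulSMul.algebraMap_injective _ _)]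
    exact Polynomial.X_sub_C_ne_zero c
  obtain ⟨p, q, rfl⟩ := exists_coord_eq w
  obtain ⟨p₁, hp₁⟩ := Polynomial.X_sub_C_dvd_sub_C_eval (a := c) (p := p)
  obtain ⟨q₁, hq₁⟩ := Polynomial.X_sub_C_dvd_sub_C_eval (a := c) (p := q)
  set α := p.eval c
  set β := q.eval c
  set r : W.CoordinateRing := algebraMap _ _ p₁ + algebraMap _ _ q₁ * coordY W with hr
  have hz' : IsIntegral W.CoordinateRing (z - ι r) := hz.sub isIntegral_algebraMap
  have hw' : ι t * (z - ι r) = ι (algebraMap ℂ _ α + algebraMap ℂ _ β * coordY W) := by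
    rw [mul_sub, hw, ← map_mul, ← map_sub]
    congr 1
    have e1 : (algebraMap ℂ[X] W.CoordinateRing p) - algebraMap ℂ _ α = t * algebraMap _ _ p₁ := by
      rw [ht, ← map_mul, ← hp₁, map_sub]; rfl
    have e2 : (algebraMap ℂ[X] W.CoordinateRing q) - algebraMap ℂ _ β = t * algebraMap _ _ q₁ := by
      rw [ht, ← map_mul, ← hq₁, map_sub]; rfl
    rw [hr]
    linear_combination e1 + e2 * coordY W
  have hroot : ∀ y, W.Equation c y → α + β * y = 0 := by
    intro y hy
    obtain ⟨φ, hφ, hφy⟩ := exists_evaluation hy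
    have := eval_eq_zero_of_isIntegral hz' hw' φ (by rw [ht, hφ]; simp)
    have hφC : ∀ a : ℂ, φ (algebraMap ℂ _ a) = a := fun a => by
      have := hφ (Polynomial.C a)
      rwa [Polynomial.eval_C] at this
    rwa [map_add, map_mul, hφC, hφC, hφy] at this
  obtain ⟨y, hy⟩ : ∃ y, W.Equation c y := by
    obtain ⟨y, hy⟩ := IsAlgClosed.exists_root (Polynomial.C 1 * Polynomial.X ^ 2 +
      Polynomial.C (W.a₁ * c + W.a₃) * Polynomial.X +
      Polynomial.C (-(c ^ 3 + W.a₂ * c ^ 2 + W.a₄ * c + W.a₆)))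
      (by rw [Polynomial.degree_quadratic one_ne_zero]; decide)
    refine ⟨y, (W.equation_iff c y).mpr ?_⟩
    simp only [Polynomial.IsRoot, Polynomial.eval_add, Polynomial.eval_mul, Polynomial.eval_C,
      Polynomial.eval_pow, Polynomial.eval_X] at hy
    linear_combination hy
  have hy2 : W.Equation c (-y - (W.a₁ * c + W.a₃)) := by
    rw [W.equation_iff] at hy ⊢
    linear_combination hy
  have hβ : β = 0 := by
    by_contra hβ
    have h1 : 2 * y + W.a₁ * c + W.a₃ = 0 := by
      refine (mul_eq_zero.mp (?_ : β * _ = 0)).resolve_left hβ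
      linear_combination hroot y hy - hroot _ hy2
    have hns := ((W.nonsingular_iff' c y).mp (W.equation_iff_nonsingular.mp hy)).2
    have hB : W.a₁ * y - (3 * c ^ 2 + 2 * W.a₂ * c + W.a₄) ≠ 0 := hns.resolve_right (not_not.mpr h1)
    set u := algebraMap ℂ W.FunctionField β⁻¹ * (z - ι r) with hu
    have hCi : ∀ a : ℂ, ι (algebraMap ℂ _ a) = algebraMap ℂ _ a := fun a =>
      (IsScalarTower.algebraMap_apply ℂ W.CoordinateRing W.FunctionField a).symm
    have hcint : ∀ a : ℂ, IsIntegral W.CoordinateRing (algebraMap ℂ W.FunctionField a) :=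
      fun a => by rw [← hCi]; exact isIntegral_algebraMap
    have huint : IsIntegral W.CoordinateRing u := (hcint _).mul hz'
    have htu : ι t * u = ι (coordY W - algebraMap ℂ _ y) := by
      rw [hu, mul_left_comm, hw', ← hCi, ← map_mul]
      congr 1
      have hα : α = -(β * y) := by linear_combination hroot y hy
      rw [hα, mul_add, ← mul_assoc, ← map_mul, ← map_mul, inv_mul_cancel₀ hβ,
        show β⁻¹ * -(β * y) = -y by field_simp, map_neg, map_one]
      ring
    set B := 3 * c ^ 2 + 2 * W.a₂ * c + W.a₄ - W.a₁ * y with hBdef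
    have hB0 : B ≠ 0 := fun h => hB (by linear_combination -h)
    -- With `x = t + c` and `y` replaced by `t * u + y`, the Weierstrass equation loses its constant
    -- term and its term in `t * u`. Dividing by `t` twice leaves `B / t` as a polynomial in `u` and
    -- `t`, and `B ≠ 0` is nonsingularity.
    have hinv : (ι t)⁻¹ = algebraMap ℂ _ B⁻¹ * (u ^ 2 + algebraMap ℂ _ W.a₁ * u - ι t -
        algebraMap ℂ _ (3 * c + W.a₂)) := by
      have hs : ι (coordY W) = ι t * u + algebraMap ℂ _ y := by rw [htu, map_sub, hCi]; ring
      have hx : ι (coordX W) = ι t + algebraMap ℂ _ c := by rw [htc, map_sub, hCi]; ring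
      have heq := congrArg ι (coord_equation W)
      simp only [map_add, map_mul, map_pow, hCi, hs, hx] at heq
      have e1 := congrArg (algebraMap ℂ W.FunctionField) h1
      have e2 := congrArg (algebraMap ℂ W.FunctionField) ((W.equation_iff c y).mp hy)
      simp only [map_add, map_mul, map_pow, map_ofNat, map_zero] at e1 e2
      have hBm : algebraMap ℂ W.FunctionField B ≠ 0 := by simpa using hB0
      have hBe : algebraMap ℂ W.FunctionField B = 3 * algebraMap ℂ _ c ^ 2 +
          2 * algebraMap ℂ _ W.a₂ * algebraMap ℂ _ c + algebraMap ℂ _ W.a₄ -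
          algebraMap ℂ _ W.a₁ * algebraMap ℂ _ y := by
        simp only [hBdef, map_sub, map_add, map_mul, map_pow, map_ofNat]
      rw [map_inv₀, eq_inv_mul_iff_mul_eq₀ hBm, ← div_eq_mul_inv, div_eq_iff ht0, hBe,
        map_add, map_mul, map_ofNat]
      refine mul_left_cancel₀ ht0 ?_
      linear_combination -heq + e2 + ι t * u * e1
    have hint : IsIntegral W.CoordinateRing (ι t)⁻¹ := by
      rw [hinv]
      exact (hcint _).mul ((((huint.pow 2).add ((hcint _).mul huint)).sub
        isIntegral_algebraMap).sub (hcint _))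
    obtain ⟨φ, hφ, -⟩ := exists_evaluation hy
    have := eval_eq_zero_of_isIntegral hint (s := t) (w := 1)
      (by rw [map_one]; exact mul_inv_cancel₀ ht0) φ (by rw [ht, hφ]; simp)
    rw [map_one] at this
    exact one_ne_zero this
  have hα : α = 0 := by
    have := hroot y hy
    rwa [hβ, zero_mul, add_zero] at this
  rw [hα, hβ, map_zero, zero_mul, add_zero, map_zero, mul_eq_zero, sub_eq_zero] at hw'
  exact ⟨r, hw'.resolve_left ht0⟩

theorem exists_mul_eq_algebraMap {s : W.CoordinateRing} (hs : s ≠ 0) :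
    ∃ (s' : W.CoordinateRing) (p : ℂ[X]), p ≠ 0 ∧ s * s' = algebraMap _ _ p := by
  obtain ⟨p, q, rfl⟩ := CoordinateRing.exists_smul_basis_eq s
  have h := CoordinateRing.coe_norm_smul_basis (W' := W) p q
  rw [map_mul] at h
  have h1 : CoordinateRing.mk W (Polynomial.C p + Polynomial.C q * Polynomial.X) =
      p • 1 + q • CoordinateRing.mk W Polynomial.X := by
    rw [map_add, map_mul, CoordinateRing.smul, CoordinateRing.smul, mul_one]
  rw [h1] at h
  have : Module.Finite ℂ[X] W.CoordinateRing := Module.Finite.of_basis (CoordinateRing.basis W)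
  exact ⟨_, _, Algebra.norm_ne_zero_iff.mpr hs, h.symm⟩

/-- The norm makes the denominator a polynomial in `x`, whose linear factors are removed one at a
time. -/
theorem exists_eq_algebraMap_of_isIntegral [W.IsElliptic] {z : W.FunctionField}
    (hz : IsIntegral W.CoordinateRing z) :
    ∃ r : W.CoordinateRing, z = algebraMap _ _ r := by
  have key : ∀ (s : Multiset ℂ) (z : W.FunctionField), IsIntegral W.CoordinateRing z →
      (∃ w, algebraMap W.CoordinateRing W.FunctionField (algebraMap ℂ[X] W.CoordinateRing
        (s.map fun c => Polynomial.X - Polynomial.C c).prod) * z =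
          algebraMap W.CoordinateRing _ w) →
      ∃ r : W.CoordinateRing, z = algebraMap _ _ r := by
    intro s
    induction s using Multiset.induction_on with
    | empty => intro z _ ⟨w, hw⟩; exact ⟨w, by simpa using hw⟩
    | cons c s ih =>
      intro z hz ⟨w, hw⟩
      refine ih z hz ((exists_eq_algebraMap_of_isIntegral_of_sub_mul
        (IsIntegral.mul isIntegral_algebraMap hz) c (w := w) ?_))
      rw [← hw, Multiset.map_cons, Multiset.prod_cons, map_mul, map_mul, mul_assoc]
  obtain ⟨r, s, hs, rfl⟩ := IsFractionRing.div_surjective (A := W.CoordinateRing) z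
  obtain ⟨s', p, hp, hsp⟩ := exists_mul_eq_algebraMap (nonZeroDivisors.ne_zero hs)
  have hs0 : algebraMap _ W.FunctionField s ≠ 0 :=
    (map_ne_zero_iff _ (IsFractionRing.injective _ _)).mpr (nonZeroDivisors.ne_zero hs)
  have hc : p.leadingCoeff ≠ 0 := Polynomial.leadingCoeff_ne_zero.mpr hp
  have h1 := (IsAlgClosed.splits p).eq_prod_roots
  generalize p.leadingCoeff = a at hc h1
  refine key p.roots _ hz ⟨r * s' * algebraMap ℂ _ a⁻¹, ?_⟩
  set m := (p.roots.map fun c => Polynomial.X - Polynomial.C c).prod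
  have h2 : (algebraMap ℂ[X] W.CoordinateRing m) =
      s * s' * algebraMap ℂ _ a⁻¹ := by
    rw [hsp]
    have : algebraMap ℂ W.CoordinateRing a⁻¹ =
      algebraMap ℂ[X] _ (Polynomial.C a⁻¹) := rfl
    rw [this, ← map_mul]
    rw [h1]
    rw [mul_right_comm, ← Polynomial.C_mul, mul_inv_cancel₀ hc, Polynomial.C_1, one_mul]
  rw [h2]
  simp only [map_mul]
  field_simp

/-- A normal domain is the intersection of the valuation rings of its fraction field that contain
it. -/
theorem exists_eq_algebraMap_of_forall_valuationSubring [W.IsElliptic] {z : W.FunctionField}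
    (hz : ∀ A : ValuationSubring W.FunctionField,
      (∀ r : W.CoordinateRing, algebraMap _ _ r ∈ A) → z ∈ A) :
    ∃ r : W.CoordinateRing, z = algebraMap _ _ r := by
  let S : Subring W.FunctionField := (algebraMap W.CoordinateRing W.FunctionField).range
  have hS : IsIntegrallyClosedIn S W.FunctionField := by
    rw [Subring.isIntegrallyClosedIn_iff]
    intro w ⟨p, hp, hpw⟩
    have hl : p ∈ Polynomial.lifts
        (algebraMap W.CoordinateRing W.FunctionField).rangeRestrict :=
      (Polynomial.mem_lifts _).mpr (Polynomial.map_surjective _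
        (algebraMap W.CoordinateRing W.FunctionField).rangeRestrict_surjective p)
    obtain ⟨q, hq, -, hqm⟩ := Polynomial.lifts_and_natDegree_eq_and_monic hl hp
    obtain ⟨r, rfl⟩ := exists_eq_algebraMap_of_isIntegral (W := W) (z := w) ⟨q, hqm, by
      rw [← hq, Polynomial.eval₂_map] at hpw
      exact hpw⟩
    exact ⟨r, rfl⟩
  by_contra h
  have hzS : z ∉ S := fun ⟨r, hr⟩ => h ⟨r, hr.symm⟩
  obtain ⟨A, hA, hzA⟩ := Subring.exists_le_valuationSubring_of_isIntegrallyClosedIn hzS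
  exact hzA (hz A fun r => hA ⟨r, rfl⟩)

end


/-! ### Relations over `ℂ(f)` -/

section

open scoped Polynomial

variable {K : Type*} [Field K] [Algebra ℂ K]

theorem exists_algebraMap_eq_of_isIntegral {z : K} (hz : IsIntegral ℂ z) :
    ∃ c : ℂ, algebraMap ℂ K c = z := by
  obtain ⟨p, hp, hpz⟩ := hz
  have h : Polynomial.aeval z p = 0 := hpz
  rw [(IsAlgClosed.splits p).eq_prod_roots, hp.leadingCoeff, Polynomial.C_1, one_mul,
    map_multiset_prod, Multiset.prod_eq_zero_iff] at h
  simp only [Multiset.map_map, Multiset.mem_map, Function.comp_apply, map_sub,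
    Polynomial.aeval_X, Polynomial.aeval_C] at h
  obtain ⟨c, -, hc⟩ := h
  exact ⟨c, (sub_eq_zero.mp hc).symm⟩

/-- For constant `f` the degree is the dimension of `K` over ℂ: it is 0 by default if infinite, and
1 otherwise since ℂ is algebraically closed. -/
theorem algebraMap_ne_of_two_le_morphismDegree {f : K} (h : 2 ≤ morphismDegree f) (c : ℂ) :
    algebraMap ℂ K c ≠ f := by
  rintro rfl
  have hbot : IntermediateField.adjoin ℂ {algebraMap ℂ K c} = ⊥ :=
    IntermediateField.adjoin_simple_eq_bot_iff.mpr (IntermediateField.algebraMap_mem _ c)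
  unfold morphismDegree at h
  rw [hbot, IntermediateField.finrank_bot'] at h
  have : FiniteDimensional ℂ K := Module.finite_of_finrank_pos (by omega)
  have h1 : Module.finrank ℂ K ≤ 1 := finrank_le_one 1 fun z => by
    obtain ⟨a, ha⟩ := exists_algebraMap_eq_of_isIntegral (Algebra.IsIntegral.isIntegral (R := ℂ) z)
    exact ⟨a, by rw [← ha, Algebra.algebraMap_eq_smul_one]⟩
  omega

theorem morphismDegree_inv (f : K) : morphismDegree f⁻¹ = morphismDegree f := by
  have : IntermediateField.adjoin ℂ {f⁻¹} = IntermediateField.adjoin ℂ {f} := by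
    refine le_antisymm ?_ ?_ <;> rw [IntermediateField.adjoin_simple_le_iff]
    · exact inv_mem (IntermediateField.mem_adjoin_simple_self ℂ f)
    · simpa using inv_mem (IntermediateField.mem_adjoin_simple_self ℂ f⁻¹)
  unfold morphismDegree
  rw [this]

open IntermediateField.algebraAdjoinAdjoin in
-- Too many elements are dependent over ℂ(f), and denominators can be cleared to ℂ[f]. Taking `N` as
-- the largest degree that occurs keeps the vector of top coefficients nonzero.
theorem exists_relation_of_morphismDegree_lt {f : K} (h : 2 ≤ morphismDegree f) {m : ℕ}
    (hm : morphismDegree f < m) (b : Fin m → K) :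
    ∃ (p : Fin m → ℂ[X]) (N : ℕ), (∀ i, (p i).natDegree ≤ N) ∧ (∃ i, (p i).coeff N ≠ 0) ∧
      ∑ i, Polynomial.aeval f (p i) * b i = 0 := by
  classical
  have hfin : FiniteDimensional (IntermediateField.adjoin ℂ {f}) K :=
    Module.finite_of_finrank_pos (lt_of_lt_of_le two_pos h)
  have hdep : ¬ LinearIndependent (Algebra.adjoin ℂ {f}) b := by
    rw [LinearIndependent.iff_fractionRing (Algebra.adjoin ℂ {f})
      (IntermediateField.adjoin ℂ {f})]
    intro hli
    have := hli.fintype_card_le_finrank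
    rw [Fintype.card_fin] at this
    exact absurd this (not_le.mpr hm)
  rw [Fintype.linearIndependent_iff] at hdep
  push Not at hdep
  obtain ⟨c, hc, i₀, hi₀⟩ := hdep
  have hp : ∀ i, ∃ p : ℂ[X], Polynomial.aeval f p = (c i : K) := fun i => by
    have : (c i : K) ∈ (Polynomial.aeval f : ℂ[X] →ₐ[ℂ] K).range :=
      (Algebra.adjoin_singleton_eq_range_aeval ℂ f).le (c i).2
    exact this
  choose p hp using hp
  obtain ⟨i₁, hi₁, hmax⟩ := Finset.exists_max_image (Finset.univ.filter fun i => p i ≠ 0)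
    (fun i => (p i).natDegree) ⟨i₀, by
      simp only [Finset.mem_filter, Finset.mem_univ, true_and]
      intro h0
      refine hi₀ (Subtype.ext ?_)
      rw [← hp, h0, map_zero]; rfl⟩
  simp only [Finset.mem_filter, Finset.mem_univ, true_and] at hi₁ hmax
  refine ⟨p, (p i₁).natDegree, fun i => ?_, ⟨i₁, ?_⟩, ?_⟩
  · by_cases h0 : p i = 0
    · simp [h0]
    · exact hmax i h0
  · exact Polynomial.leadingCoeff_ne_zero.mpr hi₁
  · rw [← hc]
    exact Finset.sum_congr rfl fun i _ => by rw [hp]; rfl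

end

/-! ### Sections with a pole at infinity -/

section

open WeierstrassCurve.Affine
open scoped Polynomial

variable (W : WeierstrassCurve.Affine ℂ)

/-- The functions `p(x) + q(x) y` with a pole of order at most `m` at infinity. -/
def sectionsMap (m : ℕ) :
    (Polynomial.degreeLT ℂ (m / 2 + 1) × Polynomial.degreeLT ℂ ((m - 1) / 2)) →ₗ[ℂ]
      W.FunctionField :=
  (IsScalarTower.toAlgHom ℂ W.CoordinateRing W.FunctionField).toLinearMap ∘ₗ
    LinearMap.coprod
      ((IsScalarTower.toAlgHom ℂ ℂ[X] W.CoordinateRing).toLinearMap ∘ₗ Submodule.subtype _)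
      (LinearMap.mulRight ℂ (coordY W) ∘ₗ
        (IsScalarTower.toAlgHom ℂ ℂ[X] W.CoordinateRing).toLinearMap ∘ₗ Submodule.subtype _)

/-- The space of functions with a pole of order at most `m` at infinity. -/
def sections (m : ℕ) : Submodule ℂ W.FunctionField := LinearMap.range (sectionsMap W m)

variable {W}

theorem mem_sections {m : ℕ} {z : W.FunctionField} : z ∈ sections W m ↔
    ∃ p q : ℂ[X], p.degree < (m / 2 + 1 : ℕ) ∧ q.degree < ((m - 1) / 2 : ℕ) ∧
      z = algebraMap W.CoordinateRing _ (algebraMap _ _ p + algebraMap _ _ q * coordY W) := by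
  constructor
  · rintro ⟨⟨⟨p, hp⟩, ⟨q, hq⟩⟩, rfl⟩
    exact ⟨p, q, Polynomial.mem_degreeLT.mp hp, Polynomial.mem_degreeLT.mp hq, rfl⟩
  · rintro ⟨p, q, hp, hq, rfl⟩
    exact ⟨⟨⟨p, Polynomial.mem_degreeLT.mpr hp⟩, ⟨q, Polynomial.mem_degreeLT.mpr hq⟩⟩, rfl⟩

instance (m : ℕ) : FiniteDimensional ℂ (sections W m) :=
  LinearMap.finiteDimensional_range _

/-- The functions `x` and `y` have poles of order 2 and 3, so `2 deg p ≤ m` and `2 deg q + 3 ≤ m`.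
The numbers of free coefficients, `m / 2 + 1` and `(m - 1) / 2`, add up to `m` for `m ≥ 1`. -/
theorem finrank_sections {m : ℕ} (hm : 1 ≤ m) : Module.finrank ℂ (sections W m) = m := by
  have hinj : Function.Injective (sectionsMap W m) := by
    rw [← LinearMap.ker_eq_bot, LinearMap.ker_eq_bot']
    rintro ⟨⟨p, hp⟩, ⟨q, hq⟩⟩ h
    have h1 : algebraMap W.CoordinateRing W.FunctionField
        (algebraMap _ _ p + algebraMap _ _ q * coordY W) = 0 := h
    rw [map_eq_zero_iff _ (IsFractionRing.injective _ _)] at h1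
    obtain ⟨rfl, rfl⟩ := CoordinateRing.smul_basis_eq_zero (W' := W) (p := p) (q := q) (by
      rw [Algebra.smul_def, Algebra.smul_def, mul_one]; exact h1)
    rfl
  rw [sections, LinearMap.finrank_range_of_inj hinj, Module.finrank_prod,
    (Polynomial.degreeLTEquiv ℂ _).finrank_eq, (Polynomial.degreeLTEquiv ℂ _).finrank_eq,
    Module.finrank_fin_fun, Module.finrank_fin_fun]
  omega

/-- The degree of the norm is the larger of `2 deg p` and `2 deg q + 3`, that is, the pole order at
infinity. -/
theorem mem_sections_of_natDegree_norm_le {m : ℕ} (hm : 1 ≤ m) {r : W.CoordinateRing}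
    (hr : (Algebra.norm ℂ[X] r).natDegree ≤ m) :
    algebraMap _ W.FunctionField r ∈ sections W m := by
  obtain ⟨p, q, rfl⟩ := CoordinateRing.exists_smul_basis_eq r
  refine mem_sections.mpr ⟨p, q, ?_, ?_, by
    rw [Algebra.smul_def, Algebra.smul_def, mul_one]; rfl⟩
  all_goals
    have h := Polynomial.natDegree_le_iff_degree_le.mp hr
    rw [CoordinateRing.degree_norm_smul_basis, max_le_iff] at h
  · by_cases hp : p = 0
    · simp [hp]
    · rw [Polynomial.degree_eq_natDegree hp] at h ⊢
      have h1 : 2 * p.natDegree ≤ m := by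
        have := h.1
        rw [two_nsmul] at this
        have : p.natDegree + p.natDegree ≤ m := by exact_mod_cast this
        omega
      exact_mod_cast (by omega : p.natDegree < m / 2 + 1)
  · by_cases hq : q = 0
    · simp [hq]
    · rw [Polynomial.degree_eq_natDegree hq] at h ⊢
      have h1 : 2 * q.natDegree + 3 ≤ m := by
        have := h.2
        rw [two_nsmul] at this
        have : q.natDegree + q.natDegree + 3 ≤ m := by exact_mod_cast this
        omega
      exact_mod_cast (by omega : q.natDegree < (m - 1) / 2)

/-! ### The place at infinity -/

/-- At a pole of `x` the terms `y ^ 2` and `x ^ 3` dominate the two sides of the Weierstrass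
equation. -/
theorem valuation_coordY_sq {P : Place W.FunctionField}
    (hP : 1 < P.localRing.valuation (algebraMap _ _ (coordX W))) :
    P.localRing.valuation (algebraMap _ _ (coordY W)) ^ 2 =
      P.localRing.valuation (algebraMap _ _ (coordX W)) ^ 3 := by
  set v := P.localRing.valuation with hv
  set ι := algebraMap W.CoordinateRing W.FunctionField with hι
  set ξ := v (ι (coordX W)) with hξ
  set η := v (ι (coordY W)) with hη
  have hc : ∀ a : ℂ, v (ι (algebraMap ℂ _ a)) ≤ 1 := fun a => by
    rw [hι, ← IsScalarTower.algebraMap_apply]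
    exact (P.localRing.valuation_le_one_iff _).mpr (P.const_mem a)
  have heq := congrArg ι (coord_equation W)
  have hξ0 : 0 < ξ := one_pos.trans hP
  have h12 : ξ ^ 1 < ξ ^ 2 := pow_lt_pow_right₀ hP (by norm_num)
  have h23 : ξ ^ 2 < ξ ^ 3 := pow_lt_pow_right₀ hP (by norm_num)
  have h13 : (1 : _) < ξ ^ 3 := one_lt_pow₀ hP (by norm_num)
  rw [pow_one] at h12
  have hR : v (ι (coordX W ^ 3 + algebraMap ℂ _ W.a₂ * coordX W ^ 2 + algebraMap ℂ _ W.a₄ *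
      coordX W + algebraMap ℂ _ W.a₆)) = ξ ^ 3 := by
    have e3 : v (ι (coordX W ^ 3)) = ξ ^ 3 := by rw [map_pow, map_pow]
    have e2 : v (ι (algebraMap ℂ _ W.a₂ * coordX W ^ 2)) < ξ ^ 3 := by
      rw [map_mul, map_mul, map_pow, map_pow]
      exact (mul_le_of_le_one_left zero_le (hc _)).trans_lt h23
    have e1 : v (ι (algebraMap ℂ _ W.a₄ * coordX W)) < ξ ^ 3 := by
      rw [map_mul, map_mul]
      exact (mul_le_of_le_one_left zero_le (hc _)).trans_lt (h12.trans h23)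
    have e0 : v (ι (algebraMap ℂ _ W.a₆)) < ξ ^ 3 := (hc _).trans_lt h13
    rw [add_assoc, add_assoc, map_add ι, v.map_add_eq_of_lt_left, e3]
    rw [e3, map_add ι, map_add ι]
    exact v.map_add_lt e2 (v.map_add_lt e1 e0)
  rw [← heq] at hR
  have hη : ξ < η := by
    by_contra! hle
    have : v (ι (coordY W ^ 2 + algebraMap ℂ _ W.a₁ * coordX W * coordY W +
        algebraMap ℂ _ W.a₃ * coordY W)) ≤ ξ ^ 2 := by
      rw [map_add ι, map_add ι]
      refine v.map_add_le (v.map_add_le ?_ ?_) ?_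
      · rw [map_pow, map_pow]; exact pow_le_pow_left₀ zero_le hle 2
      · rw [map_mul, map_mul, map_mul, map_mul, mul_assoc, sq]
        exact (mul_le_of_le_one_left zero_le (hc _)).trans (mul_le_mul_right hle _)
      · rw [map_mul, map_mul]
        exact (mul_le_of_le_one_left zero_le (hc _)).trans (hle.trans h12.le)
    rw [hR] at this
    exact absurd h23 (not_lt.mpr this)
  have hη0 : 0 < η := hξ0.trans hη
  rw [← hR, add_assoc, map_add ι, v.map_add_eq_of_lt_left, map_pow, map_pow]
  rw [map_add ι, map_pow, map_pow]
  refine v.map_add_lt ?_ ?_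
  · rw [map_mul, map_mul, map_mul, map_mul, mul_assoc, sq]
    exact (mul_le_of_le_one_left zero_le (hc _)).trans_lt (mul_lt_mul_of_pos_right hη hη0)
  · rw [map_mul, map_mul, sq]
    refine (mul_le_of_le_one_left zero_le (hc _)).trans_lt ?_
    exact lt_mul_of_one_lt_left hη0 (hP.trans hη)

theorem valuation_algebraMap_polynomial {P : Place W.FunctionField}
    (hP : 1 < P.localRing.valuation (algebraMap _ _ (coordX W))) {p : ℂ[X]} (hp : p ≠ 0) :
    P.localRing.valuation (algebraMap W.CoordinateRing _ (algebraMap _ _ p)) =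
      P.localRing.valuation (algebraMap _ _ (coordX W)) ^ p.natDegree := by
  have : P.localRing.valuation.IsTrivialOn ℂ := ⟨fun c hc => P.valuation_algebraMap hc⟩
  rw [← Polynomial.valuation_aeval_eq_valuation_X_pow_natDegree_of_one_lt_valuation_X _ hP hp,
    Polynomial.aeval_algebraMap_apply, coordX, Polynomial.aeval_algebraMap_apply,
    Polynomial.aeval_X_left_apply]

/-- The squared valuations of `p(x)` and `q(x) y` are powers of that of `x` with even and odd
exponent, so the two terms cannot cancel. Squaring avoids half-integral exponents. -/
theorem mem_sections_iff_valuation_sq_le {P : Place W.FunctionField}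
    (hP : 1 < P.localRing.valuation (algebraMap _ _ (coordX W))) {m : ℕ} (hm : 1 ≤ m)
    (r : W.CoordinateRing) : algebraMap _ W.FunctionField r ∈ sections W m ↔
      P.localRing.valuation (algebraMap _ _ r) ^ 2 ≤
        P.localRing.valuation (algebraMap _ _ (coordX W)) ^ m := by
  have hpv : ∀ p : ℂ[X], p ≠ 0 → _ := fun p hp => valuation_algebraMap_polynomial hP hp
  have hy := valuation_coordY_sq hP
  set v := P.localRing.valuation with hv
  set ι := algebraMap W.CoordinateRing W.FunctionField with hι
  set ξ := v (ι (coordX W)) with hξ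
  have hξ0 : 0 < ξ := one_pos.trans hP
  have hp2 : ∀ p : ℂ[X], p ≠ 0 → v (ι (algebraMap _ _ p)) ^ 2 = ξ ^ (2 * p.natDegree) :=
    fun p hp => by rw [hpv p hp, ← pow_mul, mul_comm]
  have hq2 : ∀ q : ℂ[X], q ≠ 0 →
      v (ι (algebraMap _ _ q * coordY W)) ^ 2 = ξ ^ (2 * q.natDegree + 3) := fun q hq => by
    rw [map_mul, map_mul, mul_pow, hp2 q hq, hy, pow_add]
  constructor
  · intro hr
    obtain ⟨p, q, hp, hq, hrpq⟩ := mem_sections.mp hr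
    have h1 : v (ι (algebraMap _ _ p)) ^ 2 ≤ ξ ^ m := by
      by_cases h0 : p = 0
      · simp [h0]
      · rw [hp2 p h0]
        rw [Polynomial.degree_eq_natDegree h0] at hp
        have : p.natDegree < m / 2 + 1 := by exact_mod_cast hp
        exact pow_le_pow_right₀ hP.le (by omega)
    have h2 : v (ι (algebraMap _ _ q * coordY W)) ^ 2 ≤ ξ ^ m := by
      by_cases h0 : q = 0
      · simp [h0]
      · rw [hq2 q h0]
        rw [Polynomial.degree_eq_natDegree h0] at hq
        have : q.natDegree < (m - 1) / 2 := by exact_mod_cast hq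
        exact pow_le_pow_right₀ hP.le (by omega)
    rw [hrpq, map_add ι]
    rcases le_max_iff.mp (v.map_add (ι (algebraMap _ _ p)) (ι (algebraMap _ _ q * coordY W)))
      with h | h
    · exact (pow_le_pow_left₀ zero_le h 2).trans h1
    · exact (pow_le_pow_left₀ zero_le h 2).trans h2
  · intro hr
    obtain ⟨p, q, rfl⟩ := exists_coord_eq r
    have hmax : v (ι (algebraMap _ _ p + algebraMap _ _ q * coordY W)) =
        max (v (ι (algebraMap _ _ p))) (v (ι (algebraMap _ _ q * coordY W))) := by
      by_cases hp0 : p = 0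
      · simp [hp0]
      by_cases hq0 : q = 0
      · simp [hq0]
      rw [map_add ι]
      refine v.map_add_of_distinct_val fun h => ?_
      have h2 := hq2 q hq0
      rw [← h, hp2 p hp0] at h2
      have := pow_right_injective₀ hξ0 hP.ne' h2
      omega
    rw [hmax] at hr
    refine mem_sections.mpr ⟨p, q, ?_, ?_, rfl⟩
    · by_cases hp0 : p = 0
      · simp [hp0]
      · have := (pow_le_pow_left₀ zero_le (le_max_left _ _) 2).trans hr
        rw [hp2 p hp0, pow_le_pow_iff_right₀ hP] at this
        rw [Polynomial.degree_eq_natDegree hp0]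
        exact_mod_cast (by omega : p.natDegree < m / 2 + 1)
    · by_cases hq0 : q = 0
      · simp [hq0]
      · have := (pow_le_pow_left₀ zero_le (le_max_right _ _) 2).trans hr
        rw [hq2 q hq0, pow_le_pow_iff_right₀ hP] at this
        rw [Polynomial.degree_eq_natDegree hq0]
        exact_mod_cast (by omega : q.natDegree < (m - 1) / 2)

-- The field ℂ is integrally closed in the function field and does not contain `x`, so some
-- valuation ring contains ℂ but not `x`.
variable (W) in
theorem exists_place_infinity :
    ∃ P : Place W.FunctionField, 1 < P.localRing.valuation (algebraMap _ _ (coordX W)) := by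
  let S : Subring W.FunctionField := (algebraMap ℂ W.FunctionField).range
  have hS : IsIntegrallyClosedIn S W.FunctionField := by
    rw [Subring.isIntegrallyClosedIn_iff]
    intro w ⟨p, hp, hpw⟩
    have hl : p ∈ Polynomial.lifts (algebraMap ℂ W.FunctionField).rangeRestrict :=
      (Polynomial.mem_lifts _).mpr (Polynomial.map_surjective _
        (algebraMap ℂ W.FunctionField).rangeRestrict_surjective p)
    obtain ⟨q, hq, -, hqm⟩ := Polynomial.lifts_and_natDegree_eq_and_monic hl hp
    obtain ⟨c, rfl⟩ := exists_algebraMap_eq_of_isIntegral (z := w) ⟨q, hqm, by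
      rw [← hq, Polynomial.eval₂_map] at hpw
      exact hpw⟩
    exact ⟨c, rfl⟩
  have hx : algebraMap _ _ (coordX W) ∉ S := by
    rintro ⟨c, hc⟩
    rw [IsScalarTower.algebraMap_apply ℂ W.CoordinateRing W.FunctionField] at hc
    have h1 : algebraMap ℂ[X] W.CoordinateRing (Polynomial.C c) = algebraMap _ _ Polynomial.X :=
      IsFractionRing.injective W.CoordinateRing W.FunctionField hc
    have h2 := FaithfulSMul.algebraMap_injective ℂ[X] W.CoordinateRing h1
    exact Polynomial.X_ne_C c h2.symm
  obtain ⟨A, hA, hxA⟩ := Subring.exists_le_valuationSubring_of_isIntegrallyClosedIn hx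
  refine ⟨⟨A, fun c => hA ⟨c, rfl⟩, fun h => hxA (h ▸ trivial)⟩, ?_⟩
  rw [← not_le, ValuationSubring.valuation_le_one_iff]
  exact hxA

end


/-! ### Morphisms as quotients of sections -/

/-- Where `f` has a pole, dividing the relation by `f ^ (N - 1)` expresses `f * H N` through the
lower `H j` with nonpositive powers of `f`; elsewhere the bound is immediate. -/
theorem valuation_mul_le_of_sum_eq_zero {K Γ : Type*} [Field K]
    [LinearOrderedCommGroupWithZero Γ] (v : Valuation K Γ) {f : K} {N : ℕ} {H : ℕ → K}
    (h : ∑ j ∈ Finset.range (N + 1), f ^ j * H j = 0) {γ : Γ} (hγ : ∀ j ≤ N, v (H j) ≤ γ) :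
    v (f * H N) ≤ γ := by
  rw [map_mul]
  rcases le_or_gt (v f) 1 with hf | hf
  · exact (mul_le_of_le_one_left zero_le hf).trans (hγ N le_rfl)
  · rcases N with _ | N
    · rw [Finset.sum_range_one, pow_zero, one_mul] at h
      simp [h]
    · rw [Finset.sum_range_succ, add_comm, add_eq_zero_iff_eq_neg] at h
      have hf0 : 0 < v f := one_pos.trans hf
      have h1 : v (f ^ (N + 1) * H (N + 1)) ≤ v f ^ N * γ := by
        rw [h, Valuation.map_neg]
        refine v.map_sum_le fun j hj => ?_
        rw [map_mul, map_pow]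
        rw [Finset.mem_range] at hj
        exact mul_le_mul' (pow_le_pow_right₀ hf.le (by omega)) (hγ j (by omega))
      rw [map_mul, map_pow, pow_succ, mul_assoc] at h1
      exact (mul_le_mul_iff_right₀ (pow_pos hf0 N)).mp h1

section

open WeierstrassCurve.Affine
open scoped Polynomial

variable {W : WeierstrassCurve.Affine ℂ}

theorem exists_eq_algebraMap_of_mem_sections {m : ℕ} {z : W.FunctionField}
    (hz : z ∈ sections W m) : ∃ r : W.CoordinateRing, z = algebraMap _ _ r := by
  obtain ⟨p, q, -, -, rfl⟩ := mem_sections.mp hz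
  exact ⟨_, rfl⟩

/-- Functions which are dominated by sections at all places are sections. -/
theorem mem_sections_of_forall_valuation_le [W.IsElliptic] {m : ℕ} (hm : 1 ≤ m)
    {z : W.FunctionField} (hz : ∀ P : Place W.FunctionField, ∃ s ∈ sections W m,
      P.localRing.valuation z ≤ P.localRing.valuation s) : z ∈ sections W m := by
  obtain ⟨r, rfl⟩ := exists_eq_algebraMap_of_forall_valuationSubring (W := W) (z := z)
    fun A hA => by
      by_cases hA0 : A = ⊤
      · rw [hA0]; trivial
      obtain ⟨s, hs, hle⟩ := hz ⟨A, fun c => by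
        rw [IsScalarTower.algebraMap_apply ℂ W.CoordinateRing W.FunctionField]
        exact hA _, hA0⟩
      obtain ⟨r, rfl⟩ := exists_eq_algebraMap_of_mem_sections hs
      exact (A.valuation_le_one_iff _).mp (hle.trans ((A.valuation_le_one_iff _).mpr (hA r)))
  obtain ⟨P, hP⟩ := exists_place_infinity W
  obtain ⟨s, hs, hle⟩ := hz P
  obtain ⟨t, rfl⟩ := exists_eq_algebraMap_of_mem_sections hs
  rw [mem_sections_iff_valuation_sq_le hP hm] at hs ⊢
  exact (pow_le_pow_left₀ zero_le hle 2).trans hs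

/-- The `d + 1` basis sections are dependent over ℂ(f). Written by powers of `f`, the relation has a
nonzero leading coefficient `H N`, which is a section, and `f * H N` is dominated at every place by
one of the coefficients, hence a section too. -/
theorem exists_sections_eq_div [W.IsElliptic] {f : W.FunctionField} (hf : 2 ≤ morphismDegree f) :
    ∃ g h : W.CoordinateRing, algebraMap _ W.FunctionField g ∈ sections W (morphismDegree f + 1) ∧
      algebraMap _ W.FunctionField h ∈ sections W (morphismDegree f + 1) ∧ h ≠ 0 ∧
      f * algebraMap _ _ h = algebraMap _ _ g := by
  set d := morphismDegree f with hd
  let b := Module.finBasisOfFinrankEq ℂ (sections W (d + 1)) (finrank_sections (by omega))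
  obtain ⟨p, N, hpN, ⟨i₀, hi₀⟩, hsum⟩ :=
    exists_relation_of_morphismDegree_lt hf (Nat.lt_succ_self d) fun i => (b i : W.FunctionField)
  let H : ℕ → sections W (d + 1) := fun j => ∑ i, (p i).coeff j • b i
  have hH0 : H N ≠ 0 := fun h0 => hi₀ (Fintype.linearIndependent_iff.mp b.linearIndependent _ h0 i₀)
  have hrel : ∑ j ∈ Finset.range (N + 1), f ^ j * (H j : W.FunctionField) = 0 := by
    rw [← hsum]
    simp only [H, AddSubmonoidClass.coe_finsetSum, Finset.mul_sum]
    rw [Finset.sum_comm]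
    refine Finset.sum_congr rfl fun i _ => ?_
    rw [Polynomial.aeval_eq_sum_range' (Nat.lt_succ_of_le (hpN i)), Finset.sum_mul]
    refine Finset.sum_congr rfl fun j _ => ?_
    rw [Submodule.coe_smul, smul_mul_assoc, mul_smul_comm]
  have hmem : f * (H N : W.FunctionField) ∈ sections W (d + 1) := by
    refine mem_sections_of_forall_valuation_le (by omega) fun P => ?_
    obtain ⟨j₀, hj₀, hmax⟩ := Finset.exists_max_image (Finset.range (N + 1))
      (fun j => P.localRing.valuation (H j : W.FunctionField)) ⟨0, by simp⟩
    exact ⟨H j₀, (H j₀).2, valuation_mul_le_of_sum_eq_zero _ hrel fun j hj =>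
      hmax j (Finset.mem_range.mpr (by omega))⟩
  obtain ⟨g, hg⟩ := exists_eq_algebraMap_of_mem_sections hmem
  obtain ⟨h, hh⟩ := exists_eq_algebraMap_of_mem_sections (H N).2
  refine ⟨g, h, hg ▸ hmem, hh ▸ (H N).2, ?_, by rw [← hh, hg]⟩
  rintro rfl
  rw [map_zero] at hh
  exact hH0 (Subtype.ext hh)

/-- The degree of the norm is the dimension of the coordinate ring modulo `h`. If it exceeded `deg
f`, lifts of a basis would satisfy a relation over ℂ[f]; homogenized in `g` and `h` and reduced
modulo `h`, only the terms with `g ^ N` survive. Since `g` is a unit modulo `h`, this is a linear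
relation over ℂ between basis elements. -/
theorem natDegree_norm_le_of_span_eq_top {f : W.FunctionField} (hf : 2 ≤ morphismDegree f)
    {g h : W.CoordinateRing} (hh : h ≠ 0) (hfgh : f * algebraMap _ _ h = algebraMap _ _ g)
    (hspan : Ideal.span {g, h} = ⊤) :
    (Algebra.norm ℂ[X] h).natDegree ≤ morphismDegree f := by
  classical
  by_contra! hlt
  rw [← finrank_quotient_span_eq_natDegree_norm (CoordinateRing.basis W) hh] at hlt
  have hfd : FiniteDimensional ℂ (W.CoordinateRing ⧸ Ideal.span {h}) :=
    Module.finite_of_finrank_pos (by omega)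
  let b := Module.finBasis ℂ (W.CoordinateRing ⧸ Ideal.span {h})
  choose c hc using fun i => Ideal.Quotient.mk_surjective (b i)
  obtain ⟨p, N, hpN, ⟨i₀, hi₀⟩, hsum⟩ :=
    exists_relation_of_morphismDegree_lt hf hlt fun i => algebraMap _ W.FunctionField (c i)
  set q : W.CoordinateRing →+* W.CoordinateRing ⧸ Ideal.span {h} := Ideal.Quotient.mk _ with hq
  have hqh : q h = 0 := Ideal.Quotient.eq_zero_iff_mem.mpr (Ideal.mem_span_singleton_self h)
  let G : Fin _ → W.CoordinateRing := fun i =>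
    ∑ j ∈ Finset.range (N + 1), algebraMap ℂ _ ((p i).coeff j) * (g ^ j * h ^ (N - j))
  have hG : ∀ i, algebraMap _ W.FunctionField (G i) =
      Polynomial.aeval f (p i) * algebraMap _ _ h ^ N := fun i => by
    rw [Polynomial.aeval_eq_sum_range' (Nat.lt_succ_of_le (hpN i)), Finset.sum_mul, map_sum]
    refine Finset.sum_congr rfl fun j hj => ?_
    have hj : j ≤ N := by rw [Finset.mem_range] at hj; omega
    rw [map_mul, map_mul, map_pow, map_pow, ← hfgh, mul_pow, Algebra.smul_def,
      ← IsScalarTower.algebraMap_apply, ← Nat.add_sub_cancel' hj, pow_add, Nat.add_sub_cancel_left]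
    ring
  have hGsum : ∑ i, G i * c i = 0 := by
    refine IsFractionRing.injective W.CoordinateRing W.FunctionField ?_
    rw [map_sum, map_zero, ← zero_mul (algebraMap _ W.FunctionField h ^ N), ← hsum,
      Finset.sum_mul]
    exact Finset.sum_congr rfl fun i _ => by rw [map_mul, hG]; ring
  have hqG : ∀ i, q (G i) = algebraMap ℂ _ ((p i).coeff N) * q g ^ N := fun i => by
    simp only [G]
    rw [map_sum, Finset.sum_range_succ, Finset.sum_eq_zero, zero_add]
    · rw [map_mul, map_mul, map_pow, Nat.sub_self, pow_zero, map_one, mul_one]; rfl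
    · intro j hj
      rw [Finset.mem_range] at hj
      rw [map_mul, map_mul, map_pow q h, hqh, zero_pow (by omega), mul_zero, mul_zero]
  obtain ⟨u, v, huv⟩ := Ideal.mem_span_pair.mp (hspan ▸ Submodule.mem_top : (1 : W.CoordinateRing) ∈
    Ideal.span {g, h})
  have hu : q u * q g = 1 := by
    have := congrArg q huv
    rwa [map_add, map_mul, map_mul, hqh, mul_zero, add_zero, map_one] at this
  have hlin : ∑ i, (p i).coeff N • b i = 0 := by
    have h1 := congrArg (fun x => q u ^ N * q x) hGsum
    simp only [map_zero, mul_zero, map_sum, map_mul, hqG, hc] at h1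
    rw [← h1, Finset.mul_sum]
    refine Finset.sum_congr rfl fun i _ => ?_
    rw [Algebra.smul_def]
    calc _ = (q u * q g) ^ N * (algebraMap ℂ _ ((p i).coeff N) * b i) := by
            rw [hu, one_pow, one_mul]
      _ = _ := by ring
  exact hi₀ (Fintype.linearIndependent_iff.mp b.linearIndependent _ hlin i₀)

theorem exists_algHom_of_span_ne_top {g h : W.CoordinateRing} (hspan : Ideal.span {g, h} ≠ ⊤) :
    ∃ φ : W.CoordinateRing →ₐ[ℂ] ℂ, φ g = 0 ∧ φ h = 0 := by
  obtain ⟨M, hM, hle⟩ := Ideal.exists_le_maximal _ hspan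
  let _ : Field (W.CoordinateRing ⧸ M) := Ideal.Quotient.field M
  have : Module.Finite ℂ[X] W.CoordinateRing := Module.Finite.of_basis (CoordinateRing.basis W)
  have : Algebra.FiniteType ℂ W.CoordinateRing :=
    Algebra.FiniteType.trans (S := ℂ[X]) inferInstance inferInstance
  have : Algebra.FiniteType ℂ (W.CoordinateRing ⧸ M) :=
    Algebra.FiniteType.of_surjective (Ideal.Quotient.mkₐ ℂ M) (Ideal.Quotient.mkₐ_surjective ℂ M)
  have : Module.Finite ℂ (W.CoordinateRing ⧸ M) := finite_of_finite_type_of_isJacobsonRing _ _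
  let ψ : (W.CoordinateRing ⧸ M) →ₐ[ℂ] ℂ := IsAlgClosed.lift
  have hψ : ∀ x ∈ M, ψ.comp (Ideal.Quotient.mkₐ ℂ M) x = 0 := fun x hx => by
    rw [AlgHom.comp_apply, Ideal.Quotient.mkₐ_eq_mk, Ideal.Quotient.eq_zero_iff_mem.mpr hx,
      map_zero]
  exact ⟨_, hψ g (hle (Ideal.subset_span (by simp))), hψ h (hle (Ideal.subset_span (by simp)))⟩

/-- Either `g` and `h` have a common zero in the affine part of the curve, or their poles at
infinity have order at most the degree of `g / h`. -/
theorem exists_common_zero_or_mem_sections {f : W.FunctionField} (hf : 2 ≤ morphismDegree f)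
    {g h : W.CoordinateRing} (hh : h ≠ 0) (hfgh : f * algebraMap _ _ h = algebraMap _ _ g) :
    (∃ φ : W.CoordinateRing →ₐ[ℂ] ℂ, φ g = 0 ∧ φ h = 0) ∨
      (algebraMap _ W.FunctionField g ∈ sections W (morphismDegree f) ∧
        algebraMap _ W.FunctionField h ∈ sections W (morphismDegree f)) := by
  by_cases hspan : Ideal.span {g, h} = ⊤
  · have hf0 : f ≠ 0 := fun h0 =>
      algebraMap_ne_of_two_le_morphismDegree hf 0 (by rw [map_zero, h0])
    have hh0 : algebraMap _ W.FunctionField h ≠ 0 :=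
      (map_ne_zero_iff _ (IsFractionRing.injective _ _)).mpr hh
    have hg : g ≠ 0 := by
      rintro rfl
      rw [map_zero] at hfgh
      exact mul_ne_zero hf0 hh0 hfgh
    refine .inr ⟨mem_sections_of_natDegree_norm_le (by omega) ?_,
      mem_sections_of_natDegree_norm_le (by omega)
        (natDegree_norm_le_of_span_eq_top hf hh hfgh hspan)⟩
    -- The bound for `g` is the bound for the denominator of `1 / f`.
    rw [← morphismDegree_inv] at hf ⊢
    refine natDegree_norm_le_of_span_eq_top hf hg (g := h) ?_ (by rwa [Set.pair_comm])
    rw [← hfgh, inv_mul_cancel_left₀ hf0]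
  · exact .inl (exists_algHom_of_span_ne_top hspan)

end


/-! ### Morphisms in a fixed linear equivalence class -/

section

variable {K : Type*} [Field K] [Algebra ℂ K]

/-- Here `τ` is the valuation of a uniformizer. It serves all `g` at once because uniformizers are
associated, and it is nonzero because otherwise the local ring would be a field and hence all of
`K`. -/
theorem Place.HasOrder.exists_valuation_eq {P : Place K} {f : K} {m : ℤ} (hf : P.HasOrder f m) :
    ∃ τ : P.localRing.ValueGroup, 0 < τ ∧ τ ≤ 1 ∧
      ∀ (g : K) (n : ℤ), P.HasOrder g n → P.localRing.valuation g = τ ^ n := by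
  obtain ⟨t, -, ht, -⟩ := hf
  refine ⟨P.localRing.valuation t, ?_, (P.localRing.valuation_le_one_iff _).mpr t.2, ?_⟩
  · rw [zero_lt_iff, Ne, map_eq_zero]
    intro h0
    have ht0 : t = 0 := Subtype.ext h0
    rw [ht0, Ideal.span_singleton_zero] at ht
    refine P.ne_top (eq_top_iff.mpr fun z _ => ?_)
    rcases P.localRing.mem_or_inv_mem z with h | h
    · exact h
    · by_cases hz : z = 0
      · rw [hz]; exact zero_mem _
      have hu : IsUnit (⟨z⁻¹, h⟩ : P.localRing) := by
        by_contra hu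
        have := (IsLocalRing.mem_maximalIdeal _).mpr hu
        rw [ht, Ideal.mem_bot] at this
        exact inv_ne_zero hz (congrArg Subtype.val this)
      rw [P.localRing.valuation_eq_one_iff] at hu
      rw [← P.localRing.valuation_le_one_iff, ← inv_inv z, map_inv₀]
      have hu' : P.localRing.valuation z⁻¹ = 1 := hu
      rw [hu', inv_one]
  · rintro g n ⟨t', u, ht', rfl⟩
    have hassoc : Associated t' t := by
      rw [← Ideal.span_singleton_eq_span_singleton, ← ht, ht']
    obtain ⟨w, hw⟩ := hassoc
    have hv : ∀ x : P.localRingˣ, P.localRing.valuation ((x : P.localRing) : K) = 1 := fun x =>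
      (P.localRing.valuation_eq_one_iff _).mp x.isUnit
    rw [map_mul, hv, one_mul, map_zpow₀, ← hw]
    congr 1
    rw [MulMemClass.coe_mul, map_mul, hv, mul_one]

/-- The quotient `g₀ / g` has divisor (poles of `f`) minus (poles of `f₀`). Multiplication by it
therefore moves both 1 and `f` into the linear system of the polar divisor of `f₀`. -/
theorem PullbackIso.exists_mul_valuation_le {f f₀ : K} {D : Place K →₀ ℤ} (hf : PullbackIso f D)
    (hf₀ : PullbackIso f₀ D) : ∃ h : K, h ≠ 0 ∧ ∀ P : Place K,
      P.localRing.valuation h ≤ max 1 (P.localRing.valuation f₀) ∧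
      P.localRing.valuation (f * h) ≤ max 1 (P.localRing.valuation f₀) := by
  obtain ⟨g, hg, hfg⟩ := hf
  obtain ⟨g₀, hg₀, hfg₀⟩ := hf₀
  refine ⟨g₀ / g, div_ne_zero hg₀ hg, fun P => ?_⟩
  obtain ⟨m, hm, hmg⟩ := hfg P
  obtain ⟨m₀, hm₀, hmg₀⟩ := hfg₀ P
  obtain ⟨τ, hτ0, hτ1, hτ⟩ := hm.exists_valuation_eq
  have hle : ∀ a b : ℤ, a ≤ b → τ ^ b ≤ τ ^ a := fun a b hab =>
    zpow_le_zpow_right_of_le_one₀ hτ0 hτ1 hab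
  have hmax : τ ^ (-max (-m₀) 0) ≤ max 1 (P.localRing.valuation f₀) := by
    rw [hτ _ _ hm₀]
    rcases max_cases (-m₀) 0 with ⟨h, -⟩ | ⟨h, -⟩
    · rw [h, neg_neg]; exact le_max_right _ _
    · rw [h, neg_zero, zpow_zero]; exact le_max_left _ _
  have hh : P.localRing.valuation (g₀ / g) = τ ^ (max (-m) 0 - max (-m₀) 0) := by
    rw [map_div₀, hτ _ _ hmg, hτ _ _ hmg₀, ← zpow_sub₀ hτ0.ne']
    congr 1
    ring
  refine ⟨?_, ?_⟩
  · rw [hh]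
    exact (hle _ _ (by have := le_max_right (-m) 0; omega)).trans hmax
  · rw [map_mul, hh, hτ _ _ hm, ← zpow_add₀ hτ0.ne']
    exact (hle _ _ (by have := le_max_left (-m) 0; omega)).trans hmax

end

section

open WeierstrassCurve.Affine
open scoped Polynomial

variable {W : WeierstrassCurve.Affine ℂ}

/-- A valuation ring containing the coordinate ring and having the kernel of `φ` among its nonunits;
it is proper because it contains a nonzero nonunit. -/
theorem exists_place_of_algHom (φ : W.CoordinateRing →ₐ[ℂ] ℂ) :
    ∃ P : Place W.FunctionField, ∀ r : W.CoordinateRing, φ r = 0 →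
      P.localRing.valuation (algebraMap _ _ r) < 1 := by
  let ι := algebraMap W.CoordinateRing W.FunctionField
  have hι : Function.Injective ι := IsFractionRing.injective _ _
  let e : W.CoordinateRing ≃+* ι.range := RingEquiv.ofBijective ι.rangeRestrict
    ⟨fun a b h => hι (congrArg Subtype.val h), ι.rangeRestrict_surjective⟩
  let I : Ideal ι.range := RingHom.ker ((φ : W.CoordinateRing →+* ℂ).comp e.symm.toRingHom)
  obtain ⟨A, hA, hAI⟩ := Ideal.image_subset_nonunits_valuationSubring I (RingHom.ker_ne_top _)
  have hlt : ∀ r : W.CoordinateRing, φ r = 0 → A.valuation (ι r) < 1 := fun r hr => by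
    refine A.mem_nonunits_iff.mp (hAI ⟨e r, ?_, rfl⟩)
    rw [SetLike.mem_coe, RingHom.mem_ker]
    simpa using hr
  refine ⟨⟨A, fun c => ?_, fun h => ?_⟩, hlt⟩
  · rw [IsScalarTower.algebraMap_apply ℂ W.CoordinateRing W.FunctionField]
    exact hA ⟨_, rfl⟩
  · let t : W.CoordinateRing := coordX W - algebraMap ℂ _ (φ (coordX W))
    have ht : t = algebraMap ℂ[X] _ (Polynomial.X - Polynomial.C (φ (coordX W))) := by
      rw [map_sub]; rfl
    have ht0 : ι t ≠ 0 := by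
      rw [map_ne_zero_iff _ hι, ht, map_ne_zero_iff _ (FaithfulSMul.algebraMap_injective _ _)]
      exact Polynomial.X_sub_C_ne_zero _
    have h1 := hlt t (by simp [t])
    have h2 : A.valuation (ι t)⁻¹ ≤ 1 := (A.valuation_le_one_iff _).mpr (h ▸ trivial)
    rw [map_inv₀, inv_le_one₀ (zero_lt_iff.mpr ((map_ne_zero _).mpr ht0))] at h2
    exact absurd h1 (not_lt.mpr h2)

/-- The linear system of the polar divisor of a morphism of degree `d` has dimension at most
`d`. -/
theorem exists_finrank_le_morphismDegree [W.IsElliptic] {f : W.FunctionField}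
    (hf : 2 ≤ morphismDegree f) :
    ∃ (V : Submodule ℂ W.FunctionField) (h : W.FunctionField), FiniteDimensional ℂ V ∧
      Module.finrank ℂ V ≤ morphismDegree f ∧ h ≠ 0 ∧
      ∀ z : W.FunctionField, (∀ P : Place W.FunctionField,
        P.localRing.valuation z ≤ max 1 (P.localRing.valuation f)) → z * h ∈ V := by
  obtain ⟨g, h, hg, hh, hh0, hfgh⟩ := exists_sections_eq_div hf
  set ι := algebraMap W.CoordinateRing W.FunctionField with hι
  have hιinj : Function.Injective ι := IsFractionRing.injective _ _
  have hle : ∀ z : W.FunctionField, ∀ P : Place W.FunctionField,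
      P.localRing.valuation z ≤ max 1 (P.localRing.valuation f) →
      P.localRing.valuation (z * ι h) ≤ P.localRing.valuation (ι h) ∨
        P.localRing.valuation (z * ι h) ≤ P.localRing.valuation (ι g) := by
    intro z P hz
    rw [map_mul, ← hfgh, map_mul]
    rcases le_max_iff.mp hz with h1 | h1
    · exact .inl (mul_le_of_le_one_left zero_le h1)
    · exact .inr (mul_le_mul_left h1 _)
  have hmem : ∀ m, 1 ≤ m → ι g ∈ sections W m → ι h ∈ sections W m → ∀ z : W.FunctionField,
      (∀ P : Place W.FunctionField,
        P.localRing.valuation z ≤ max 1 (P.localRing.valuation f)) → z * ι h ∈ sections W m :=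
    fun m hm hgm hhm z hz => mem_sections_of_forall_valuation_le hm fun P =>
      (hle z P (hz P)).elim (fun h1 => ⟨_, hhm, h1⟩) fun h1 => ⟨_, hgm, h1⟩
  have hιh : ι h ≠ 0 := (map_ne_zero_iff _ hιinj).mpr hh0
  -- Multiplication by `h` sends the linear system into the sections of order `deg f + 1`, one
  -- dimension too many. A common zero of `g` and `h` is inherited by the image and cuts out a
  -- proper subspace, which misses 1; without common zeros the sections of order `deg f` suffice.
  rcases exists_common_zero_or_mem_sections hf hh0 hfgh with ⟨φ, hφg, hφh⟩ | ⟨hg', hh'⟩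
  · let U : Submodule ℂ W.FunctionField := (LinearMap.ker φ.toLinearMap).map
      (IsScalarTower.toAlgHom ℂ W.CoordinateRing W.FunctionField).toLinearMap
    refine ⟨sections W (morphismDegree f + 1) ⊓ U, ι h, inferInstance, ?_, hιh, fun z hz => ?_⟩
    · have hlt : sections W (morphismDegree f + 1) ⊓ U < sections W (morphismDegree f + 1) := by
        refine lt_of_le_of_ne inf_le_left fun heq => ?_
        have h1 : ι 1 ∈ sections W (morphismDegree f + 1) := by
          refine mem_sections_of_natDegree_norm_le (by omega) ?_
          rw [map_one, Polynomial.natDegree_one]; omega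
        rw [← heq] at h1
        obtain ⟨r, hr, hr1⟩ := h1.2
        have hr2 : r = 1 := hιinj hr1
        rw [hr2] at hr
        have : φ 1 = 0 := hr
        rw [map_one] at this
        exact one_ne_zero this
      have := Submodule.finrank_lt_finrank_of_lt hlt
      rw [finrank_sections (by omega)] at this
      omega
    · have hzs := hmem _ (by omega) hg hh z hz
      refine ⟨hzs, ?_⟩
      obtain ⟨r, hr⟩ := exists_eq_algebraMap_of_mem_sections hzs
      refine ⟨r, ?_, hr.symm⟩
      obtain ⟨P, hP⟩ := exists_place_of_algHom φ
      by_contra hφr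
      have hφr : φ r ≠ 0 := hφr
      have h1 : P.localRing.valuation (ι r) < 1 := by
        rw [← hr]
        exact (hle z P (hz P)).elim (fun h1 => h1.trans_lt (hP h hφh))
          fun h1 => h1.trans_lt (hP g hφg)
      have h2 := hP (r - algebraMap ℂ _ (φ r)) (by simp)
      rw [map_sub, ← IsScalarTower.algebraMap_apply] at h2
      have h3 := Valuation.map_sub_lt _ h1 h2
      rw [sub_sub_cancel, P.valuation_algebraMap hφr] at h3
      exact lt_irrefl _ h3
  · exact ⟨sections W (morphismDegree f), ι h, inferInstance,
      (finrank_sections (by omega)).le, hιh, hmem _ (by omega) hg' hh'⟩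

end


/-! ### Morphisms with general values -/

section

open WeierstrassCurve.Affine
open scoped Polynomial

variable {W : WeierstrassCurve.Affine ℂ}

/-- The nonconstant generators `x`, `y`, `x ^ 2` of the sections with a pole of order at most
`4`. -/
def quarticSections (W : WeierstrassCurve.Affine ℂ) : Fin 3 → W.CoordinateRing :=
  ![coordX W, coordY W, coordX W ^ 2]

theorem algebraMap_quarticSections_mem (j : Fin 3) :
    algebraMap _ W.FunctionField (quarticSections W j) ∈ sections W 4 := by
  rw [mem_sections]
  fin_cases j
  · refine ⟨Polynomial.X, 0, ?_, by simp, by simp [quarticSections, coordX]⟩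
    rw [Polynomial.degree_X]; norm_num
  · refine ⟨0, 1, by rw [Polynomial.degree_zero]; exact WithBot.bot_lt_coe _, by simp,
      by simp [quarticSections]⟩
  · refine ⟨Polynomial.X ^ 2, 0, ?_, by simp, by simp [quarticSections, coordX]⟩
    rw [Polynomial.degree_X_pow]; norm_num

theorem exists_eq_sum_quarticSections {r : W.CoordinateRing}
    (hr : algebraMap _ W.FunctionField r ∈ sections W 4) :
    ∃ (a₀ : ℂ) (a : Fin 3 → ℂ), r = a₀ • 1 + ∑ j, a j • quarticSections W j := by
  obtain ⟨p, q, hp, hq, h⟩ := mem_sections.mp hr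
  have hr' := IsFractionRing.injective W.CoordinateRing W.FunctionField h
  have hp2 : p.degree ≤ 2 := Polynomial.degree_le_iff_coeff_zero _ _ |>.mpr fun n hn =>
    Polynomial.coeff_eq_zero_of_degree_lt (hp.trans_le (by
      have hn' : 2 < n := by exact_mod_cast hn
      exact_mod_cast (by omega : 4 / 2 + 1 ≤ n)))
  have hq0 : q.degree ≤ 0 := Polynomial.degree_le_iff_coeff_zero _ _ |>.mpr fun n hn =>
    Polynomial.coeff_eq_zero_of_degree_lt (hq.trans_le (by
      have hn' : 0 < n := by exact_mod_cast hn
      exact_mod_cast (by omega : (4 - 1) / 2 ≤ n)))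
  refine ⟨p.coeff 0, ![p.coeff 1, q.coeff 0, p.coeff 2], ?_⟩
  have hC : ∀ a : ℂ, algebraMap ℂ[X] W.CoordinateRing (Polynomial.C a) = algebraMap ℂ _ a :=
    fun a => rfl
  have hX : algebraMap ℂ[X] W.CoordinateRing Polynomial.X = coordX W := rfl
  rw [hr', Polynomial.eq_quadratic_of_degree_le_two hp2, Polynomial.eq_C_of_degree_le_zero hq0,
    Fin.sum_univ_three]
  simp only [map_add, map_mul, map_pow, hC, hX, quarticSections, Matrix.cons_val_zero,
    Matrix.cons_val_one, Matrix.cons_val_two, Matrix.tail_cons, Matrix.head_cons,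
    Algebra.smul_def, mul_one]
  simp
  ring

/-- The quotient of two sections with a pole of order at most `4` and a common zero does not take
general values at seven places. -/
theorem exists_ne_zero_of_seven_le_card {N : ℕ} (Q : Fin N → Place W.FunctionField)
    (I : Finset (Fin N)) (hI : 7 ≤ I.card) :
    ∃ Φ : MvPolynomial (Fin N) ℂ, Φ ≠ 0 ∧ ∀ π : Fin N → ℂ, eval π Φ ≠ 0 →
      ∀ (φ : W.CoordinateRing →ₐ[ℂ] ℂ) (g h : W.CoordinateRing), φ g = 0 → φ h = 0 →
        algebraMap _ W.FunctionField g ∈ sections W 4 →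
        algebraMap _ W.FunctionField h ∈ sections W 4 → h ≠ 0 →
        (∀ c : ℂ, algebraMap _ W.FunctionField g ≠ c • algebraMap _ _ h) →
        ¬ ∀ i ∈ I, (Q i).localRing.valuation
          (algebraMap _ W.FunctionField g / algebraMap _ _ h - algebraMap ℂ _ (π i)) < 1 := by
  classical
  have hK := trdeg_functionField W
  set ι := algebraMap W.CoordinateRing W.FunctionField with hι
  have hιinj : Function.Injective ι := IsFractionRing.injective _ _
  let V := sections W 4
  have hV : V ≠ ⊥ := fun h => by
    have : Module.finrank ℂ V = 4 := finrank_sections (by norm_num)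
    rw [h, finrank_bot] at this
    omega
  choose l hl0 hl using fun i => (Q i).exists_functional hK V hV
  -- When leading coefficients at a place vanish, the quotient comes from a space of dimension at
  -- most 3, for which six values already suffice.
  let U : Fin N → Submodule ℂ W.FunctionField := fun i => (LinearMap.ker (l i)).map V.subtype
  have hU : ∀ i, Module.finrank ℂ (U i) < 4 := fun i => by
    rw [← finrank_sections (W := W) (m := 4) (by norm_num), Submodule.finrank_map_subtype_eq]
    exact Submodule.finrank_lt fun h => hl0 i (LinearMap.ker_eq_top.mp h)
  choose Ψ hΨ0 hΨ using fun i => exists_ne_zero_of_two_mul_finrank_le_card hK Q I (U i)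
    (by have := hU i; omega)
  have h1V : ι 1 ∈ V := by
    refine mem_sections_of_natDegree_norm_le (by omega) ?_
    rw [map_one, Polynomial.natDegree_one]; omega
  let b : Fin 3 → V := fun j => ⟨ι (quarticSections W j), algebraMap_quarticSections_mem j⟩
  -- Vanishing at the point `φ` determines the constant term of a section from its other three
  -- coefficients, and substituting this into the leading coefficient gives the combination of the
  -- `φ (e i j)`. The coordinate ring is the parameter ring of the moving common zero, whence `d =
  -- 1` and `2 * 3 + 1 = 7`.
  let e : Fin N → Fin 3 → W.CoordinateRing := fun i j =>
    algebraMap ℂ _ (l i (b j)) - l i ⟨ι 1, h1V⟩ • quarticSections W j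
  obtain ⟨Φ, hΦ0, hΦ⟩ := exists_ne_zero_of_two_mul_add_le_card (d := 1) (n := 3)
    (by rw [trdeg_coordinateRing, Nat.cast_one]) I (Finset.card_pos.mp (by omega)) (by omega) e
  refine ⟨Φ * ∏ i, Ψ i, mul_ne_zero hΦ0 (Finset.prod_ne_zero_iff.mpr fun i _ => hΨ0 i),
    fun π hπ φ g h hφg hφh hg hh h0 hgh hval => ?_⟩
  rw [map_mul, map_prod] at hπ
  have hπ1 := left_ne_zero_of_mul hπ
  have hπ2 := fun i => Finset.prod_ne_zero_iff.mp (right_ne_zero_of_mul hπ) i (Finset.mem_univ i)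
  have hιh : ι h ≠ 0 := (map_ne_zero_iff _ hιinj).mpr h0
  have hv : ∀ i ∈ I, l i ⟨ι g, hg⟩ = π i * l i ⟨ι h, hh⟩ := fun i hi =>
    hl i ⟨ι g, hg⟩ ⟨ι h, hh⟩ (π i) hιh (hval i hi)
  have hexp : ∀ r : W.CoordinateRing, φ r = 0 → (hr : ι r ∈ V) → ∃ a : Fin 3 → ℂ, ∀ i,
      l i ⟨ι r, hr⟩ = ∑ j, a j * φ (e i j) := by
    intro r hφr hr
    obtain ⟨a₀, a, rfl⟩ := exists_eq_sum_quarticSections hr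
    refine ⟨a, fun i => ?_⟩
    have hφ0 : a₀ + ∑ j, a j * φ (quarticSections W j) = 0 := by
      simpa [map_add, map_sum] using hφr
    have hvec : (⟨_, hr⟩ : V) = a₀ • ⟨ι 1, h1V⟩ + ∑ j, a j • b j := by
      apply Subtype.ext
      simp only [Submodule.coe_add, Submodule.coe_smul, AddSubmonoidClass.coe_finsetSum, b,
        map_add, map_sum, Algebra.smul_def, map_mul, hι, ← IsScalarTower.algebraMap_apply]
    rw [hvec, map_add, map_sum]
    simp only [map_smul, smul_eq_mul, e, map_sub, AlgHom.commutes, Algebra.algebraMap_self,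
      RingHom.id_apply, mul_sub, Finset.sum_sub_distrib]
    have : ∑ j, a j * (l i ⟨ι 1, h1V⟩ * φ (quarticSections W j)) =
        l i ⟨ι 1, h1V⟩ * ∑ j, a j * φ (quarticSections W j) := by
      rw [Finset.mul_sum]; exact Finset.sum_congr rfl fun j _ => by ring
    rw [this]
    linear_combination l i ⟨ι 1, h1V⟩ * hφ0
  by_cases hz : ∃ i ∈ I, l i ⟨ι h, hh⟩ = 0
  · obtain ⟨i, hi, hi0⟩ := hz
    refine hΨ i π (hπ2 i) (ι g) ?_ (ι h) ?_ hιh hgh hval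
    · exact ⟨⟨ι g, hg⟩, by rw [SetLike.mem_coe, LinearMap.mem_ker, hv i hi, hi0, mul_zero], rfl⟩
    · exact ⟨⟨ι h, hh⟩, hi0, rfl⟩
  · push Not at hz
    obtain ⟨a, ha⟩ := hexp g hφg hg
    obtain ⟨a', ha'⟩ := hexp h hφh hh
    refine hΦ π hπ1 φ a a' (fun i hi => ?_) fun i hi => ?_
    · have := hz i hi
      rwa [ha'] at this
    · have := hv i hi
      rwa [ha, ha'] at this

/-- For general values, no morphism of degree `2`, `3` or `4`, in the latter case in a fixed linear
equivalence class, takes `4 + deg` of these values. -/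
theorem exists_ne_zero_forall_not_takes_values [W.IsElliptic] (D : Place W.FunctionField →₀ ℤ)
    {N : ℕ} (Q : Fin N → Place W.FunctionField) (I : Finset (Fin N)) :
    ∃ Φ : MvPolynomial (Fin N) ℂ, Φ ≠ 0 ∧ ∀ π : Fin N → ℂ, eval π Φ ≠ 0 →
      ∀ f : W.FunctionField, 2 ≤ morphismDegree f → morphismDegree f ≤ 4 →
        (morphismDegree f = 4 → PullbackIso f D) → 4 + morphismDegree f ≤ I.card →
        ¬ ∀ i ∈ I, (Q i).localRing.valuation (f - algebraMap ℂ _ (π i)) < 1 := by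
  have hK := trdeg_functionField W
  by_cases h6 : 6 ≤ I.card
  swap
  · exact ⟨1, one_ne_zero, fun π _ f h2 _ _ hc => by omega⟩
  -- The sections of order 3 settle degree 2, and also degree 3 when numerator and denominator have
  -- no common affine zero.
  obtain ⟨Φ₂, hΦ₂0, hΦ₂⟩ := exists_ne_zero_of_two_mul_finrank_le_card hK Q I (sections W 3)
    (by rw [finrank_sections (by norm_num)]; omega)
  obtain ⟨Φ₃, hΦ₃0, hΦ₃⟩ : ∃ Φ : MvPolynomial (Fin N) ℂ, Φ ≠ 0 ∧ (7 ≤ I.card → _) := by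
    by_cases h7 : 7 ≤ I.card
    · obtain ⟨Φ, h0, h⟩ := exists_ne_zero_of_seven_le_card Q I h7
      exact ⟨Φ, h0, fun _ => h⟩
    · exact ⟨1, one_ne_zero, fun h => absurd h h7⟩
  obtain ⟨Φ₄, hΦ₄0, hΦ₄⟩ : ∃ Φ : MvPolynomial (Fin N) ℂ, Φ ≠ 0 ∧ ∀ π : Fin N → ℂ, eval π Φ ≠ 0 →
      ∀ f : W.FunctionField, morphismDegree f = 4 → PullbackIso f D → 8 ≤ I.card →
        ¬ ∀ i ∈ I, (Q i).localRing.valuation (f - algebraMap ℂ _ (π i)) < 1 := by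
    by_cases h8 : 8 ≤ I.card
    swap
    · exact ⟨1, one_ne_zero, fun π _ f _ _ h => absurd h h8⟩
    by_cases hex : ∃ f₀ : W.FunctionField, morphismDegree f₀ = 4 ∧ PullbackIso f₀ D
    swap
    · exact ⟨1, one_ne_zero, fun π _ f hf hfD => absurd ⟨f, hf, hfD⟩ hex⟩
    obtain ⟨f₀, hf₀, hf₀D⟩ := hex
    -- A single morphism `f₀` of degree 4 in the class of `D` provides a space of dimension at most
    -- 4 that represents every other `f` in the class.
    obtain ⟨V, k, hVfin, hVrank, hk, hV⟩ := exists_finrank_le_morphismDegree (f := f₀) (by omega)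
    obtain ⟨Φ, hΦ0, hΦ⟩ := exists_ne_zero_of_two_mul_finrank_le_card hK Q I V (by omega)
    refine ⟨Φ, hΦ0, fun π hπ f hf hfD _ hval => ?_⟩
    obtain ⟨h, hh0, hh⟩ := hfD.exists_mul_valuation_le hf₀D
    have hhk : h * k ≠ 0 := mul_ne_zero hh0 hk
    have hdiv : f * h * k / (h * k) = f := by rw [mul_assoc, mul_div_cancel_right₀ _ hhk]
    refine hΦ π hπ (f * h * k) (hV _ fun P => (hh P).2) (h * k) (hV _ fun P => (hh P).1) hhk
      (fun c hc => algebraMap_ne_of_two_le_morphismDegree (f := f) (by omega) c ?_)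
      (by rwa [hdiv])
    rw [← hdiv, hc, Algebra.smul_def, mul_div_cancel_right₀ _ hhk]
  refine ⟨Φ₂ * Φ₃ * Φ₄, mul_ne_zero (mul_ne_zero hΦ₂0 hΦ₃0) hΦ₄0,
    fun π hπ f h2 h4 hD hcard hval => ?_⟩
  rw [map_mul, map_mul] at hπ
  have hπ4 := right_ne_zero_of_mul hπ
  have hπ2 := left_ne_zero_of_mul (left_ne_zero_of_mul hπ)
  have hπ3 := right_ne_zero_of_mul (left_ne_zero_of_mul hπ)
  obtain ⟨g, h, hg, hh, hh0, hfgh⟩ := exists_sections_eq_div h2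
  have hιh : algebraMap _ W.FunctionField h ≠ 0 :=
    (map_ne_zero_iff _ (IsFractionRing.injective _ _)).mpr hh0
  have hdiv : algebraMap _ W.FunctionField g / algebraMap _ _ h = f := by
    rw [← hfgh, mul_div_cancel_right₀ _ hιh]
  have hconst : ∀ c : ℂ, algebraMap _ W.FunctionField g ≠ c • algebraMap _ _ h := fun c hc =>
    algebraMap_ne_of_two_le_morphismDegree h2 c
      (by rw [← hdiv, hc, Algebra.smul_def, mul_div_cancel_right₀ _ hιh])
  obtain h | h | h : morphismDegree f = 2 ∨ morphismDegree f = 3 ∨ morphismDegree f = 4 := by omega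
  · rw [h] at hg hh
    exact hΦ₂ π hπ2 _ hg _ hh hιh hconst (by rwa [hdiv])
  · rcases exists_common_zero_or_mem_sections h2 hh0 hfgh with ⟨φ, hφg, hφh⟩ | ⟨hg', hh'⟩
    · rw [h] at hg hh
      exact hΦ₃ (by omega) π hπ3 φ g _ hφg hφh hg hh hh0 hconst (by rwa [hdiv])
    · rw [h] at hg' hh'
      exact hΦ₂ π hπ2 _ hg' _ hh' hιh hconst (by rwa [hdiv])
  · exact hΦ₄ π hπ4 f h (hD h) (by omega) hval

/-- General points of `ℙ¹` are not the values at given places of a morphism of small degree, in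
degree `4` within a fixed linear equivalence class, at `4 + deg` of these places. -/
theorem exists_points_forall_not_takesValue [W.IsElliptic] (D : Place W.FunctionField →₀ ℤ)
    {N : ℕ} (Q : Fin N → Place W.FunctionField) :
    ∃ p : Fin N → Fin 2 → ℂ, (∀ i, p i ≠ 0) ∧
      ¬ ∃ f : W.FunctionField, (2 ≤ morphismDegree f ∧ morphismDegree f ≤ 4 ∧
        (morphismDegree f = 4 → PullbackIso f D)) ∧
        4 + morphismDegree f ≤ {i | (Q i).TakesValue f (p i)}.ncard := by
  classical
  -- The places where the values are attained depend on `f`, so the conditions for all subsets of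
  -- places are multiplied together.
  choose Φ hΦ0 hΦ using exists_ne_zero_forall_not_takes_values D Q
  obtain ⟨π, hπ⟩ : ∃ π : Fin N → ℂ, eval π (∏ I, Φ I) ≠ 0 := by
    by_contra! h
    exact Finset.prod_ne_zero_iff.mpr (fun I _ => hΦ0 I)
      (MvPolynomial.funext (q := 0) fun x => by rw [h x, map_zero])
  rw [map_prod, Finset.prod_ne_zero_iff] at hπ
  refine ⟨fun i => ![π i, 1], fun i h => one_ne_zero (congrFun h 1), ?_⟩
  rintro ⟨f, ⟨h2, h4, hD⟩, hcard⟩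
  rw [Set.ncard_eq_toFinset_card'] at hcard
  refine hΦ _ π (hπ _ (Finset.mem_univ _)) f h2 h4 hD hcard fun i hi => ?_
  rw [Set.mem_toFinset] at hi
  rcases hi with ⟨-, h⟩ | ⟨h, -⟩
  · simpa using h
  · exact absurd h one_ne_zero

end

end PolarPolyhedra

end

theorem mainTheorem5 :
    PolarPolyhedra.Nondegenerate 3 3 2 8 ∧
    PolarPolyhedra.ForGeneralPoints 1 8 (fun p =>
      ¬ ∃ Γ, PolarPolyhedra.IsGrove p PolarPolyhedra.octad Γ) ∧
    (∀ (W : WeierstrassCurve ℂ) [W.IsElliptic]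
      (D : PolarPolyhedra.Place W.toAffine.FunctionField →₀ ℤ)
      (Q : Fin 8 → PolarPolyhedra.Place W.toAffine.FunctionField),
      (D.sum fun _ m => m) = 4 → Function.Injective Q →
      ∃ p : Fin 8 → Fin 2 → ℂ, (∀ i, p i ≠ 0) ∧
        ¬ ∃ f : W.toAffine.FunctionField,
          (2 ≤ PolarPolyhedra.morphismDegree f ∧ PolarPolyhedra.morphismDegree f ≤ 4 ∧
            (PolarPolyhedra.morphismDegree f = 4 → PolarPolyhedra.PullbackIso f D)) ∧
          4 + PolarPolyhedra.morphismDegree f ≤ {i | (Q i).TakesValue f (p i)}.ncard) := by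
  exact ⟨PolarPolyhedra.nondegenerate_three_three_two_eight,
    PolarPolyhedra.forGeneralPoints_not_exists_grove,
    fun W _ D Q _ _ => PolarPolyhedra.exists_points_forall_not_takesValue D Q⟩
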